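/- AuDaLa is Turing complete, by simulation of Turing machines. **Turing machines.** Let $T=(Q,q_0,F,\Gamma,\Sigma,B,\delta)$ be a deterministic Turing machine with finite $Q$ and $\Gamma$, $F\subseteq Q$, $\Sigma\subseteq\Gamma$, $B\in\Gamma\setminus\Sigma$ and a partial function $\delta:(Q\setminus F)\times\Gamma\rightharpoonup Q\times\Gamma\times\{L,R\}$. A configuration is a pair $(q,t)$ with $q\in Q$, $t:\mathbb Z\to\Gamma$, where cell $0$ is the head. If $\delta(q,t(0))=(q',s',D)$, then $(q,t)\to(q',t')$, where for $D=L$: $t'(1)=s'$ and $t'(i)=t(i-1)$ otherwise; for $D=R$: $t'(-1)=s'$ and $t'(i)=t(i+1)$ otherwise. If $\delta(q,t(0))$ is undefined, $T$ halts in $(q,t)$. Let $S=s_0\ldots s_n$ be a nonempty string over $\Sigma$, $C_0=(q_0,t_S)$ with $t_S(i)=s_i$ for $0\le i\le n$ and $t_S(i)=B$ otherwise, and let $C_0\to C_1\to\cdots$ be the (finite or infinite) run of $T$. $T$ accepts $S$ if the run ends in a configuration with state in $F$. **AuDaLa.** A program declares struct types, with typed parameters and with steps (lists of statements: `if E then {S}`,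 updates `x1.….xn.x := E`, local variable assignments `T x := E`, and constructor statements), and a schedule built from step calls, sequencing `<` and `Fix(·)`. A state consists of the remaining schedule, the struct instances with their pending commands, stacks and variable values, and a stability stack. Initially there is just one null-instance of each struct type, whose parameters have default values and cannot be changed. A scheduled step is executed by all instances whose struct type has it, in arbitrary interleaving of their commands (push, read, write, operator, construct, branch); new instances get an arbitrary fresh label. The next schedule item is considered only in an *idle* state, i.e. when no instance has commands left; $\mathrm{Fix}(sc)$ repeats $sc$ until an iteration creates no instance and changes no parameter. An execution ends in an idle state with empty schedule. **The program.** Number $Q$ and $\Gamma$ injectively by integers, $q_0$ and $B$ by $0$ (this is possible), and list the pairs $(q,s)$ where $\delta$ is defined, in any order. The program $I$ has struct types $\mathit{TapeCell}(\mathit{left},\mathit{right}:\mathit{TapeCell},\mathit{symbol}:\mathrm{Int})$ and $\mathit{Control}(\mathit{head}:\mathit{TapeCell},\mathit{state}:\mathrm{Int},\mathit{accepting}:\mathrm{Bool})$, the latter with steps *init* and *transition*, and schedule $\mathit{init}<\mathrm{Fix}(\mathit{transition})$. *init* creates a TapeCell for each $s_i$, links neighbours, and executes $\mathit{Control}(\mathit{cell}_0,0,(q_0\in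 F))$. *transition* is an if–else-if chain over the listed pairs $(q,s)$, with condition `state == q && head.symbol == s` and, for $\delta(q,s)=(q',s',R)$, the body `head.symbol := s'; state := q'; accepting := (q' ∈ F); if head != null && head.right == null then {head.right := TapeCell(head, null, 0)}; head := head.right` (symmetrically with `left` and `TapeCell(null, head, 0)` for $L$). An idle state $P$ with exactly one non-null instance $c$ of *Control* *corresponds to* $(q,t)$ if $c.\mathit{state}=q$, $c.\mathit{accepting}=(q\in F)$, and $t(i)=c.\mathit{head}.\mathit{right}^{\,i}.\mathit{symbol}$ for $i\ge0$, $t(i)=c.\mathit{head}.\mathit{left}^{-i}.\mathit{symbol}$ for $i<0$ (up to the numbering). **Theorem.** For every such $T$, every nonempty input $S$, and every such numbering and listing: 1. $I$ is a well-formed (well-typed) AuDaLa program; no execution of $I$ gets stuck, and every execution of a step ends after finitely many transitions. 2. Every reachable idle state in which execution of *init* has been started is reached by *init* followed by $k$ executions of *transition*, for some $k$. If $C_k$ exists, the state corresponds to $C_k$; otherwise $T$ halts in $C_{k-1}$ and the state corresponds to $C_{k-1}$. 3. Conversely, for every $k$ such that $C_k$ exists, an idle state that corresponds to $C_k$ is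 reached by *init* and $k$ executions of *transition*. Up to renaming of labels, all idle states reached by *init* and $k$ executions of *transition* have the same instances and parameter values; and if $T$ halts in $C_k$, then so do those reached with one more execution of *transition*. 4. If an execution of $I$ has ended, then $T$ halts on $S$, say in $C_k$; the execution consisted of *init* and $k+1$ executions of *transition*, and its last state corresponds to $C_k$. 5. $T$ halts on $S$ iff some execution of $I$ ends, and iff $I$ has no infinite execution. $T$ accepts $S$ iff some execution of $I$ ends with $\mathit{accepting}=\mathrm{true}$ in the non-null *Control* instance. -/

import Mathlib

/-! ## Turing machines -/

/-- The two directions. -/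
inductive Dir where
  | L
  | R
deriving DecidableEq

/-- A deterministic Turing machine with control states `Q` and tape symbols `Γ`. The transition
function is partial (`none` is undefined) and undefined on accepting states. -/
structure TM (Q Γ : Type*) where
  q0 : Q
  F : Finset Q
  inputSymbols : Finset Γ
  B : Γ
  blank_not_input : B ∉ inputSymbols
  δ : Q → Γ → Option (Q × Γ × Dir)
  δ_accepting : ∀ q ∈ F, ∀ s, δ q s = none

namespace TM

/-- A configuration: the control state, and the tape relative to the head (cell `0`). -/
structure Config (Q Γ : Type*) where
  state : Q
  tape : ℤ → Γ

variable {Q Γ : Type*}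

/-- The tape after writing `s'` on the head cell and moving the head in direction `D`. -/
def moveTape (t : ℤ → Γ) (s' : Γ) : Dir → ℤ → Γ
  | .L => fun i => if i = 1 then s' else t (i - 1)
  | .R => fun i => if i = -1 then s' else t (i + 1)

/-- The transition of `T` from a configuration; `none` if `T` halts there. -/
def next (T : TM Q Γ) (C : Config Q Γ) : Option (Config Q Γ) :=
  (T.δ C.state (C.tape 0)).map fun r => ⟨r.1, moveTape C.tape r.2.1 r.2.2⟩

/-- The tape `t_S`: the symbols of `S` in the cells `0, 1, …`, blank elsewhere. -/
def inputTape (T : TM Q Γ) (S : List Γ) (i : ℤ) : Γ :=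
  if 0 ≤ i then S.getD i.toNat T.B else T.B

def initialConfig (T : TM Q Γ) (S : List Γ) : Config Q Γ := ⟨T.q0, T.inputTape S⟩

/-- The configuration after exactly `k` transitions on input `S`, if `T` makes that many. -/
def configAt (T : TM Q Γ) (S : List Γ) : ℕ → Option (Config Q Γ)
  | 0 => some (T.initialConfig S)
  | k + 1 => (T.configAt S k).bind T.next

/-- `T` halts on `S`. -/
def Halts (T : TM Q Γ) (S : List Γ) : Prop :=
  ∃ k C, T.configAt S k = some C ∧ T.next C = none

/-- `T` accepts `S`: it halts in an accepting state. -/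
def Accepts (T : TM Q Γ) (S : List Γ) : Prop :=
  ∃ k C, T.configAt S k = some C ∧ T.next C = none ∧ C.state ∈ T.F

end TM

/-! ## The language AuDaLa: syntax -/

namespace AuDaLa

/-- Identifiers: a countably infinite set. Only equality of identifiers matters; those used below
have readable names. -/
inductive Ident where
  | TapeCell
  | left
  | right
  | symbol
  | Control
  | head
  | state
  | accepting
  | transition
  | init
  | cell (n : ℕ)
  | guard (n : ℕ)
  | other (n : ℕ)
deriving DecidableEq

/-- Types: the primitive types and the struct types. -/
inductive Ty where
  | nat
  | int
  | bool
  | string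
  | struct (s : Ident)
deriving DecidableEq

inductive Lit where
  | nat (n : ℕ)
  | int (z : ℤ)
  | bool (b : Bool)
  | string (s : String)

inductive BOp where
  | eq
  | ne
  | le
  | ge
  | lt
  | gt
  | mul
  | div
  | mod
  | add
  | sub
  | pow
  | and
  | or

/-- Expressions. `null` carries the type that its context gives it; `var [x₁, …, xₙ] x` is
`x₁.⋯.xₙ.x`; `cons s [E₁, …, Eₙ]` is the constructor expression `s(E₁, …, Eₙ)`. -/
inductive Expr where
  | this
  | null (T : Ty)
  | lit (l : Lit)
  | var (path : List Ident) (x : Ident)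
  | cons (s : Ident) (args : List Expr)
  | not (E : Expr)
  | op (o : BOp) (E₁ E₂ : Expr)

/-- Statements: `if E then {S}`, local variable assignment `T x := E`, update
`x₁.⋯.xₙ.x := E`, and the constructor statement `s(E₁, …, Eₙ)`. -/
inductive Stmt where
  | ifThen (E : Expr) (S : List Stmt)
  | decl (T : Ty) (x : Ident) (E : Expr)
  | assign (path : List Ident) (x : Ident) (E : Expr)
  | cons (s : Ident) (args : List Expr)

/-- Schedule items: `F`, `s.F` and `Fix(sc)`. A schedule `sc₁ < ⋯ < scₙ` is a list of items. -/
inductive SchedItem where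
  | call (F : Ident)
  | typedCall (s F : Ident)
  | fix (sc : List SchedItem)

structure StructDef where
  name : Ident
  pars : List (Ident × Ty)
  steps : List (Ident × List Stmt)

structure Program where
  structs : List StructDef
  sched : List SchedItem

namespace Program

def structDef (p : Program) (s : Ident) : Option StructDef :=
  p.structs.find? fun d => d.name = s

/-- The parameters of the struct type `s`. -/
def pars (p : Program) (s : Ident) : List (Ident × Ty) :=
  ((p.structDef s).map StructDef.pars).getD []

/-- The body of the step `F` of struct type `s`; empty if `s` has no such step. -/
def stepBody (p : Program) (s F : Ident) : List Stmt :=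
  ((p.structDef s).bind fun d => d.steps.lookup F).getD []

/-- The type of the parameter `x` of struct type `s`. -/
def parTy (p : Program) (s x : Ident) : Option Ty := (p.pars s).lookup x

end Program

/-! ## Well-formed programs -/

/-- The type of `E₁ o E₂` for operands of the given types. -/
def BOp.ty (o : BOp) (T U : Ty) : Option Ty :=
  match o with
  | .eq | .ne => if T = U then some .bool else none
  | .and | .or => if T = .bool ∧ U = .bool then some .bool else none
  | .le | .ge | .lt | .gt => if T = U ∧ (T = .nat ∨ T = .int) then some .bool else none
  | .mul | .div | .mod | .add | .sub | .pow =>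
      if T = U ∧ (T = .nat ∨ T = .int) then some T else none

def Lit.ty : Lit → Ty
  | .nat _ => .nat
  | .int _ => .int
  | .bool _ => .bool
  | .string _ => .string

/-- `T` is a primitive type or a struct type that is declared in `p`. -/
def Ty.Declared (p : Program) : Ty → Prop
  | .struct s => (p.structDef s).isSome
  | _ => True

/-- The type of `x₁.⋯.xₙ.x`, where `G` types the first identifier. -/
def Program.varTy (p : Program) (G : Ident → Option Ty) : List Ident → Ident → Option Ty
  | [], x => G x
  | y :: ys, x =>
      match G y with
      | some (.struct s) => p.varTy (p.parTy s) ys x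
      | _ => none

/-- Typing of expressions in a step of struct type `self`; `G` types the parameters of `self` and
the local variables in scope. -/
inductive HasTy (p : Program) (self : Ident) (G : Ident → Option Ty) : Expr → Ty → Prop
  | this : HasTy p self G .this (.struct self)
  | null {T : Ty} : T.Declared p → HasTy p self G (.null T) T
  | lit {l : Lit} : HasTy p self G (.lit l) l.ty
  | var {path : List Ident} {x : Ident} {T : Ty} :
      p.varTy G path x = some T → HasTy p self G (.var path x) T
  | cons {s : Ident} {args : List Expr} : (p.structDef s).isSome →
      List.Forall₂ (HasTy p self G) args ((p.pars s).map Prod.snd) →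
      HasTy p self G (.cons s args) (.struct s)
  | not {E : Expr} : HasTy p self G E .bool → HasTy p self G (.not E) .bool
  | op {o : BOp} {E₁ E₂ : Expr} {T U V : Ty} : HasTy p self G E₁ T → HasTy p self G E₂ U →
      o.ty T U = some V → HasTy p self G (.op o E₁ E₂) V

/-- Well-typed lists of statements. A local variable is declared before it is used, in scope until
the end of its block, and its name is new: neither a parameter of `self` nor another local variable
in scope. -/
inductive StmtsOK (p : Program) (self : Ident) : (Ident → Option Ty) → List Stmt → Prop
  | nil {G : Ident → Option Ty} : StmtsOK p self G []
  | ifThen {G : Ident → Option Ty} {E : Expr} {S r : List Stmt} : HasTy p self G E .bool →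
      StmtsOK p self G S → StmtsOK p self G r → StmtsOK p self G (.ifThen E S :: r)
  | decl {G : Ident → Option Ty} {T : Ty} {x : Ident} {E : Expr} {r : List Stmt} :
      T.Declared p → G x = none → HasTy p self G E T →
      StmtsOK p self (Function.update G x (some T)) r → StmtsOK p self G (.decl T x E :: r)
  | assign {G : Ident → Option Ty} {path : List Ident} {x : Ident} {T : Ty} {E : Expr}
      {r : List Stmt} : p.varTy G path x = some T → HasTy p self G E T →
      StmtsOK p self G r → StmtsOK p self G (.assign path x E :: r)
  | cons {G : Ident → Option Ty} {s : Ident} {args : List Expr} {r : List Stmt} :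
      HasTy p self G (.cons s args) (.struct s) →
      StmtsOK p self G r → StmtsOK p self G (.cons s args :: r)

/-- All steps that the schedule item calls are declared. -/
inductive SchedOK (p : Program) : SchedItem → Prop
  | call {F : Ident} {d : StructDef} : d ∈ p.structs → F ∈ d.steps.map Prod.fst →
      SchedOK p (.call F)
  | typedCall {F : Ident} {d : StructDef} : d ∈ p.structs → F ∈ d.steps.map Prod.fst →
      SchedOK p (.typedCall d.name F)
  | fix {sc : List SchedItem} : (∀ i ∈ sc, SchedOK p i) → SchedOK p (.fix sc)

/-- The static requirements on AuDaLa programs: unique names, and everything well typed. -/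
structure Program.WellFormed (p : Program) : Prop where
  structs_nodup : (p.structs.map StructDef.name).Nodup
  pars_nodup : ∀ d ∈ p.structs, (d.pars.map Prod.fst).Nodup
  steps_nodup : ∀ d ∈ p.structs, (d.steps.map Prod.fst).Nodup
  pars_declared : ∀ d ∈ p.structs, ∀ b ∈ d.pars, b.2.Declared p
  steps_ok : ∀ d ∈ p.structs, ∀ b ∈ d.steps, StmtsOK p d.name (p.parTy d.name) b.2
  sched_ok : ∀ i ∈ p.sched, SchedOK p i

/-! ## Operational semantics -/

/-- Labels of struct instances: one null-label for each struct type, and infinitely many others. -/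
inductive Label where
  | null (s : Ident)
  | ref (n : ℕ)
deriving DecidableEq

inductive Val where
  | nat (n : ℕ)
  | int (z : ℤ)
  | bool (b : Bool)
  | string (s : String)
  | label (ℓ : Label)
deriving DecidableEq

def Lit.val : Lit → Val
  | .nat n => .nat n
  | .int z => .int z
  | .bool b => .bool b
  | .string s => .string s

/-- The default value of a type, also the value of `null` at that type. -/
def Ty.defaultVal : Ty → Val
  | .nat => .nat 0
  | .int => .int 0
  | .bool => .bool false
  | .string => .string (String.ofList [])
  | .struct s => .label (.null s)

def BOp.evalInt (o : BOp) (a b : ℤ) : Option Val :=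
  match o with
  | .le => some (.bool (decide (a ≤ b)))
  | .ge => some (.bool (decide (b ≤ a)))
  | .lt => some (.bool (decide (a < b)))
  | .gt => some (.bool (decide (b < a)))
  | .mul => some (.int (a * b))
  | .div => if b = 0 then none else some (.int (a / b))
  | .mod => if b = 0 then none else some (.int (a % b))
  | .add => some (.int (a + b))
  | .sub => some (.int (a - b))
  | .pow => if b < 0 then none else some (.int (a ^ b.toNat))
  | _ => none

def BOp.evalNat (o : BOp) (a b : ℕ) : Option Val :=
  match o with
  | .le => some (.bool (decide (a ≤ b)))
  | .ge => some (.bool (decide (b ≤ a)))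
  | .lt => some (.bool (decide (a < b)))
  | .gt => some (.bool (decide (b < a)))
  | .mul => some (.nat (a * b))
  | .div => if b = 0 then none else some (.nat (a / b))
  | .mod => if b = 0 then none else some (.nat (a % b))
  | .add => some (.nat (a + b))
  | .sub => if a < b then none else some (.nat (a - b))
  | .pow => some (.nat (a ^ b))
  | _ => none

/-- The value of `v o w`; `none` where the operator is undefined. -/
def BOp.eval (o : BOp) (v w : Val) : Option Val :=
  match o with
  | .eq => some (.bool (decide (v = w)))
  | .ne => some (.bool (decide (v ≠ w)))
  | .and =>
      match v, w with
      | .bool a, .bool b => some (.bool (a && b))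
      | _, _ => none
  | .or =>
      match v, w with
      | .bool a, .bool b => some (.bool (a || b))
      | _, _ => none
  | o =>
      match v, w with
      | .int a, .int b => o.evalInt a b
      | .nat a, .nat b => o.evalNat a b
      | _, _ => none

/-- Commands that struct instances execute. -/
inductive Cmd where
  | push (v : Val)
  | pushThis
  | rd (x : Ident)
  | wr (x : Ident)
  | cons (s : Ident)
  | ifc (C : List Cmd)
  | not
  | op (o : BOp)

/-- The commands that put the label of `this.x₁.⋯.xₙ` on the stack. -/
def compilePath (path : List Ident) : List Cmd := Cmd.pushThis :: path.map Cmd.rd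

mutual

/-- The interpretation of expressions as commands. -/
def compileExpr : Expr → List Cmd
  | .this => [.pushThis]
  | .null T => [.push T.defaultVal]
  | .lit l => [.push l.val]
  | .var path x => compilePath path ++ [.rd x]
  | .cons s args => compileExprs args ++ [.cons s]
  | .not E => compileExpr E ++ [.not]
  | .op o E₁ E₂ => compileExpr E₁ ++ compileExpr E₂ ++ [.op o]

def compileExprs : List Expr → List Cmd
  | [] => []
  | E :: r => compileExpr E ++ compileExprs r

end

mutual

/-- The interpretation of statements as commands. -/
def compileStmt : Stmt → List Cmd
  | .ifThen E S => compileExpr E ++ [.ifc (compileStmts S)]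
  | .decl _ x E => compileExpr E ++ compilePath [] ++ [.wr x]
  | .assign path x E => compileExpr E ++ compilePath path ++ [.wr x]
  | .cons s args => compileExprs args ++ [.cons s]

def compileStmts : List Stmt → List Cmd
  | [] => []
  | Z :: r => compileStmt Z ++ compileStmts r

end

/-- A struct instance: its struct type, the commands it still has to execute, its stack (top
first), and the values of its parameters and local variables. -/
structure Instance where
  type : Ident
  cmds : List Cmd
  stack : List Val
  env : Ident → Option Val

/-- Struct environments. -/
abbrev Store := Label → Option Instance

/-- What remains of a schedule at run time: source items, and fixpoints that are being iterated. -/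
inductive Pending where
  | item (i : SchedItem)
  | aFix (sc : List SchedItem)

/-- A state: the remaining schedule, the struct environment, and the stability stack (top first),
with one entry for each fixpoint that is being iterated. -/
structure State where
  sched : List Pending
  store : Store
  stab : List Bool

/-- No struct instance is executing a step. -/
def State.Idle (P : State) : Prop := ∀ ℓ i, P.store ℓ = some i → i.cmds = []

/-- The execution of the program has ended. -/
def State.Final (P : State) : Prop := P.Idle ∧ P.sched = []

/-- The environment in which all parameters of `s` have default values. -/
def Program.nullEnv (p : Program) (s : Ident) : Ident → Option Val :=
  fun x => (p.parTy s x).map Ty.defaultVal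

/-- The environment of a new instance of `s` whose parameters get the values `vs`. -/
def Program.newEnv (p : Program) (s : Ident) (vs : List Val) : Ident → Option Val :=
  (((p.pars s).map Prod.fst).zip vs).foldl (fun ξ b => Function.update ξ b.1 (some b.2))
    (p.nullEnv s)

/-- The initial state: the struct instances are the null-instances. -/
def Program.initial (p : Program) : State where
  sched := p.sched.map Pending.item
  store := fun ℓ =>
    match ℓ with
    | .null s => if (p.structDef s).isSome then some ⟨s, [], [], p.nullEnv s⟩ else none
    | .ref _ => none
  stab := []

def Label.IsNull : Label → Prop
  | .null _ => True
  | .ref _ => False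

/-- The transitions between states. A transition that starts the execution of a step `F` is
labelled `some F`, all others are labelled `none`. -/
inductive Trans (p : Program) : State → Option Ident → State → Prop
  | push {P : State} {ℓ : Label} {s : Ident} {v : Val} {γ : List Cmd} {χ : List Val}
      {ξ : Ident → Option Val} :
      P.store ℓ = some ⟨s, .push v :: γ, χ, ξ⟩ →
      Trans p P none { P with store := Function.update P.store ℓ (some ⟨s, γ, v :: χ, ξ⟩) }
  | pushThis {P : State} {ℓ : Label} {s : Ident} {γ : List Cmd} {χ : List Val}
      {ξ : Ident → Option Val} :
      P.store ℓ = some ⟨s, .pushThis :: γ, χ, ξ⟩ →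
      Trans p P none
        { P with store := Function.update P.store ℓ (some ⟨s, γ, .label ℓ :: χ, ξ⟩) }
  | rd {P : State} {ℓ ℓ' : Label} {s x : Ident} {v : Val} {γ : List Cmd} {χ : List Val}
      {ξ : Ident → Option Val} {i' : Instance} :
      P.store ℓ = some ⟨s, .rd x :: γ, .label ℓ' :: χ, ξ⟩ →
      P.store ℓ' = some i' → i'.env x = some v →
      Trans p P none { P with store := Function.update P.store ℓ (some ⟨s, γ, v :: χ, ξ⟩) }
  /- The write is to a local variable, or to an instance that is not a null-instance. If it changes
  a parameter, the stability stack is reset. -/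
  | wr {P : State} {ℓ ℓ' : Label} {s x : Ident} {v : Val} {γ : List Cmd} {χ : List Val}
      {ξ : Ident → Option Val} {i' : Instance} {σ : Store} {su : Bool} :
      P.store ℓ = some ⟨s, .wr x :: γ, .label ℓ' :: v :: χ, ξ⟩ →
      σ = Function.update P.store ℓ (some ⟨s, γ, χ, ξ⟩) →
      σ ℓ' = some i' →
      (¬ ℓ'.IsNull ∨ p.parTy i'.type x = none) →
      (su = true ↔ (i'.env x = some v ∨ p.parTy i'.type x = none)) →
      Trans p P none
        { P with
          store := Function.update σ ℓ' (some { i' with env := Function.update i'.env x (some v) })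
          stab := P.stab.map fun b => b && su }
  /- Writes to parameters of null-instances have no effect. -/
  | wrSkip {P : State} {ℓ ℓ' : Label} {s x : Ident} {v : Val} {γ : List Cmd} {χ : List Val}
      {ξ : Ident → Option Val} {i' : Instance} :
      P.store ℓ = some ⟨s, .wr x :: γ, .label ℓ' :: v :: χ, ξ⟩ →
      P.store ℓ' = some i' → ℓ'.IsNull → (p.parTy i'.type x).isSome →
      Trans p P none { P with store := Function.update P.store ℓ (some ⟨s, γ, χ, ξ⟩) }
  | not {P : State} {ℓ : Label} {s : Ident} {b : Bool} {γ : List Cmd} {χ : List Val}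
      {ξ : Ident → Option Val} :
      P.store ℓ = some ⟨s, .not :: γ, .bool b :: χ, ξ⟩ →
      Trans p P none
        { P with store := Function.update P.store ℓ (some ⟨s, γ, .bool (!b) :: χ, ξ⟩) }
  | op {P : State} {ℓ : Label} {s : Ident} {o : BOp} {v w u : Val} {γ : List Cmd} {χ : List Val}
      {ξ : Ident → Option Val} :
      P.store ℓ = some ⟨s, .op o :: γ, w :: v :: χ, ξ⟩ → o.eval v w = some u →
      Trans p P none { P with store := Function.update P.store ℓ (some ⟨s, γ, u :: χ, ξ⟩) }
  | cons {P : State} {ℓ : Label} {n : ℕ} {s s' : Ident} {vs : List Val} {γ : List Cmd}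
      {χ : List Val} {ξ : Ident → Option Val} :
      P.store ℓ = some ⟨s, .cons s' :: γ, vs.reverse ++ χ, ξ⟩ →
      (p.structDef s').isSome → vs.length = (p.pars s').length → P.store (.ref n) = none →
      Trans p P none
        { P with
          store := Function.update
            (Function.update P.store ℓ (some ⟨s, γ, .label (.ref n) :: χ, ξ⟩))
            (.ref n) (some ⟨s', [], [], p.newEnv s' vs⟩)
          stab := P.stab.map fun _ => false }
  | ifTrue {P : State} {ℓ : Label} {s : Ident} {C γ : List Cmd} {χ : List Val}
      {ξ : Ident → Option Val} :
      P.store ℓ = some ⟨s, .ifc C :: γ, .bool true :: χ, ξ⟩ →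
      Trans p P none { P with store := Function.update P.store ℓ (some ⟨s, C ++ γ, χ, ξ⟩) }
  | ifFalse {P : State} {ℓ : Label} {s : Ident} {C γ : List Cmd} {χ : List Val}
      {ξ : Ident → Option Val} :
      P.store ℓ = some ⟨s, .ifc C :: γ, .bool false :: χ, ξ⟩ →
      Trans p P none { P with store := Function.update P.store ℓ (some ⟨s, γ, χ, ξ⟩) }
  | call {P : State} {F : Ident} {r : List Pending} :
      P.Idle → P.sched = .item (.call F) :: r →
      Trans p P (some F)
        { P with
          sched := r
          store := fun ℓ => (P.store ℓ).map fun i =>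
            ⟨i.type, compileStmts (p.stepBody i.type F), [], i.env⟩ }
  | typedCall {P : State} {s F : Ident} {r : List Pending} :
      P.Idle → P.sched = .item (.typedCall s F) :: r →
      Trans p P (some F)
        { P with
          sched := r
          store := fun ℓ => (P.store ℓ).map fun i =>
            if i.type = s then ⟨i.type, compileStmts (p.stepBody i.type F), [], i.env⟩ else i }
  | fixInit {P : State} {sc : List SchedItem} {r : List Pending} :
      P.Idle → P.sched = .item (.fix sc) :: r →
      Trans p P none
        { P with sched := sc.map Pending.item ++ .aFix sc :: r, stab := true :: P.stab }
  | fixIter {P : State} {sc : List SchedItem} {r : List Pending} {st : List Bool} :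
      P.Idle → P.sched = .aFix sc :: r → P.stab = false :: st →
      Trans p P none
        { P with sched := sc.map Pending.item ++ .aFix sc :: r, stab := true :: st }
  | fixTerm {P : State} {sc : List SchedItem} {r : List Pending} {st : List Bool} :
      P.Idle → P.sched = .aFix sc :: r → P.stab = true :: st →
      Trans p P none { P with sched := r, stab := st }

/-- `Reach p l P`: some execution of `p` leads from the initial state to `P`, and `l` lists the
steps whose execution was started on the way, in order. -/
inductive Reach (p : Program) : List Ident → State → Prop
  | initial : Reach p [] p.initial
  | trans {l : List Ident} {P P' : State} {a : Option Ident} :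
      Reach p l P → Trans p P a P' → Reach p (l ++ a.toList) P'

/-! ## The implementation of a Turing machine -/

section Implementation

variable {Q Γ : Type*}

/-- A numbering of the states and symbols of `T` by integers, with `0` for the initial state and
for the blank symbol, and a list of the pairs at which `δ` is defined. -/
structure Numbering (T : TM Q Γ) where
  stateCode : Q → ℤ
  stateCode_injective : Function.Injective stateCode
  stateCode_q0 : stateCode T.q0 = 0
  symbolCode : Γ → ℤ
  symbolCode_injective : Function.Injective symbolCode
  symbolCode_blank : symbolCode T.B = 0
  pairs : List (Q × Γ)
  pairs_nodup : pairs.Nodup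
  mem_pairs : ∀ q s, (q, s) ∈ pairs ↔ (T.δ q s).isSome

/-- The type `TapeCell`. -/
def cellTy : Ty := .struct .TapeCell

/-- `TapeCell(null, null, s)` -/
def newCell (s : ℤ) : Expr :=
  .cons .TapeCell [.null cellTy, .null cellTy, .lit (.int s)]

/-- The step `init` for the input string `w`:
`TapeCell cellᵢ := TapeCell(null, null, sᵢ)` for all `i`, then
`cellᵢ₊₁.left := cellᵢ; cellᵢ.right := cellᵢ₊₁` for all `i`, then
`Control(cell₀, 0, acc)`. -/
def initBody (w : List ℤ) (acc : Bool) : List Stmt :=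
  (w.mapIdx fun i s => Stmt.decl cellTy (.cell i) (newCell s)) ++
  ((List.range (w.length - 1)).flatMap fun i =>
    [Stmt.assign [.cell (i + 1)] .left (.var [] (.cell i)),
     Stmt.assign [.cell i] .right (.var [] (.cell (i + 1)))]) ++
  [Stmt.cons .Control [.var [] (.cell 0), .lit (.int 0), .lit (.bool acc)]]

/-- `state == q && head.symbol == s` -/
def clauseGuard (q s : ℤ) : Expr :=
  .op .and (.op .eq (.var [] .state) (.lit (.int q)))
    (.op .eq (.var [.head] .symbol) (.lit (.int s)))

/-- The parameter of `TapeCell` that leads to the next cell in the given direction. -/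
def dirPar : Dir → Ident
  | .L => .left
  | .R => .right

/-- The new cell in the given direction: `TapeCell(null, head, 0)` resp.
`TapeCell(head, null, 0)`. -/
def dirCell : Dir → Expr
  | .L => .cons .TapeCell [.null cellTy, .var [] .head, .lit (.int 0)]
  | .R => .cons .TapeCell [.var [] .head, .null cellTy, .lit (.int 0)]

/-- The body of the clause for the transition result `(q', s', D)`. -/
def clauseBody (q' s' : ℤ) (acc : Bool) (D : Dir) : List Stmt :=
  [.assign [.head] .symbol (.lit (.int s')),
   .assign [] .state (.lit (.int q')),
   .assign [] .accepting (.lit (.bool acc)),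
   .ifThen (.op .and (.op .ne (.var [] .head) (.null cellTy))
       (.op .eq (.var [.head] (dirPar D)) (.null cellTy)))
     [.assign [.head] (dirPar D) (dirCell D)],
   .assign [] .head (.var [.head] (dirPar D))]

/-- `if E₁ then {S₁} else if E₂ then {S₂} else …`, where `if E then {S} else {S'}` stands for
`Bool g := E; if g then {S}; if !g then {S'}` with a new local variable `g`. -/
def elseIfs (n : ℕ) : List (Expr × List Stmt) → List Stmt
  | [] => []
  | c :: r =>
    [.decl .bool (.guard n) c.1,
     .ifThen (.var [] (.guard n)) c.2,
     .ifThen (.not (.var [] (.guard n))) (elseIfs (n + 1) r)]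

variable [DecidableEq Q]

/-- The clause of the step `transition` for the pair `(q, s)`, if `δ` is defined there. -/
def clause (T : TM Q Γ) (N : Numbering T) (q : Q) (s : Γ) : Option (Expr × List Stmt) :=
  (T.δ q s).map fun r =>
    (clauseGuard (N.stateCode q) (N.symbolCode s),
     clauseBody (N.stateCode r.1) (N.symbolCode r.2.1) (decide (r.1 ∈ T.F)) r.2.2)

/-- The step `transition`. -/
def transitionBody (T : TM Q Γ) (N : Numbering T) : List Stmt :=
  elseIfs 0 (N.pairs.filterMap fun c => clause T N c.1 c.2)

/-- The AuDaLa program that implements `T` on the input string `S`; its schedule is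
`init < Fix(transition)`. -/
def impl (T : TM Q Γ) (N : Numbering T) (S : List Γ) : Program where
  structs :=
    [⟨.TapeCell, [(.left, cellTy), (.right, cellTy), (.symbol, .int)], []⟩,
     ⟨.Control, [(.head, cellTy), (.state, .int), (.accepting, .bool)],
       [(.transition, transitionBody T N),
        (.init, initBody (S.map N.symbolCode) (decide (T.q0 ∈ T.F)))]⟩]
  sched := [.call .init, .fix [.call .transition]]

end Implementation

/-! ## Implementation configurations -/

/-- `v.x`: the value of `x` in the struct instance that `v` refers to. -/
def Store.dot (σ : Store) (v : Option Val) (x : Ident) : Option Val :=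
  v.bind fun u =>
    match u with
    | .label ℓ => (σ ℓ).bind fun i => i.env x
    | _ => none

/-- `c.head.left⁻ⁱ.symbol` for `i < 0`, and `c.head.rightⁱ.symbol` for `i ≥ 0`. -/
def Store.tape (σ : Store) (c : Label) (i : ℤ) : Option Val :=
  σ.dot ((fun v => σ.dot v (if i < 0 then .left else .right))^[i.natAbs]
    (σ.dot (some (.label c)) .head)) .symbol

/-- `c` is the only instance of `Control` other than the null-instance. -/
def State.SoleControl (P : State) (c : Label) : Prop :=
  ∀ ℓ, (¬ ℓ.IsNull ∧ ∃ i, P.store ℓ = some i ∧ i.type = .Control) ↔ ℓ = c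

/-- `P` is an idle state with a single `Control` instance that is not null, and `(q, t)` is its
implementation configuration. -/
def State.HasImplConfig (P : State) (q : ℤ) (t : ℤ → ℤ) : Prop :=
  P.Idle ∧ ∃ c, P.SoleControl c ∧
    P.store.dot (some (.label c)) .state = some (.int q) ∧
    ∀ i, P.store.tape c i = some (.int (t i))

/-- The single `Control` instance of `P` that is not null has `b` as value of `accepting`. -/
def State.HasAccepting (P : State) (b : Bool) : Prop :=
  ∃ c, P.SoleControl c ∧ P.store.dot (some (.label c)) .accepting = some (.bool b)

/-- The idle state `P` corresponds to the configuration `C` of `T`: `C` is its implementation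
configuration, up to the numbering of states and symbols, and `accepting` tells whether the state
of `C` is accepting. -/
def Corresponds {Q Γ : Type*} [DecidableEq Q] {T : TM Q Γ} (N : Numbering T) (P : State)
    (C : TM.Config Q Γ) : Prop :=
  P.HasImplConfig (N.stateCode C.state) (fun i => N.symbolCode (C.tape i)) ∧
    P.HasAccepting (decide (C.state ∈ T.F))

/-- Renaming of the labels in values. -/
def Val.rename (ρ : Label ≃ Label) : Val → Val
  | .label ℓ => .label (ρ ℓ)
  | v => v

/-- `P` and `P'` have the same struct instances with the same parameter values, up to a renaming of
the labels that are not null-labels. -/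
def State.SameData (p : Program) (P P' : State) : Prop :=
  ∃ ρ : Label ≃ Label, (∀ s, ρ (.null s) = .null s) ∧
    ∀ ℓ, (P.store ℓ = none ↔ P'.store (ρ ℓ) = none) ∧
      ∀ i i', P.store ℓ = some i → P'.store (ρ ℓ) = some i' →
        i'.type = i.type ∧
          ∀ x, (p.parTy i.type x).isSome → i'.env x = (i.env x).map (Val.rename ρ)

/-- The steps started by an execution that runs `init` and then `k` times `transition`. -/
def runTrace (k : ℕ) : List Ident := .init :: List.replicate k .transition

end AuDaLa

/-! The program simulates the machine because the step `transition`, when it is executed in a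
state that encodes a configuration, ends in a state that encodes the next one, whatever the order
in which the commands are interleaved.

Single instances are verified with a weakest-precondition predicate `WP` on the part of the memory
that they use. Only two instances execute commands in `transition`: the `Control` instance that
simulates the machine, and the null-instance of `Control`. The latter has the initial state and a
blank under its head, so it may execute a clause too, but then all its writes go to parameters of
null-instances and have no effect. The two have only the null-instance of `TapeCell` in common,
which never changes. Therefore they do not interfere, and `Par.term` derives from their separate
verification that all their interleavings end, without getting stuck, and satisfy both
postconditions. The same result covers `init`, which only the null-instance of `Control` executes.

The encoding (`StateEncodes`) consists of a doubly linked tape of finitely many cells, labelled by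
an arbitrary injection, and of the null-instance of `TapeCell`, which represents the blanks at
both ends; `transition` adds a cell when the head leaves the tape (`term_transition`). As the head
always moves to a different cell, an execution of `transition` that simulates a transition changes
the parameter `head`, and so the fixpoint iterates; after the machine has halted, nothing changes,
and the fixpoint ends. The number of cells to the left and right of the head is a function of the
number of transitions (`modelAt`), which gives the uniqueness of the states up to a renaming of
labels (`StateEncodes.sameData`).

All statements about executions follow from `Reach.invariant`, the invariant of the reachable
states. It says that the current execution of a step is bound to end (`Term`) in a state that
encodes the right configuration. -/

namespace AuDaLa

/-! ### Execution of a single struct instance -/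

/-- What struct instances hold, without their commands and stacks: the struct type and the values of
parameters and local variables. A thread is verified against a part of the memory only: `ty` is
`none` at the labels outside that part, and the values of `get` there are meaningless. -/
structure Mem where
  ty : Label → Option Ident
  get : Label → Ident → Option Val

namespace Mem

/-- The memory after writing `v` to the variable `x` of the instance `ℓ`. -/
def set (μ : Mem) (ℓ : Label) (x : Ident) (v : Val) : Mem where
  ty := μ.ty
  get := Function.update μ.get ℓ (Function.update (μ.get ℓ) x (some v))

/-- The memory after creating an instance of `s` with label `n` and parameter values `vs`. -/
def alloc (p : Program) (μ : Mem) (n : ℕ) (s : Ident) (vs : List Val) : Mem where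
  ty := Function.update μ.ty (.ref n) (some s)
  get := Function.update μ.get (.ref n) (p.newEnv s vs)

@[simp] theorem ty_set (μ : Mem) (ℓ x v) : (μ.set ℓ x v).ty = μ.ty := rfl

theorem get_set (μ : Mem) (ℓ x v m y) :
    (μ.set ℓ x v).get m y = if m = ℓ ∧ y = x then some v else μ.get m y := by
  unfold set
  by_cases hm : m = ℓ
  · subst hm
    by_cases hy : y = x <;> simp [hy]
  · simp [hm]

theorem get_set_self (μ : Mem) (ℓ x v) : (μ.set ℓ x v).get ℓ x = some v := by simp [get_set]

theorem ty_alloc (p : Program) (μ : Mem) (n s vs m) :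
    (μ.alloc p n s vs).ty m = if m = .ref n then some s else μ.ty m := by
  simp [alloc, Function.update_apply]

theorem get_alloc (p : Program) (μ : Mem) (n s vs m) :
    (μ.alloc p n s vs).get m = if m = .ref n then p.newEnv s vs else μ.get m := by
  simp [alloc, Function.update_apply]

end Mem

/-- Weakest precondition: if the instance `ℓ` executes the commands with the given stack and memory,
and no other instance interferes with that memory, then it never gets stuck, and at the end the
memory and the stability flag satisfy `Φ`. The flag is true as long as the thread has created no
instance and has changed no parameter. In order that threads can share null-instances, writes to
these are allowed only if they are without effect, or concern local variables of `ℓ` itself. -/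
inductive WP (p : Program) (ℓ : Label) (Φ : Mem → Bool → Prop) :
    List Cmd → List Val → Mem → Bool → Prop
  | nil {χ : List Val} {μ : Mem} {su : Bool} : Φ μ su → WP p ℓ Φ [] χ μ su
  | push {v : Val} {γ : List Cmd} {χ : List Val} {μ : Mem} {su : Bool} :
      WP p ℓ Φ γ (v :: χ) μ su → WP p ℓ Φ (.push v :: γ) χ μ su
  | pushThis {γ : List Cmd} {χ : List Val} {μ : Mem} {su : Bool} :
      WP p ℓ Φ γ (.label ℓ :: χ) μ su → WP p ℓ Φ (.pushThis :: γ) χ μ su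
  | rd {ℓ' : Label} {x t : Ident} {v : Val} {γ : List Cmd} {χ : List Val} {μ : Mem} {su : Bool} :
      μ.ty ℓ' = some t → μ.get ℓ' x = some v → WP p ℓ Φ γ (v :: χ) μ su →
      WP p ℓ Φ (.rd x :: γ) (.label ℓ' :: χ) μ su
  | wr {ℓ' : Label} {x t : Ident} {v : Val} {γ : List Cmd} {χ : List Val} {μ : Mem} {su : Bool} :
      μ.ty ℓ' = some t → (¬ ℓ'.IsNull ∨ ℓ' = ℓ ∧ p.parTy t x = none) →
      WP p ℓ Φ γ χ (μ.set ℓ' x v)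
        (su && decide (μ.get ℓ' x = some v ∨ p.parTy t x = none)) →
      WP p ℓ Φ (.wr x :: γ) (.label ℓ' :: v :: χ) μ su
  | wrSkip {ℓ' : Label} {x t : Ident} {v : Val} {γ : List Cmd} {χ : List Val} {μ : Mem}
      {su : Bool} :
      μ.ty ℓ' = some t → ℓ'.IsNull → (p.parTy t x).isSome → WP p ℓ Φ γ χ μ su →
      WP p ℓ Φ (.wr x :: γ) (.label ℓ' :: v :: χ) μ su
  | not {b : Bool} {γ : List Cmd} {χ : List Val} {μ : Mem} {su : Bool} :
      WP p ℓ Φ γ (.bool (!b) :: χ) μ su → WP p ℓ Φ (.not :: γ) (.bool b :: χ) μ su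
  | op {o : BOp} {v w u : Val} {γ : List Cmd} {χ : List Val} {μ : Mem} {su : Bool} :
      o.eval v w = some u → WP p ℓ Φ γ (u :: χ) μ su → WP p ℓ Φ (.op o :: γ) (w :: v :: χ) μ su
  | cons {s : Ident} {vs : List Val} {γ : List Cmd} {χ χ' : List Val} {μ : Mem} {su : Bool} :
      (p.structDef s).isSome → vs.length = (p.pars s).length → χ' = vs.reverse ++ χ →
      (∀ n, μ.ty (.ref n) = none →
        WP p ℓ Φ γ (.label (.ref n) :: χ) (μ.alloc p n s vs) false) →
      WP p ℓ Φ (.cons s :: γ) χ' μ su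
  | ifTrue {C γ : List Cmd} {χ : List Val} {μ : Mem} {su : Bool} :
      WP p ℓ Φ (C ++ γ) χ μ su → WP p ℓ Φ (.ifc C :: γ) (.bool true :: χ) μ su
  | ifFalse {C γ : List Cmd} {χ : List Val} {μ : Mem} {su : Bool} :
      WP p ℓ Φ γ χ μ su → WP p ℓ Φ (.ifc C :: γ) (.bool false :: χ) μ su

theorem WP.post {p : Program} {ℓ : Label} {Φ : Mem → Bool → Prop} {χ : List Val} {μ : Mem}
    {su : Bool} (h : WP p ℓ Φ [] χ μ su) : Φ μ su := by
  cases h with | nil h => exact h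

/-- In the state `P`, the memory `μ` is in use by the instance `ℓ`, which has the commands `γ` and
the stack `χ`; all other instances in it are idle. -/
def State.Shows (P : State) (ℓ : Label) (γ : List Cmd) (χ : List Val) (μ : Mem) : Prop :=
  ∀ m t, μ.ty m = some t →
    P.store m = some ⟨t, if m = ℓ then γ else [], if m = ℓ then χ else [], μ.get m⟩

/-- The labels in use, other than null-labels, are finitely many, so that there are fresh ones. -/
def State.FiniteRefs (P : State) : Prop := {n | P.store (.ref n) ≠ none}.Finite

/-- What a command of the instance `ℓ` preserves: it changes nothing outside its memory `μ`, nor any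
other null-instance, and its new memory `μ'` differs in domain at most by a fresh label. -/
structure Frame (P P' : State) (ℓ : Label) (μ μ' : Mem) : Prop where
  sched : P'.sched = P.sched
  outside : ∀ m i, P.store m = some i → (μ.ty m = none ∨ m.IsNull ∧ m ≠ ℓ) → P'.store m = some i
  dom : ∀ m, P.store m = none → P'.store m ≠ none → μ'.ty m ≠ none
  grow : ∀ m, μ'.ty m ≠ none → μ.ty m ≠ none ∨ (P.store m = none ∧ ¬ m.IsNull)
  mono : ∀ m, μ.ty m ≠ none → μ'.ty m ≠ none
  fin : P.FiniteRefs → P'.FiniteRefs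

/-- The frame of a command that changes the instance `ℓ` only, and the memory only in values. -/
theorem Frame.update {sc : List Pending} {st st' : List Bool} {σ : Store} {ℓ : Label} {μ : Mem}
    {g : Label → Ident → Option Val} {i : Instance} (h : μ.ty ℓ ≠ none) (hs : σ ℓ ≠ none) :
    Frame ⟨sc, σ, st⟩ ⟨sc, Function.update σ ℓ (some i), st'⟩ ℓ μ ⟨μ.ty, g⟩ where
  sched := rfl
  outside m i hm hm' := by
    have : m ≠ ℓ := by rintro rfl; tauto
    simpa [Function.update_apply, this] using hm
  dom m hm hm' := by
    by_cases e : m = ℓ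
    · exact e ▸ h
    · simp [e] at hm'; exact absurd hm hm'
  grow m hm := .inl hm
  mono m hm := hm
  fin hf := by
    refine hf.subset fun n hn => ?_
    by_cases e : Label.ref n = ℓ
    · simpa [e] using hs
    · simpa [Function.update_apply, e] using hn

theorem State.Shows.update {sc : List Pending} {st st' : List Bool} {σ : Store} {ℓ : Label}
    {μ : Mem} {γ γ' : List Cmd} {χ χ' : List Val} {s : Ident} {ξ : Ident → Option Val}
    (h : State.Shows ⟨sc, σ, st⟩ ℓ γ χ μ) (hs : σ ℓ = some ⟨s, γ, χ, ξ⟩) (hμ : μ.ty ℓ ≠ none) :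
    State.Shows ⟨sc, Function.update σ ℓ (some ⟨s, γ', χ', ξ⟩), st'⟩ ℓ γ' χ' μ := by
  intro m t hm
  have := h m t hm
  by_cases e : m = ℓ
  · subst e
    simp only [hs, if_true, Option.some.injEq, Instance.mk.injEq] at this
    obtain ⟨rfl, -, -, rfl⟩ := this
    simp
  · simpa [e, Function.update_apply] using this

theorem State.Shows.at {P : State} {ℓ : Label}
    {μ : Mem} {γ : List Cmd} {χ : List Val} {s : Ident} {γ' : List Cmd} {χ' : List Val}
    {ξ : Ident → Option Val}
    (h : State.Shows P ℓ γ χ μ) (hs : P.store ℓ = some ⟨s, γ', χ', ξ⟩) (hμ : μ.ty ℓ ≠ none) :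
    μ.ty ℓ = some s ∧ γ' = γ ∧ χ' = χ ∧ μ.get ℓ = ξ := by
  obtain ⟨t, ht⟩ := Option.ne_none_iff_exists'.1 hμ
  have := h ℓ t ht
  rw [hs] at this
  simp at this
  obtain ⟨rfl, rfl, rfl, rfl⟩ := this
  exact ⟨ht, rfl, rfl, rfl⟩

/-- What a verified instance looks like after executing a command. -/
def Continues (p : Program) (ℓ : Label) (Φ : Mem → Bool → Prop) (P P' : State) (γ : List Cmd)
    (μ : Mem) (su : Bool) : Prop :=
  ∃ γ' χ' μ' d, sizeOf γ' < sizeOf γ ∧ WP p ℓ Φ γ' χ' μ' (su && d) ∧ P'.Shows ℓ γ' χ' μ' ∧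
    Frame P P' ℓ μ μ' ∧ P'.stab = P.stab.map fun b => b && d

theorem Continues.of_update {p : Program} {ℓ : Label} {Φ : Mem → Bool → Prop} {P : State}
    {γ γ' : List Cmd} {χ χ' : List Val} {s : Ident} {ξ : Ident → Option Val} {μ : Mem} {su : Bool}
    (hsh : P.Shows ℓ γ χ μ) (hs : P.store ℓ = some ⟨s, γ, χ, ξ⟩) (hμ : μ.ty ℓ ≠ none)
    (hlt : sizeOf γ' < sizeOf γ) (hwp : WP p ℓ Φ γ' χ' μ su) :
    Continues p ℓ Φ P { P with store := Function.update P.store ℓ (some ⟨s, γ', χ', ξ⟩) }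
      γ μ su := by
  refine ⟨γ', χ', μ, true, hlt, by simpa using hwp, hsh.update hs hμ, ?_, by simp⟩
  exact Frame.update hμ (by simp [hs])

theorem sizeOf_append_lt (C γ : List Cmd) : sizeOf (C ++ γ) < sizeOf (Cmd.ifc C :: γ) := by
  induction C with
  | nil => simp
  | cons c C ih => simp at ih ⊢; omega

/-- A transition from a state that is not idle executes a command of some instance `ℓ`, and keeps
`ℓ` verified if it was. -/
theorem Trans.thread {p : Program} {P P' : State} {a : Option Ident} (h : Trans p P a P')
    (hP : ¬ P.Idle) : a = none ∧ ∃ ℓ i, P.store ℓ = some i ∧ i.cmds ≠ [] ∧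
      ∀ Φ γ χ μ su, P.Shows ℓ γ χ μ → μ.ty ℓ ≠ none → WP p ℓ Φ γ χ μ su →
        Continues p ℓ Φ P P' γ μ su := by
  cases h with
  | push hs =>
    refine ⟨rfl, _, _, hs, by simp, fun Φ γ χ μ su hsh hμ hw => ?_⟩
    obtain ⟨-, rfl, rfl, rfl⟩ := hsh.at hs hμ
    cases hw with
    | push hw => exact .of_update hsh hs hμ (by simp) hw
  | pushThis hs =>
    refine ⟨rfl, _, _, hs, by simp, fun Φ γ χ μ su hsh hμ hw => ?_⟩
    obtain ⟨-, rfl, rfl, rfl⟩ := hsh.at hs hμ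
    cases hw with
    | pushThis hw => exact .of_update hsh hs hμ (by simp) hw
  | rd hs hs' hv =>
    refine ⟨rfl, _, _, hs, by simp, fun Φ γ χ μ su hsh hμ hw => ?_⟩
    obtain ⟨-, rfl, rfl, rfl⟩ := hsh.at hs hμ
    cases hw with
    | rd ht hg hw =>
      have := hsh _ _ ht
      rw [hs'] at this
      simp only [Option.some.injEq] at this
      subst this
      simp only [hg, Option.some.injEq] at hv
      subst hv
      exact .of_update hsh hs hμ (by simp) hw
  | @wr ℓ ℓ' s x v γ₀ χ₀ ξ i' σ su₀ hs hσ hs' hn hsu =>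
    refine ⟨rfl, _, _, hs, by simp, fun Φ γ χ μ su hsh hμ hw => ?_⟩
    obtain ⟨hty, rfl, rfl, rfl⟩ := hsh.at hs hμ
    have hsh' := hsh.update (st' := P.stab) (γ' := γ₀) (χ' := χ₀) hs hμ
    rw [← hσ] at hsh'
    have key : ∀ t, μ.ty ℓ' = some t → i'.type = t ∧ i'.env = μ.get ℓ' := by
      intro t ht
      have := hsh' _ _ ht
      simp only [hs', Option.some.injEq] at this
      subst this
      exact ⟨rfl, rfl⟩
    cases hw with
    | @wr _ _ t _ _ _ _ _ ht hn' hw =>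
      obtain ⟨h1, h2⟩ := key t ht
      rw [h1, h2] at hsu
      have hsu' : su₀ = decide (μ.get ℓ' x = some v ∨ p.parTy t x = none) := by
        rw [Bool.eq_iff_iff]; simpa using hsu
      refine ⟨γ₀, χ₀, _, su₀, by simp, by rw [hsu']; exact hw, ?_, ?_, rfl⟩
      · intro m t' hm
        have := hsh' m t' hm
        by_cases e : m = ℓ'
        · subst e
          simp only [hs', Option.some.injEq] at this
          subst this
          simp [Mem.set]
        · simpa [Mem.set, Function.update_apply, e] using this
      · have hl : σ ℓ' ≠ none := by simp [hs']
        have hd : ∀ m, σ m = none ↔ P.store m = none := by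
          intro m
          by_cases e : m = ℓ <;> simp [hσ, e, hs]
        refine ⟨rfl, fun m i hm hm' => ?_, fun m hm hm' => ?_, fun m hm => .inl hm, fun m hm => hm,
          fun hf => hf.subset fun n hn => ?_⟩
        · have h1 : m ≠ ℓ := by rintro rfl; tauto
          have h2 : m ≠ ℓ' := by
            rintro rfl
            rw [ht] at hm'
            simp at hm'
            tauto
          simpa [h1, h2, Function.update_apply, hσ] using hm
        · by_cases e : m = ℓ'
          · simp [e, ht]
          · simp [e, hd] at hm'; contradiction
        · by_cases e : Label.ref n = ℓ'
          · simpa [e, ← hd] using hl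
          · simpa [e, Function.update_apply, hd] using hn
    | @wrSkip _ _ t _ _ _ _ _ ht hn' hp hw =>
      obtain ⟨h1, h2⟩ := key t ht
      rw [h1] at hn
      rcases hn with hn | hn
      · exact absurd hn' hn
      · simp [hn] at hp
  | wrSkip hs hs' hn hp =>
    refine ⟨rfl, _, _, hs, by simp, fun Φ γ χ μ su hsh hμ hw => ?_⟩
    obtain ⟨-, rfl, rfl, rfl⟩ := hsh.at hs hμ
    cases hw with
    | wr ht hn' hw =>
      have := hsh _ _ ht
      rw [hs'] at this
      simp only [Option.some.injEq] at this
      subst this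
      rcases hn' with hn' | ⟨-, hn'⟩
      · exact absurd hn hn'
      · simp [hn'] at hp
    | wrSkip ht hn' hp hw => exact .of_update hsh hs hμ (by simp) hw
  | not hs =>
    refine ⟨rfl, _, _, hs, by simp, fun Φ γ χ μ su hsh hμ hw => ?_⟩
    obtain ⟨-, rfl, rfl, rfl⟩ := hsh.at hs hμ
    cases hw with
    | not hw => exact .of_update hsh hs hμ (by simp) hw
  | op hs ho =>
    refine ⟨rfl, _, _, hs, by simp, fun Φ γ χ μ su hsh hμ hw => ?_⟩
    obtain ⟨-, rfl, rfl, rfl⟩ := hsh.at hs hμ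
    cases hw with
    | op ho' hw =>
      rw [ho] at ho'
      cases ho'
      exact .of_update hsh hs hμ (by simp) hw
  | @cons ℓ n s s' vs γ₀ χ₀ ξ hs hd hl hn =>
    refine ⟨rfl, _, _, hs, by simp, fun Φ γ χ μ su hsh hμ hw => ?_⟩
    obtain ⟨hty, rfl, rfl, rfl⟩ := hsh.at hs hμ
    cases hw with
    | cons hd' hl' he hw =>
      obtain ⟨hr, rfl⟩ := List.append_inj he (by simp [hl, hl'])
      obtain rfl := List.reverse_injective hr
      have hn' : μ.ty (.ref n) = none := by
        by_contra h
        obtain ⟨t, ht⟩ := Option.ne_none_iff_exists'.1 h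
        simp [hsh _ _ ht] at hn
      have hne : Label.ref n ≠ ℓ := by rintro rfl; exact hμ hn'
      refine ⟨γ₀, _, _, false, by simp, by simpa using hw n hn', ?_, ?_, by simp⟩
      · intro m t hm
        rw [Mem.ty_alloc] at hm
        by_cases e : m = .ref n
        · subst e
          simp at hm
          simp [hm, Mem.alloc, hne]
        · simp [e] at hm
          simpa [e, Function.update_apply, Mem.alloc] using
            hsh.update (st' := P.stab) (γ' := γ₀) (χ' := .label (.ref n) :: χ₀) hs hμ m t hm
      · refine ⟨rfl, fun m i hm hm' => ?_, fun m hm hm' => ?_, fun m hm => ?_, fun m hm => ?_,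
          fun hf => ?_⟩
        · have h1 : m ≠ ℓ := by rintro rfl; tauto
          have h2 : m ≠ .ref n := by rintro rfl; simp [hn] at hm
          simpa [h1, h2, Function.update_apply] using hm
        · by_cases e : m = .ref n
          · simp [e, Mem.ty_alloc]
          · by_cases e' : m = ℓ
            · simp [e', hs] at hm
            · simp [e, e'] at hm'; contradiction
        · rw [Mem.ty_alloc] at hm
          by_cases e : m = .ref n
          · subst e; exact .inr ⟨hn, id⟩
          · exact .inl (by simpa [e] using hm)
        · rw [Mem.ty_alloc]; split_ifs <;> simp [hm]
        · refine (hf.insert n).subset fun k hk => ?_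
          by_cases e : k = n
          · simp [e]
          · by_cases e' : Label.ref k = ℓ
            · simp [e', hs]
            · simpa [e, e', Function.update_apply] using hk
  | ifTrue hs =>
    refine ⟨rfl, _, _, hs, by simp, fun Φ γ χ μ su hsh hμ hw => ?_⟩
    obtain ⟨-, rfl, rfl, rfl⟩ := hsh.at hs hμ
    cases hw with
    | ifTrue hw => exact .of_update hsh hs hμ (sizeOf_append_lt _ _) hw
  | ifFalse hs =>
    refine ⟨rfl, _, _, hs, by simp, fun Φ γ χ μ su hsh hμ hw => ?_⟩
    obtain ⟨-, rfl, rfl, rfl⟩ := hsh.at hs hμ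
    cases hw with
    | ifFalse hw => exact .of_update hsh hs hμ (by simp) hw
  | call hi => exact absurd hi hP
  | typedCall hi => exact absurd hi hP
  | fixInit hi => exact absurd hi hP
  | fixIter hi => exact absurd hi hP
  | fixTerm hi => exact absurd hi hP

/-- A verified instance that has commands left can execute the next one. -/
theorem WP.progress {p : Program} {ℓ : Label} {Φ : Mem → Bool → Prop} {P : State}
    {γ : List Cmd} {χ : List Val} {μ : Mem} {su : Bool} (hw : WP p ℓ Φ γ χ μ su)
    (hγ : γ ≠ []) (hsh : P.Shows ℓ γ χ μ) (hμ : μ.ty ℓ ≠ none) (hf : P.FiniteRefs) :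
    ∃ P', Trans p P none P' := by
  obtain ⟨s, hty⟩ := Option.ne_none_iff_exists'.1 hμ
  have hs := hsh _ _ hty
  simp only [if_true] at hs
  cases hw with
  | nil => exact absurd rfl hγ
  | push => exact ⟨_, .push hs⟩
  | pushThis => exact ⟨_, .pushThis hs⟩
  | rd ht hg => exact ⟨_, .rd hs (hsh _ _ ht) hg⟩
  | @wr ℓ' x t v γ χ _ _ ht hn =>
    have hsh' := hsh.update (st' := P.stab) (γ' := γ) (χ' := χ) hs hμ
    exact ⟨_, .wr (su := decide _) hs rfl (hsh' _ _ ht) (hn.imp id And.right) (by simp; rfl)⟩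
  | wrSkip ht hn hp => exact ⟨_, .wrSkip hs (hsh _ _ ht) hn hp⟩
  | not => exact ⟨_, .not hs⟩
  | op ho => exact ⟨_, .op hs ho⟩
  | cons hd hl he =>
    obtain ⟨n, hn⟩ := hf.exists_notMem
    subst he
    exact ⟨_, .cons (n := n) hs hd hl (by simpa using hn)⟩
  | @ifTrue C γ χ => exact ⟨_, .ifTrue hs⟩
  | ifFalse => exact ⟨_, .ifFalse hs⟩

/-! ### Two instances that run concurrently -/

/-- Every execution from `P` reaches an idle state after finitely many transitions without getting
stuck, and the first idle state satisfies `Ψ`. -/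
inductive Term (p : Program) (Ψ : State → Prop) : State → Prop
  | idle {P : State} : P.Idle → Ψ P → Term p Ψ P
  | step {P : State} : ¬ P.Idle → (∃ P', Trans p P none P') →
      (∀ a P', Trans p P a P' → a = none) → (∀ a P', Trans p P a P' → Term p Ψ P') → Term p Ψ P

/-- Two verified instances `ℓ₁` and `ℓ₂` that run concurrently and have only null-instances in
common. -/
structure Par (p : Program) (Φ₁ Φ₂ : Mem → Bool → Prop) (ℓ₁ ℓ₂ : Label) (sc : List Pending)
    (st : List Bool) (P : State) (γ₁ γ₂ : List Cmd) (χ₁ χ₂ : List Val) (μ₁ μ₂ : Mem)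
    (su₁ su₂ : Bool) : Prop where
  wp₁ : WP p ℓ₁ Φ₁ γ₁ χ₁ μ₁ su₁
  wp₂ : WP p ℓ₂ Φ₂ γ₂ χ₂ μ₂ su₂
  shows₁ : P.Shows ℓ₁ γ₁ χ₁ μ₁
  shows₂ : P.Shows ℓ₂ γ₂ χ₂ μ₂
  own₁ : μ₁.ty ℓ₁ ≠ none
  own₂ : μ₂.ty ℓ₂ ≠ none
  shared : ∀ m, μ₁.ty m ≠ none → μ₂.ty m ≠ none → m.IsNull ∧ m ≠ ℓ₁ ∧ m ≠ ℓ₂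
  dom : ∀ m, P.store m ≠ none → μ₁.ty m ≠ none ∨ μ₂.ty m ≠ none
  fin : P.FiniteRefs
  sched : P.sched = sc
  stab : P.stab = st.map fun b => b && (su₁ && su₂)

namespace Par

variable {p : Program} {Φ₁ Φ₂ : Mem → Bool → Prop} {ℓ₁ ℓ₂ : Label} {sc : List Pending}
  {st : List Bool} {P P' : State} {γ₁ γ₂ : List Cmd} {χ₁ χ₂ : List Val} {μ₁ μ₂ : Mem}
  {su₁ su₂ : Bool}

theorem symm (h : Par p Φ₁ Φ₂ ℓ₁ ℓ₂ sc st P γ₁ γ₂ χ₁ χ₂ μ₁ μ₂ su₁ su₂) :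
    Par p Φ₂ Φ₁ ℓ₂ ℓ₁ sc st P γ₂ γ₁ χ₂ χ₁ μ₂ μ₁ su₂ su₁ where
  wp₁ := h.wp₂
  wp₂ := h.wp₁
  shows₁ := h.shows₂
  shows₂ := h.shows₁
  own₁ := h.own₂
  own₂ := h.own₁
  shared m h₁ h₂ := by have := h.shared m h₂ h₁; tauto
  dom m hm := (h.dom m hm).symm
  fin := h.fin
  sched := h.sched
  stab := by rw [h.stab, Bool.and_comm su₂]

theorem step (h : Par p Φ₁ Φ₂ ℓ₁ ℓ₂ sc st P γ₁ γ₂ χ₁ χ₂ μ₁ μ₂ su₁ su₂)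
    (hc : Continues p ℓ₁ Φ₁ P P' γ₁ μ₁ su₁) :
    ∃ γ₁' χ₁' μ₁' su₁', sizeOf γ₁' < sizeOf γ₁ ∧
      Par p Φ₁ Φ₂ ℓ₁ ℓ₂ sc st P' γ₁' γ₂ χ₁' χ₂ μ₁' μ₂ su₁' su₂ := by
  obtain ⟨γ₁', χ₁', μ₁', d, hlt, hw, hsh, hF, hst⟩ := hc
  have hout : ∀ m i, P.store m = some i → μ₂.ty m ≠ none → P'.store m = some i := by
    intro m i hm hm₂
    refine hF.outside m i hm ?_
    by_cases h₁ : μ₁.ty m = none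
    · exact .inl h₁
    · have := h.shared m h₁ hm₂; tauto
  refine ⟨γ₁', χ₁', μ₁', _, hlt, hw, h.wp₂, hsh, ?_, hF.mono _ h.own₁, h.own₂, ?_, ?_, hF.fin h.fin,
    hF.sched.trans h.sched, ?_⟩
  · intro m t hm
    exact hout m _ (h.shows₂ m t hm) (by simp [hm])
  · intro m h₁ h₂
    rcases hF.grow m h₁ with h₁ | ⟨h₁, -⟩
    · exact h.shared m h₁ h₂
    · obtain ⟨t, ht⟩ := Option.ne_none_iff_exists'.1 h₂
      simp [h.shows₂ m t ht] at h₁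
  · intro m hm
    by_cases hm' : P.store m = none
    · exact .inl (hF.dom m hm' hm)
    · exact (h.dom m hm').imp (hF.mono m) id
  · rw [hst, h.stab, List.map_map]
    refine List.map_congr_left fun b _ => ?_
    cases b <;> cases d <;> cases su₁ <;> simp

/-- Concurrent instances that are verified separately run to the end, whatever the order in which
their commands are interleaved, and establish both postconditions. -/
theorem term {Ψ : State → Prop} (hΨ : ∀ P χ₁ χ₂ μ₁ μ₂ su₁ su₂, P.Idle →
      Par p Φ₁ Φ₂ ℓ₁ ℓ₂ sc st P [] [] χ₁ χ₂ μ₁ μ₂ su₁ su₂ → Ψ P)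
    (h : Par p Φ₁ Φ₂ ℓ₁ ℓ₂ sc st P γ₁ γ₂ χ₁ χ₂ μ₁ μ₂ su₁ su₂) : Term p Ψ P := by
  induction hN : sizeOf γ₁ + sizeOf γ₂ using Nat.strong_induction_on
    generalizing P γ₁ γ₂ χ₁ χ₂ μ₁ μ₂ su₁ su₂ with
  | _ N ih =>
  subst hN
  have hact : ∀ ℓ i, P.store ℓ = some i → i.cmds ≠ [] → ℓ = ℓ₁ ∨ ℓ = ℓ₂ := by
    intro ℓ i hi hc
    rcases h.dom ℓ (by simp [hi]) with hd | hd
    · obtain ⟨t, ht⟩ := Option.ne_none_iff_exists'.1 hd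
      left
      by_contra hne
      have := h.shows₁ ℓ t ht
      rw [hi] at this
      simp [hne] at this
      simp [this] at hc
    · obtain ⟨t, ht⟩ := Option.ne_none_iff_exists'.1 hd
      right
      by_contra hne
      have := h.shows₂ ℓ t ht
      rw [hi] at this
      simp [hne] at this
      simp [this] at hc
  obtain ⟨t₁, ht₁⟩ := Option.ne_none_iff_exists'.1 h.own₁
  obtain ⟨t₂, ht₂⟩ := Option.ne_none_iff_exists'.1 h.own₂
  by_cases hidle : P.Idle
  · have h₁ : γ₁ = [] := by simpa using hidle _ _ (h.shows₁ _ _ ht₁)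
    have h₂ : γ₂ = [] := by simpa using hidle _ _ (h.shows₂ _ _ ht₂)
    subst h₁ h₂
    exact .idle hidle (hΨ P _ _ _ _ _ _ hidle h)
  · refine .step hidle ?_ (fun a P' ht => (ht.thread hidle).1) fun a P' ht => ?_
    · by_cases h₁ : γ₁ = []
      · have h₂ : γ₂ ≠ [] := by
          rintro rfl
          subst h₁
          refine hidle fun ℓ i hi => ?_
          by_contra hc
          rcases hact ℓ i hi hc with rfl | rfl
          · rw [h.shows₁ _ _ ht₁] at hi
            simp at hi; simp [← hi] at hc
          · rw [h.shows₂ _ _ ht₂] at hi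
            simp at hi; simp [← hi] at hc
        exact h.wp₂.progress h₂ h.shows₂ h.own₂ h.fin
      · exact h.wp₁.progress h₁ h.shows₁ h.own₁ h.fin
    · obtain ⟨-, ℓ, i, hi, hc, hcont⟩ := ht.thread hidle
      rcases hact ℓ i hi hc with rfl | rfl
      · obtain ⟨γ', χ', μ', su', hlt, h'⟩ :=
          h.step (hcont _ _ _ _ _ h.shows₁ h.own₁ h.wp₁)
        exact ih _ (by omega) h' rfl
      · obtain ⟨γ', χ', μ', su', hlt, h'⟩ :=
          h.symm.step (hcont _ _ _ _ _ h.shows₂ h.own₂ h.wp₂)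
        exact ih _ (by omega) h'.symm rfl

end Par

/-! ### The declarations of the program -/

section

variable {Q Γ : Type*} [DecidableEq Q] (T : TM Q Γ) (N : Numbering T) (S : List Γ)

theorem structDef_tapeCell :
    (impl T N S).structDef .TapeCell =
      some ⟨.TapeCell, [(.left, cellTy), (.right, cellTy), (.symbol, .int)], []⟩ := by
  simp [Program.structDef, impl]

theorem structDef_control :
    (impl T N S).structDef .Control =
      some ⟨.Control, [(.head, cellTy), (.state, .int), (.accepting, .bool)],
       [(.transition, transitionBody T N),
        (.init, initBody (S.map N.symbolCode) (decide (T.q0 ∈ T.F)))]⟩ := by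
  simp [Program.structDef, impl]

theorem structDef_eq_none {s : Ident} (h₁ : s ≠ .TapeCell) (h₂ : s ≠ .Control) :
    (impl T N S).structDef s = none := by
  simp [Program.structDef, impl, h₁.symm, h₂.symm]

theorem pars_tapeCell :
    (impl T N S).pars .TapeCell = [(.left, cellTy), (.right, cellTy), (.symbol, .int)] := by
  simp [Program.pars, structDef_tapeCell]

theorem pars_control :
    (impl T N S).pars .Control = [(.head, cellTy), (.state, .int), (.accepting, .bool)] := by
  simp [Program.pars, structDef_control]

theorem parTy_tapeCell (x : Ident) :
    (impl T N S).parTy .TapeCell x =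
      if x = .left ∨ x = .right then some cellTy else if x = .symbol then some .int else none := by
  simp only [Program.parTy, pars_tapeCell]
  cases x <;> simp [List.lookup] <;> rfl

theorem parTy_control (x : Ident) :
    (impl T N S).parTy .Control x =
      if x = .head then some cellTy else if x = .state then some .int
        else if x = .accepting then some .bool else none := by
  simp only [Program.parTy, pars_control]
  cases x <;> simp [List.lookup] <;> rfl

theorem newEnv_tapeCell (u v w : Val) (x : Ident) :
    (impl T N S).newEnv .TapeCell [u, v, w] x =
      if x = .left then some u else if x = .right then some v
        else if x = .symbol then some w else none := by
  simp only [Program.newEnv, pars_tapeCell]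
  cases x <;> simp [Program.nullEnv, parTy_tapeCell]

theorem newEnv_control (u v w : Val) (x : Ident) :
    (impl T N S).newEnv .Control [u, v, w] x =
      if x = .head then some u else if x = .state then some v
        else if x = .accepting then some w else none := by
  simp only [Program.newEnv, pars_control]
  cases x <;> simp [Program.nullEnv, parTy_control]

theorem stepBody_init :
    (impl T N S).stepBody .Control .init =
      initBody (S.map N.symbolCode) (decide (T.q0 ∈ T.F)) := by
  simp [Program.stepBody, structDef_control, List.lookup]
  rfl

theorem stepBody_transition :
    (impl T N S).stepBody .Control .transition = transitionBody T N := by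
  simp [Program.stepBody, structDef_control, List.lookup]

theorem stepBody_tapeCell (F : Ident) : (impl T N S).stepBody .TapeCell F = [] := by
  simp [Program.stepBody, structDef_tapeCell]

/-! ### The program is well-formed -/

theorem hasTy_newCell (self : Ident) (G : Ident → Option Ty) (s : ℤ) :
    HasTy (impl T N S) self G (newCell s) cellTy := by
  refine .cons (by simp [structDef_tapeCell]) ?_
  rw [pars_tapeCell]
  refine .cons (.null ?_) (.cons (.null ?_) (.cons .lit .nil)) <;>
    simp [Ty.Declared, structDef_tapeCell, cellTy]

theorem cellTy_declared : cellTy.Declared (impl T N S) := by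
  simp [cellTy, Ty.Declared, structDef_tapeCell]

theorem stmtsOK_elseIfs {G : Ident → Option Ty} (hh : G .head = some cellTy)
    (hs : G .state = some .int) (ha : G .accepting = some .bool) (n : ℕ)
    (hG : ∀ m, n ≤ m → G (.guard m) = none) (L : List (Q × Γ)) :
    StmtsOK (impl T N S) .Control G
      (elseIfs n (L.filterMap fun c => clause T N c.1 c.2)) := by
  induction L generalizing G n with
  | nil => exact .nil
  | cons c L ih =>
    rw [List.filterMap_cons]
    cases hc : clause T N c.1 c.2 with
    | none => exact ih hh hs ha n hG
    | some e =>
      obtain ⟨r, -, rfl⟩ := Option.map_eq_some_iff.1 hc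
      simp only [elseIfs]
      have hsym : (impl T N S).varTy G [.head] .symbol = some .int := by
        simp [Program.varTy, hh, cellTy, parTy_tapeCell]
      refine .decl trivial (hG n le_rfl) ?_ ?_
      · exact .op (.op (.var hs) .lit rfl) (.op (.var hsym) .lit rfl) rfl
      · set G' := Function.update G (.guard n) (some Ty.bool) with hG'
        have hh' : G' .head = some cellTy := by simpa [hG']
        have hs' : G' .state = some .int := by simpa [hG']
        have ha' : G' .accepting = some .bool := by simpa [hG']
        have hg' : G' (.guard n) = some .bool := by simp [hG']
        have hsym' : (impl T N S).varTy G' [.head] .symbol = some .int := by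
          simp [Program.varTy, hh', cellTy, parTy_tapeCell]
        have hdir : (impl T N S).varTy G' [.head] (dirPar r.2.2) = some cellTy := by
          cases r.2.2 <;> simp [Program.varTy, hh', cellTy, parTy_tapeCell, dirPar]
        have hnull : HasTy (impl T N S) .Control G' (.null cellTy) cellTy :=
          .null (cellTy_declared T N S)
        have hcell : HasTy (impl T N S) .Control G' (dirCell r.2.2) cellTy := by
          cases r.2.2 <;> refine .cons (by simp [structDef_tapeCell]) ?_ <;> rw [pars_tapeCell]
          · exact .cons hnull (.cons (.var hh') (.cons .lit .nil))
          · exact .cons (.var hh') (.cons hnull (.cons .lit .nil))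
        refine .ifThen (.var hg') ?_ (.ifThen (.not (.var hg')) ?_ .nil)
        · refine .assign hsym' .lit (.assign hs' .lit (.assign ha' .lit (.ifThen ?_ ?_ ?_)))
          · exact .op (.op (.var hh') hnull (by simp [BOp.ty]; rfl))
              (.op (.var hdir) hnull (by simp [BOp.ty]; rfl)) rfl
          · exact .assign hdir hcell .nil
          · exact .assign hh' (.var hdir) .nil
        · refine ih hh' hs' ha' (n + 1) fun m hm => ?_
          simp [hG', hG m (by omega), show m ≠ n by omega]

/-- The part of `init` after the declarations of the local variables is well typed. -/
theorem stmtsOK_links {G : Ident → Option Ty} (w : ℕ) (hw : 0 < w)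
    (hG : ∀ i, i < w → G (.cell i) = some cellTy) (acc : Bool) (L : List ℕ)
    (hL : ∀ i ∈ L, i + 1 < w) :
    StmtsOK (impl T N S) .Control G ((L.flatMap fun i =>
      [Stmt.assign [.cell (i + 1)] .left (.var [] (.cell i)),
       Stmt.assign [.cell i] .right (.var [] (.cell (i + 1)))]) ++
      [Stmt.cons .Control [.var [] (.cell 0), .lit (.int 0), .lit (.bool acc)]]) := by
  induction L with
  | nil =>
    refine .cons (.cons (by simp [structDef_control]) ?_) .nil
    rw [pars_control]
    exact .cons (.var (hG 0 hw)) (.cons .lit (.cons .lit .nil))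
  | cons i L ih =>
    have hi := hL i (by simp)
    refine .assign (T := cellTy) ?_ (.var (hG i (by omega))) (.assign (T := cellTy) ?_
      (.var (hG (i + 1) hi)) (ih fun j hj => hL j (by simp [hj])))
    · simp [Program.varTy, hG (i + 1) hi, cellTy, parTy_tapeCell]
    · simp [Program.varTy, hG i (by omega), cellTy, parTy_tapeCell]

theorem stmtsOK_decls {G : Ident → Option Ty} (w : List ℤ) (k : ℕ)
    (hG : ∀ i, G (.cell i) = if i < k then some cellTy else none) (r : List Stmt)
    (hr : ∀ G' : Ident → Option Ty, (∀ i, i < k + w.length → G' (.cell i) = some cellTy) →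
      StmtsOK (impl T N S) .Control G' r) :
    StmtsOK (impl T N S) .Control G
      ((w.mapIdx fun i s => Stmt.decl cellTy (.cell (k + i)) (newCell s)) ++ r) := by
  induction w generalizing G k with
  | nil => exact hr G fun i hi => by simpa [hG] using hi
  | cons s w ih =>
    rw [List.mapIdx_cons]
    refine .decl (cellTy_declared T N S) (by simp [hG]) (hasTy_newCell T N S _ _ s) ?_
    have := ih (G := Function.update G (.cell k) (some cellTy)) (k + 1) (fun i => ?_)
      (fun G' h => hr G' fun i hi => h i (by simp at hi; omega))
    · simpa [add_assoc, add_comm, add_left_comm] using this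
    · by_cases h : i = k
      · simp [h]
      · simp only [Function.update_apply, Ident.cell.injEq, h, if_false, hG]
        congr 1
        simp; omega

theorem impl_wellFormed (hS : S ≠ []) : (impl T N S).WellFormed where
  structs_nodup := by simp [impl]
  pars_nodup := by simp [impl]
  steps_nodup := by simp [impl]
  pars_declared := by
    have := cellTy_declared T N S
    intro d hd
    simp only [impl, List.mem_cons, List.not_mem_nil, or_false] at hd
    rcases hd with rfl | rfl <;> simp [this] <;> simp [Ty.Declared]
  steps_ok := by
    intro d hd
    simp only [impl, List.mem_cons, List.not_mem_nil, or_false] at hd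
    rcases hd with rfl | rfl
    · simp
    · intro b hb
      simp only [List.mem_cons, List.not_mem_nil, or_false] at hb
      rcases hb with rfl | rfl
      · exact stmtsOK_elseIfs T N S (by simp [parTy_control]) (by simp [parTy_control])
          (by simp [parTy_control]) 0 (by simp [parTy_control]) _
      · have hlen : 0 < S.length := List.length_pos_of_ne_nil hS
        simp only [initBody, List.append_assoc]
        have := stmtsOK_decls T N S (G := (impl T N S).parTy .Control) (S.map N.symbolCode) 0
          (by simp [parTy_control]) _ (fun G' h => stmtsOK_links T N S S.length hlen
            (by simpa using h) (decide (T.q0 ∈ T.F)) (List.range (S.length - 1))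
            (by simp; omega))
        simpa using this
  sched_ok := by
    have hd : (impl T N S).structs.getLast (by simp [impl]) ∈ (impl T N S).structs :=
      List.getLast_mem _
    intro i hi
    simp only [impl, List.mem_cons, List.not_mem_nil, or_false] at hi
    rcases hi with rfl | rfl
    · exact .call hd (by simp [impl])
    · refine .fix fun j hj => ?_
      simp only [List.mem_cons, List.not_mem_nil, or_false] at hj
      subst hj
      exact .call hd (by simp [impl])

end

theorem nonempty_numbering {Q Γ : Type*} [Fintype Q] [Fintype Γ] (T : TM Q Γ) :
    Nonempty (Numbering T) := by
  classical
  let e := Fintype.equivFin Q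
  let f := Fintype.equivFin Γ
  -- shifting an enumeration moves the code of the chosen element to `0`
  exact ⟨{
    stateCode := fun q => (e q : ℤ) - e T.q0
    stateCode_injective := fun a b h => e.injective (Fin.ext (by simpa using h))
    stateCode_q0 := by simp
    symbolCode := fun s => (f s : ℤ) - f T.B
    symbolCode_injective := fun a b h => f.injective (Fin.ext (by simpa using h))
    symbolCode_blank := by simp
    pairs := (Finset.univ.filter fun c : Q × Γ => (T.δ c.1 c.2).isSome).toList
    pairs_nodup := Finset.nodup_toList _
    mem_pairs := by simp }⟩

/-! ### Tapes in memory -/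

/-- The label of the cell `i` of a tape whose cells `a, …, b` exist and have the labels given by
`lab`; outside, it is the null-label. -/
def link (lab : ℤ → ℕ) (a b i : ℤ) : Label :=
  if a ≤ i ∧ i ≤ b then .ref (lab i) else .null .TapeCell

/-- The memory holds a doubly linked tape with the cells `a, …, b` and the symbols `sym`, together
with the null-instance of `TapeCell`, which acts as an unlimited supply of blank cells. Apart from
null-instances, the only other instance is `c`. -/
structure TapeMem (μ : Mem) (c : ℕ) (lab : ℤ → ℕ) (a b : ℤ) (sym : ℤ → ℤ) : Prop where
  null_ty : μ.ty (.null .TapeCell) = some .TapeCell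
  null_left : μ.get (.null .TapeCell) .left = some (.label (.null .TapeCell))
  null_right : μ.get (.null .TapeCell) .right = some (.label (.null .TapeCell))
  null_symbol : μ.get (.null .TapeCell) .symbol = some (.int 0)
  null_none : ∀ s, s ≠ .TapeCell → s ≠ .Control → μ.ty (.null s) = none
  ty : ∀ i, a ≤ i → i ≤ b → μ.ty (.ref (lab i)) = some .TapeCell
  left : ∀ i, a ≤ i → i ≤ b → μ.get (.ref (lab i)) .left = some (.label (link lab a b (i - 1)))
  right : ∀ i, a ≤ i → i ≤ b → μ.get (.ref (lab i)) .right = some (.label (link lab a b (i + 1)))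
  symbol : ∀ i, a ≤ i → i ≤ b → μ.get (.ref (lab i)) .symbol = some (.int (sym i))
  inj : ∀ i j, a ≤ i → i ≤ b → a ≤ j → j ≤ b → lab i = lab j → i = j
  ne : ∀ i, a ≤ i → i ≤ b → lab i ≠ c
  dom : ∀ n, μ.ty (.ref n) ≠ none → n = c ∨ ∃ i, a ≤ i ∧ i ≤ b ∧ n = lab i
  blank : ∀ i, ¬ (a ≤ i ∧ i ≤ b) → sym i = 0

/-- The memory holds a `Control` instance `ref c` with the given parameter values. -/
structure ControlMem (μ : Mem) (c : ℕ) (h : Label) (q : ℤ) (acc : Bool) : Prop where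
  ty : μ.ty (.ref c) = some .Control
  head : μ.get (.ref c) .head = some (.label h)
  state : μ.get (.ref c) .state = some (.int q)
  accepting : μ.get (.ref c) .accepting = some (.bool acc)

/-- The memory encodes a configuration: a tape with the head on cell `0`, and the `Control`
instance `ref c` that refers to it. -/
structure Encodes (μ : Mem) (c : ℕ) (lab : ℤ → ℕ) (e : ℤ × ℤ) (q : ℤ) (acc : Bool)
    (sym : ℤ → ℤ) : Prop where
  tape : TapeMem μ c lab e.1 e.2 sym
  control : ControlMem μ c (.ref (lab 0)) q acc
  nonpos : e.1 ≤ 0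
  nonneg : 0 ≤ e.2

namespace TapeMem

variable {μ : Mem} {c : ℕ} {lab : ℤ → ℕ} {a b : ℤ} {sym : ℤ → ℤ}

theorem congr (h : TapeMem μ c lab a b sym) {μ' : Mem}
    (ht : ∀ m, m ≠ .null .Control → μ'.ty m = μ.ty m)
    (hg : ∀ m, m ≠ .null .Control → m ≠ .ref c → μ.ty m ≠ none → μ'.get m = μ.get m) :
    TapeMem μ' c lab a b sym := by
  have e : μ'.get (.null .TapeCell) = μ.get (.null .TapeCell) :=
    hg _ (by simp) (by simp) (by simp [h.null_ty])
  have e' : ∀ i, a ≤ i → i ≤ b → μ'.get (.ref (lab i)) = μ.get (.ref (lab i)) := fun i h₁ h₂ =>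
    hg _ (by simp) (by simpa using h.ne i h₁ h₂) (by simp [h.ty i h₁ h₂])
  exact {
    null_ty := by rw [ht _ (by simp), h.null_ty]
    null_left := by rw [e, h.null_left]
    null_right := by rw [e, h.null_right]
    null_symbol := by rw [e, h.null_symbol]
    null_none := fun s h₁ h₂ => by rw [ht _ (by simpa using h₂), h.null_none s h₁ h₂]
    ty := fun i h₁ h₂ => by rw [ht _ (by simp), h.ty i h₁ h₂]
    left := fun i h₁ h₂ => by rw [e' i h₁ h₂, h.left i h₁ h₂]
    right := fun i h₁ h₂ => by rw [e' i h₁ h₂, h.right i h₁ h₂]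
    symbol := fun i h₁ h₂ => by rw [e' i h₁ h₂, h.symbol i h₁ h₂]
    inj := h.inj
    ne := h.ne
    dom := fun n hn => h.dom n (by rwa [ht _ (by simp)] at hn)
    blank := h.blank }

theorem set_control (h : TapeMem μ c lab a b sym) (x : Ident) (v : Val) :
    TapeMem (μ.set (.ref c) x v) c lab a b sym :=
  h.congr (fun _ _ => rfl) fun m _ hm _ => by ext y; simp [Mem.get_set, hm]

theorem set_symbol (h : TapeMem μ c lab a b sym) {i : ℤ} (h₁ : a ≤ i) (h₂ : i ≤ b) (z : ℤ) :
    TapeMem (μ.set (.ref (lab i)) .symbol (.int z)) c lab a b (Function.update sym i z) where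
  null_ty := h.null_ty
  null_left := by simp [Mem.get_set, h.null_left]
  null_right := by simp [Mem.get_set, h.null_right]
  null_symbol := by simp [Mem.get_set, h.null_symbol]
  null_none := h.null_none
  ty := h.ty
  left j hj₁ hj₂ := by simp [Mem.get_set, h.left j hj₁ hj₂]
  right j hj₁ hj₂ := by simp [Mem.get_set, h.right j hj₁ hj₂]
  symbol j hj₁ hj₂ := by
    by_cases e : j = i
    · simp [Mem.get_set, e]
    · have : lab j ≠ lab i := fun he => e (h.inj j i hj₁ hj₂ h₁ h₂ he)
      simp [Mem.get_set, this, e, h.symbol j hj₁ hj₂]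
  inj := h.inj
  ne := h.ne
  dom := h.dom
  blank j hj := by
    have : j ≠ i := by rintro rfl; exact hj ⟨h₁, h₂⟩
    simp [this, h.blank j hj]

theorem shift (h : TapeMem μ c lab a b sym) (d : ℤ) :
    TapeMem μ c (fun i => lab (i + d)) (a - d) (b - d) fun i => sym (i + d) := by
  have hl : ∀ i, link (fun i => lab (i + d)) (a - d) (b - d) i = link lab a b (i + d) := by
    intro i; simp only [link]; congr 1; simp; omega
  exact {
    null_ty := h.null_ty
    null_left := h.null_left
    null_right := h.null_right
    null_symbol := h.null_symbol
    null_none := h.null_none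
    ty := fun i h₁ h₂ => h.ty _ (by omega) (by omega)
    left := fun i h₁ h₂ => by rw [h.left _ (by omega) (by omega), hl]; congr 3; ring
    right := fun i h₁ h₂ => by rw [h.right _ (by omega) (by omega), hl]; congr 3; ring
    symbol := fun i h₁ h₂ => h.symbol _ (by omega) (by omega)
    inj := fun i j h₁ h₂ h₃ h₄ he => by
      have := h.inj _ _ (by omega) (by omega) (by omega) (by omega) he; omega
    ne := fun i h₁ h₂ => h.ne _ (by omega) (by omega)
    dom := fun n hn => (h.dom n hn).imp id fun ⟨i, h₁, h₂, h₃⟩ =>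
      ⟨i - d, by omega, by omega, by simpa using h₃⟩
    blank := fun i hi => h.blank _ (by omega) }

/-- A fresh instance is not part of the tape. -/
theorem ne_fresh (h : TapeMem μ c lab a b sym) {n : ℕ} (hn : μ.ty (.ref n) = none) {i : ℤ}
    (h₁ : a ≤ i) (h₂ : i ≤ b) : lab i ≠ n := by
  rintro rfl
  simp [h.ty i h₁ h₂] at hn

variable {Q Γ : Type*} [DecidableEq Q] (T : TM Q Γ) (N : Numbering T) (S : List Γ)

theorem grow_right (h : TapeMem μ c lab a b sym) (hab : a ≤ b) {n : ℕ} (hc : n ≠ c)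
    (hn : μ.ty (.ref n) = none) :
    TapeMem ((μ.alloc (impl T N S) n .TapeCell
        [.label (.ref (lab b)), .label (.null .TapeCell), .int 0]).set
          (.ref (lab b)) .right (.label (.ref n)))
      c (Function.update lab (b + 1) n) a (b + 1) sym := by
  have hl : ∀ i, i ≤ b → Function.update lab (b + 1) n i = lab i := fun i hi => by
    simp [show i ≠ b + 1 by omega]
  have hf := fun i h₁ h₂ => h.ne_fresh hn (i := i) h₁ h₂
  have hlink : ∀ i, i ≤ b → link (Function.update lab (b + 1) n) a (b + 1) i = link lab a b i := by
    intro i hi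
    simp [link, hl i hi, hi, show i ≤ b + 1 by omega]
  refine ⟨?_, ?_, ?_, ?_, fun s h₁ h₂ => ?_, fun i h₁ h₂ => ?_, fun i h₁ h₂ => ?_,
    fun i h₁ h₂ => ?_, fun i h₁ h₂ => ?_, fun i j h₁ h₂ h₃ h₄ he => ?_, fun i h₁ h₂ => ?_,
    fun m hm => ?_, fun i hi => h.blank i (by omega)⟩
  · simp [Mem.ty_alloc, h.null_ty]
  · simp [Mem.get_set, Mem.get_alloc, h.null_left]
  · simp [Mem.get_set, Mem.get_alloc, h.null_right]
  · simp [Mem.get_set, Mem.get_alloc, h.null_symbol]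
  · simp [Mem.ty_alloc, h.null_none s h₁ h₂]
  · rcases h₂.eq_or_lt with rfl | h₂
    · simp [Mem.ty_alloc]
    · simp [Mem.ty_alloc, hl i (by omega), hf i h₁ (by omega), h.ty i h₁ (by omega)]
  · rcases h₂.eq_or_lt with rfl | h₂
    · simp [Mem.get_set, Mem.get_alloc, newEnv_tapeCell, link, hab]
    · simp [Mem.get_set, Mem.get_alloc, hl i (by omega), hf i h₁ (by omega),
        h.left i h₁ (by omega), hlink (i - 1) (by omega)]
  · rcases h₂.eq_or_lt with rfl | h₂
    · simp [Mem.get_set, Mem.get_alloc, newEnv_tapeCell, link, (hf b hab le_rfl).symm]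
    · rcases (show i ≤ b by omega).eq_or_lt with rfl | h₂'
      · simp [Mem.get_set, link, show a ≤ i + 1 by omega]
      · have : lab i ≠ lab b := fun he => by
          have := h.inj i b h₁ (by omega) hab le_rfl he; omega
        simp [Mem.get_set, Mem.get_alloc, hl i (by omega), hf i h₁ (by omega), this,
          h.right i h₁ (by omega), hlink (i + 1) (by omega)]
  · rcases h₂.eq_or_lt with rfl | h₂
    · simp [Mem.get_set, Mem.get_alloc, newEnv_tapeCell, h.blank (b + 1) (by omega)]
    · simp [Mem.get_set, Mem.get_alloc, hl i (by omega), hf i h₁ (by omega),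
        h.symbol i h₁ (by omega)]
  · rcases h₂.eq_or_lt with rfl | h₂ <;> rcases h₄.eq_or_lt with rfl | h₄
    · rfl
    · simp [hl j (by omega), (hf j h₃ (by omega)).symm] at he
    · simp [hl i (by omega), (hf i h₁ (by omega))] at he
    · rw [hl i (by omega), hl j (by omega)] at he
      exact h.inj i j h₁ (by omega) h₃ (by omega) he
  · rcases h₂.eq_or_lt with rfl | h₂
    · simpa using hc
    · simpa [hl i (by omega)] using h.ne i h₁ (by omega)
  · by_cases e : m = n
    · exact .inr ⟨b + 1, by omega, le_rfl, by simp [e]⟩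
    · rcases h.dom m (by simpa [Mem.ty_alloc, e] using hm) with hm | ⟨i, h₁, h₂, hm⟩
      · exact .inl hm
      · exact .inr ⟨i, h₁, by omega, by rw [hl i h₂, hm]⟩

theorem grow_left (h : TapeMem μ c lab a b sym) (hab : a ≤ b) {n : ℕ} (hc : n ≠ c)
    (hn : μ.ty (.ref n) = none) :
    TapeMem ((μ.alloc (impl T N S) n .TapeCell
        [.label (.null .TapeCell), .label (.ref (lab a)), .int 0]).set
          (.ref (lab a)) .left (.label (.ref n)))
      c (Function.update lab (a - 1) n) (a - 1) b sym := by
  have hl : ∀ i, a ≤ i → Function.update lab (a - 1) n i = lab i := fun i hi => by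
    simp [show i ≠ a - 1 by omega]
  have hf := fun i h₁ h₂ => h.ne_fresh hn (i := i) h₁ h₂
  have hlink : ∀ i, a ≤ i → link (Function.update lab (a - 1) n) (a - 1) b i = link lab a b i := by
    intro i hi
    simp [link, hl i hi, hi, show a ≤ i + 1 by omega]
  refine ⟨?_, ?_, ?_, ?_, fun s h₁ h₂ => ?_, fun i h₁ h₂ => ?_, fun i h₁ h₂ => ?_,
    fun i h₁ h₂ => ?_, fun i h₁ h₂ => ?_, fun i j h₁ h₂ h₃ h₄ he => ?_, fun i h₁ h₂ => ?_,
    fun m hm => ?_, fun i hi => h.blank i (by omega)⟩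
  · simp [Mem.ty_alloc, h.null_ty]
  · simp [Mem.get_set, Mem.get_alloc, h.null_left]
  · simp [Mem.get_set, Mem.get_alloc, h.null_right]
  · simp [Mem.get_set, Mem.get_alloc, h.null_symbol]
  · simp [Mem.ty_alloc, h.null_none s h₁ h₂]
  · rcases h₁.eq_or_lt with rfl | h₁
    · simp [Mem.ty_alloc]
    · simp [Mem.ty_alloc, hl i (by omega), hf i (by omega) h₂, h.ty i (by omega) h₂]
  · rcases h₁.eq_or_lt with rfl | h₁
    · simp [Mem.get_set, Mem.get_alloc, newEnv_tapeCell, link, (hf a le_rfl hab).symm]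
    · rcases (show a ≤ i by omega).eq_or_lt with rfl | h₁'
      · simp [Mem.get_set, link, hl a le_rfl, show a ≤ b + 1 by omega]
      · have : lab i ≠ lab a := fun he => by
          have := h.inj i a (by omega) h₂ le_rfl hab he; omega
        simp [Mem.get_set, Mem.get_alloc, hl i (by omega), hf i (by omega) h₂, this,
          h.left i (by omega) h₂, hlink (i - 1) (by omega)]
  · rcases h₁.eq_or_lt with rfl | h₁
    · simp [Mem.get_set, Mem.get_alloc, newEnv_tapeCell, hl a le_rfl, link, hab]
    · simp [Mem.get_set, Mem.get_alloc, hl i (by omega), hf i (by omega) h₂,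
        h.right i (by omega) h₂, hlink (i + 1) (by omega)]
  · rcases h₁.eq_or_lt with rfl | h₁
    · simp [Mem.get_set, Mem.get_alloc, newEnv_tapeCell, h.blank (a - 1) (by omega)]
    · simp [Mem.get_set, Mem.get_alloc, hl i (by omega), hf i (by omega) h₂,
        h.symbol i (by omega) h₂]
  · rcases h₁.eq_or_lt with rfl | h₁ <;> rcases h₃.eq_or_lt with rfl | h₃
    · rfl
    · simp [hl j (by omega), (hf j (by omega) h₄).symm] at he
    · simp [hl i (by omega), (hf i (by omega) h₂)] at he
    · rw [hl i (by omega), hl j (by omega)] at he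
      exact h.inj i j (by omega) h₂ (by omega) h₄ he
  · rcases h₁.eq_or_lt with rfl | h₁
    · simpa using hc
    · simpa [hl i (by omega)] using h.ne i (by omega) h₂
  · by_cases e : m = n
    · exact .inr ⟨a - 1, le_rfl, by omega, by simp [e]⟩
    · rcases h.dom m (by simpa [Mem.ty_alloc, e] using hm) with hm | ⟨i, h₁, h₂, hm⟩
      · exact .inl hm
      · exact .inr ⟨i, by omega, h₂, by rw [hl i h₁, hm]⟩

end TapeMem

namespace ControlMem

variable {μ : Mem} {c : ℕ} {h : Label} {q : ℤ} {acc : Bool}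

theorem congr (H : ControlMem μ c h q acc) {μ' : Mem} (ht : μ'.ty (.ref c) = some .Control)
    (hg : μ'.get (.ref c) = μ.get (.ref c)) : ControlMem μ' c h q acc :=
  ⟨ht, by rw [hg, H.head], by rw [hg, H.state], by rw [hg, H.accepting]⟩

theorem set_of_ne (H : ControlMem μ c h q acc) {ℓ : Label} (hℓ : ℓ ≠ .ref c) (x : Ident) (v : Val) :
    ControlMem (μ.set ℓ x v) c h q acc :=
  H.congr H.ty (by ext y; simp [Mem.get_set, hℓ.symm])

theorem set_guard (H : ControlMem μ c h q acc) (n : ℕ) (v : Val) :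
    ControlMem (μ.set (.ref c) (.guard n) v) c h q acc :=
  ⟨H.ty, by simp [Mem.get_set, H.head], by simp [Mem.get_set, H.state],
    by simp [Mem.get_set, H.accepting]⟩

theorem set_head (H : ControlMem μ c h q acc) (h' : Label) :
    ControlMem (μ.set (.ref c) .head (.label h')) c h' q acc :=
  ⟨H.ty, by simp [Mem.get_set], by simp [Mem.get_set, H.state],
    by simp [Mem.get_set, H.accepting]⟩

theorem set_state (H : ControlMem μ c h q acc) (q' : ℤ) :
    ControlMem (μ.set (.ref c) .state (.int q')) c h q' acc :=
  ⟨H.ty, by simp [Mem.get_set, H.head], by simp [Mem.get_set],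
    by simp [Mem.get_set, H.accepting]⟩

theorem set_accepting (H : ControlMem μ c h q acc) (acc' : Bool) :
    ControlMem (μ.set (.ref c) .accepting (.bool acc')) c h q acc' :=
  ⟨H.ty, by simp [Mem.get_set, H.head], by simp [Mem.get_set, H.state], by simp [Mem.get_set]⟩

end ControlMem

/-! ### Execution of the step `transition` -/

/-- The unit step on the tape that a direction stands for. -/
def dirOffset : Dir → ℤ
  | .L => -1
  | .R => 1

/-- The first and the last cell that exist after a move in the given direction, relative to the new
head position: the tape is extended by one cell if the head leaves it. -/
def extend : Dir → ℤ × ℤ → ℤ × ℤ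
  | .L, e => (min e.1 (-1) + 1, e.2 + 1)
  | .R, e => (e.1 - 1, max e.2 1 - 1)

theorem moveTape_eq (t : ℤ → ℤ) (s : ℤ) (D : Dir) :
    TM.moveTape t s D = fun i => Function.update t 0 s (i + dirOffset D) := by
  funext i
  cases D
  · simp only [TM.moveTape, dirOffset, Function.update_apply]
    congr 1; simp; omega
  · simp only [TM.moveTape, dirOffset, Function.update_apply]
    congr 1; simp; omega

theorem TapeMem.get_dirPar {μ : Mem} {c : ℕ} {lab : ℤ → ℕ} {a b : ℤ} {sym : ℤ → ℤ}
    (h : TapeMem μ c lab a b sym) (D : Dir) {i : ℤ} (h₁ : a ≤ i) (h₂ : i ≤ b) :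
    μ.get (.ref (lab i)) (dirPar D) = some (.label (link lab a b (i + dirOffset D))) := by
  cases D
  · exact h.left i h₁ h₂
  · exact h.right i h₁ h₂

section

variable {Q Γ : Type*} [DecidableEq Q] {T : TM Q Γ} {N : Numbering T} {S : List Γ}
  {Φ : Mem → Bool → Prop} {γ : List Cmd} {χ : List Val} {μ : Mem} {su : Bool}
  {c : ℕ} {lab : ℤ → ℕ} {a b : ℤ} {sym : ℤ → ℤ} {q : ℤ} {acc : Bool}

/-- The head moves to an existing cell. As this cell differs from the old one, the move is always
noticed as a change of a parameter. -/
theorem wp_moveHead (D : Dir) (ht : TapeMem μ c lab a b sym)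
    (hc : ControlMem μ c (.ref (lab 0)) q acc) (ha : a ≤ 0) (hb : 0 ≤ b)
    (ha' : a ≤ dirOffset D) (hb' : dirOffset D ≤ b)
    (K : WP (impl T N S) (.ref c) Φ γ χ
      (μ.set (.ref c) .head (.label (.ref (lab (dirOffset D))))) false) :
    WP (impl T N S) (.ref c) Φ
      (.pushThis :: .rd .head :: .rd (dirPar D) :: .pushThis :: .wr .head :: γ) χ μ su := by
  have hl : link lab a b (0 + dirOffset D) = .ref (lab (dirOffset D)) := by
    simp [link, ha', hb']
  have hne : lab 0 ≠ lab (dirOffset D) := fun he => by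
    have := ht.inj _ _ ha hb ha' hb' he
    cases D <;> simp [dirOffset] at this
  refine .pushThis (.rd hc.ty hc.head (.rd (ht.ty 0 ha hb) (ht.get_dirPar D ha hb)
    (.pushThis (.wr hc.ty (.inl id) ?_))))
  rw [hl]
  simpa [hc.head, hne, parTy_control] using K

/-- After the conditional statement of a clause, the cell in direction `D` exists. -/
theorem wp_extendTape (D : Dir) (ht : TapeMem μ c lab a b sym)
    (hc : ControlMem μ c (.ref (lab 0)) q acc) (ha : a ≤ 0) (hb : 0 ≤ b)
    (K : ∀ μ' lab' a' b' su', TapeMem μ' c lab' a' b' sym →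
      ControlMem μ' c (.ref (lab' 0)) q acc → a' ≤ 0 → 0 ≤ b' → a' ≤ dirOffset D →
      dirOffset D ≤ b' → extend D (a, b) = (a' - dirOffset D, b' - dirOffset D) →
      (∀ n, μ'.get (.ref c) (.guard n) = μ.get (.ref c) (.guard n)) →
      WP (impl T N S) (.ref c) Φ γ χ μ' su') :
    WP (impl T N S) (.ref c) Φ
      (.pushThis :: .rd .head :: .push (.label (.null .TapeCell)) :: .op .ne ::
        .pushThis :: .rd .head :: .rd (dirPar D) :: .push (.label (.null .TapeCell)) ::
        .op .eq :: .op .and ::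
        .ifc (compileExpr (dirCell D) ++ [.pushThis, .rd .head, .wr (dirPar D)]) :: γ) χ μ su := by
  refine .pushThis (.rd hc.ty hc.head (.push (.op rfl (.pushThis (.rd hc.ty hc.head
    (.rd (ht.ty 0 ha hb) (ht.get_dirPar D ha hb) (.push (.op rfl
    (.op (u := .bool (decide (¬ (a ≤ dirOffset D ∧ dirOffset D ≤ b)))) ?_ ?_)))))))))
  · by_cases h : a ≤ dirOffset D ∧ dirOffset D ≤ b <;> simp [BOp.eval, link, h]
  · by_cases h : a ≤ dirOffset D ∧ dirOffset D ≤ b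
    · rw [decide_eq_false (by simpa using h)]
      refine .ifFalse (K μ lab a b su ht hc ha hb h.1 h.2 ?_ fun _ => rfl)
      cases D <;> simp [extend, dirOffset] at h ⊢ <;> omega
    · rw [decide_eq_true (by simpa using h)]
      have h0 : Label.ref (lab 0) ≠ .ref c := by simpa using ht.ne 0 ha hb
      cases D with
      | L =>
        obtain rfl : a = 0 := by simp [dirOffset] at h; omega
        simp only [dirCell, compileExpr, compileExprs, compilePath, cellTy, Ty.defaultVal, Lit.val,
          List.map_nil, List.cons_append, List.nil_append]
        refine .ifTrue (.push (.pushThis (.rd hc.ty hc.head (.push (.cons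
          (vs := [.label (.null .TapeCell), .label (.ref (lab 0)), .int 0])
          (by simp [structDef_tapeCell]) (by simp [pars_tapeCell]) rfl fun n hn => ?_)))))
        have hcn : n ≠ c := by rintro rfl; simp [hc.ty] at hn
        have h0n := ht.ne_fresh hn le_rfl hb
        have hc' : ControlMem (μ.alloc (impl T N S) n .TapeCell
            [.label (.null .TapeCell), .label (.ref (lab 0)), .int 0]) c (.ref (lab 0)) q acc :=
          hc.congr (by simp [Mem.ty_alloc, hcn.symm, hc.ty]) (by simp [Mem.get_alloc, hcn.symm])
        refine .pushThis (.rd hc'.ty hc'.head (.wr (t := .TapeCell) ?_ (.inl id) ?_))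
        · simp [Mem.ty_alloc, h0n, ht.ty 0 le_rfl hb]
        · refine K _ _ _ _ _ (ht.grow_left T N S hb hcn hn) ?_ (by simp) hb (by simp [dirOffset])
            (by simp [dirOffset]; omega) (by simp [extend, dirOffset]) fun m => ?_
          · simpa using hc'.set_of_ne h0 _ _
          · simp [Mem.get_set, Mem.get_alloc, hcn.symm, dirPar]
      | R =>
        obtain rfl : b = 0 := by simp [dirOffset] at h; omega
        simp only [dirCell, compileExpr, compileExprs, compilePath, cellTy, Ty.defaultVal, Lit.val,
          List.map_nil, List.cons_append, List.nil_append]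
        refine .ifTrue (.pushThis (.rd hc.ty hc.head (.push (.push (.cons
          (vs := [.label (.ref (lab 0)), .label (.null .TapeCell), .int 0])
          (by simp [structDef_tapeCell]) (by simp [pars_tapeCell]) rfl fun n hn => ?_)))))
        have hcn : n ≠ c := by rintro rfl; simp [hc.ty] at hn
        have h0n := ht.ne_fresh hn ha le_rfl
        have hc' : ControlMem (μ.alloc (impl T N S) n .TapeCell
            [.label (.ref (lab 0)), .label (.null .TapeCell), .int 0]) c (.ref (lab 0)) q acc :=
          hc.congr (by simp [Mem.ty_alloc, hcn.symm, hc.ty]) (by simp [Mem.get_alloc, hcn.symm])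
        refine .pushThis (.rd hc'.ty hc'.head (.wr (t := .TapeCell) ?_ (.inl id) ?_))
        · simp [Mem.ty_alloc, h0n, ht.ty 0 ha le_rfl]
        · refine K _ _ _ _ _ (ht.grow_right T N S ha hcn hn) ?_ ha (by simp)
            (by simp [dirOffset]; omega) (by simp [dirOffset]) (by simp [extend, dirOffset])
            fun m => ?_
          · simpa using hc'.set_of_ne h0 _ _
          · simp [Mem.get_set, Mem.get_alloc, hcn.symm, dirPar]

/-- The body of a clause, executed by the `Control` instance that simulates the machine, carries out
the transition. -/
theorem wp_clauseBody {e : ℤ × ℤ} (q' s' : ℤ) (acc' : Bool) (D : Dir)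
    (h : Encodes μ c lab e q acc sym)
    (K : ∀ μ' lab', Encodes μ' c lab' (extend D e) q' acc' (TM.moveTape sym s' D) →
      (∀ n, μ'.get (.ref c) (.guard n) = μ.get (.ref c) (.guard n)) →
      WP (impl T N S) (.ref c) Φ γ χ μ' false) :
    WP (impl T N S) (.ref c) Φ (compileStmts (clauseBody q' s' acc' D) ++ γ) χ μ su := by
  obtain ⟨ht, hc, ha, hb⟩ := h
  simp only [clauseBody, compileStmts, compileStmt, compileExpr, compilePath, List.map_cons,
    List.map_nil, List.cons_append, List.nil_append, List.append_nil, List.append_assoc, Lit.val,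
    Ty.defaultVal, cellTy]
  have h0 : Label.ref (lab 0) ≠ .ref c := by simpa using ht.ne 0 ha hb
  refine .push (.pushThis (.rd hc.ty hc.head (.wr (ht.ty 0 ha hb) (.inl id) ?_)))
  have ht₁ := ht.set_symbol ha hb s'
  have hc₁ := hc.set_of_ne h0 .symbol (.int s')
  refine .push (.pushThis (.wr hc₁.ty (.inl id) ?_))
  have ht₂ := ht₁.set_control .state (.int q')
  have hc₂ := hc₁.set_state q'
  refine .push (.pushThis (.wr hc₂.ty (.inl id) ?_))
  have ht₃ := ht₂.set_control .accepting (.bool acc')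
  have hc₃ := hc₂.set_accepting acc'
  refine wp_extendTape D ht₃ hc₃ ha hb fun μ' lab' a' b' su' ht' hc' ha₁ hb₁ ha₂ hb₂ he hg => ?_
  refine wp_moveHead D ht' hc' ha₁ hb₁ ha₂ hb₂ (K _ (fun i => lab' (i + dirOffset D)) ?_ ?_)
  · rw [moveTape_eq]
    refine ⟨?_, ?_, ?_, ?_⟩
    · rw [show extend D e = extend D (e.1, e.2) from rfl, he]
      exact (ht'.set_control _ _).shift _
    · simpa using hc'.set_head _
    · rw [show extend D e = extend D (e.1, e.2) from rfl, he]; simpa using ha₂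
    · rw [show extend D e = extend D (e.1, e.2) from rfl, he]; simpa using hb₂
  · intro n
    rw [Mem.get_set, if_neg (by simp), hg]
    simp [Mem.get_set, h0.symm]

/-- The memory that the null-instance of `Control` uses in the step `transition`. -/
structure NullMem (μ : Mem) : Prop where
  ty : μ.ty (.null .Control) = some .Control
  head : μ.get (.null .Control) .head = some (.label (.null .TapeCell))
  state : μ.get (.null .Control) .state = some (.int 0)
  accepting : μ.get (.null .Control) .accepting = some (.bool false)
  cell_ty : μ.ty (.null .TapeCell) = some .TapeCell
  cell_left : μ.get (.null .TapeCell) .left = some (.label (.null .TapeCell))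
  cell_right : μ.get (.null .TapeCell) .right = some (.label (.null .TapeCell))
  cell_symbol : μ.get (.null .TapeCell) .symbol = some (.int 0)

/-- The body of a clause has no effect when the null-instance of `Control` executes it, as it then
writes to parameters of null-instances only. -/
theorem wp_clauseBody_null (q' s' : ℤ) (acc' : Bool) (D : Dir) (h : NullMem μ)
    (K : WP (impl T N S) (.null .Control) Φ γ χ μ su) :
    WP (impl T N S) (.null .Control) Φ (compileStmts (clauseBody q' s' acc' D) ++ γ) χ μ su := by
  simp only [clauseBody, compileStmts, compileStmt, compileExpr, compilePath, List.map_cons,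
    List.map_nil, List.cons_append, List.nil_append, List.append_nil, List.append_assoc, Lit.val,
    Ty.defaultVal, cellTy]
  have hd : μ.get (.null .TapeCell) (dirPar D) = some (.label (.null .TapeCell)) := by
    cases D
    · exact h.cell_left
    · exact h.cell_right
  refine .push (.pushThis (.rd h.ty h.head (.wrSkip h.cell_ty trivial
    (by simp [parTy_tapeCell]) ?_)))
  refine .push (.pushThis (.wrSkip h.ty trivial (by simp [parTy_control]) ?_))
  refine .push (.pushThis (.wrSkip h.ty trivial (by simp [parTy_control]) ?_))
  refine .pushThis (.rd h.ty h.head (.push (.op rfl (.pushThis (.rd h.ty h.head (.rd h.cell_ty hd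
    (.push (.op rfl (.op (u := .bool false) (by simp [BOp.eval]) (.ifFalse ?_))))))))))
  exact .pushThis (.rd h.ty h.head (.rd h.cell_ty hd (.pushThis
    (.wrSkip h.ty trivial (by simp [parTy_control]) K))))

/-- An instance `ℓ` of `Control` whose state and head symbol are `q` and `s` executes exactly the
clause for `(q, s)` in the chain. The predicate `I` describes the memory before that clause, and `J`
the one after it. -/
theorem wp_elseIfs {ℓ : Label} (I : Mem → Prop) (J : Mem → Bool → Prop) (q : Q) (s : Γ)
    (hI : ∀ μ, I μ → μ.ty ℓ = some .Control ∧ μ.get ℓ .state = some (.int (N.stateCode q)) ∧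
      ∃ h t, μ.get ℓ .head = some (.label h) ∧ μ.ty h = some t ∧
        μ.get h .symbol = some (.int (N.symbolCode s)))
    (hset : ∀ μ n v, I μ → I (μ.set ℓ (.guard n) v))
    (hbody : ∀ r, T.δ q s = some r → ∀ n μ χ γ, I μ → μ.get ℓ (.guard n) = some (.bool true) →
      (∀ μ' su', J μ' su' → μ'.ty ℓ = some .Control → μ'.get ℓ (.guard n) = some (.bool true) →
        WP (impl T N S) ℓ Φ γ χ μ' su') →
      WP (impl T N S) ℓ Φ (compileStmts (clauseBody (N.stateCode r.1) (N.symbolCode r.2.1)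
        (decide (r.1 ∈ T.F)) r.2.2) ++ γ) χ μ true)
    (L : List (Q × Γ)) (n : ℕ) (hμ : I μ)
    (hyes : (q, s) ∈ L → (T.δ q s).isSome → ∀ μ' su', J μ' su' →
      WP (impl T N S) ℓ Φ γ χ μ' su')
    (hno : ¬ ((q, s) ∈ L ∧ (T.δ q s).isSome) → ∀ μ', I μ' → WP (impl T N S) ℓ Φ γ χ μ' true) :
    WP (impl T N S) ℓ Φ
      (compileStmts (elseIfs n (L.filterMap fun c => clause T N c.1 c.2)) ++ γ) χ μ true := by
  classical
  induction L generalizing n μ with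
  | nil => simpa [elseIfs, compileStmts] using hno (by simp) μ hμ
  | cons c L ih =>
    rw [List.filterMap_cons]
    cases hc : clause T N c.1 c.2 with
    | none =>
      have hδ : T.δ c.1 c.2 = none := by simpa [clause] using hc
      have hne : (T.δ q s).isSome → (q, s) ≠ c := by rintro h rfl; simp [hδ] at h
      exact ih n hμ (fun h h' => hyes (by simp [h]) h')
        fun h => hno fun ⟨h₁, h₂⟩ => h ⟨by simpa [hne h₂] using h₁, h₂⟩
    | some e =>
      obtain ⟨r, hr, rfl⟩ := Option.map_eq_some_iff.1 hc
      obtain ⟨hty, hst, h, t, hh, hht, hsym⟩ := hI μ hμ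
      simp only [elseIfs, compileStmts, compileStmt, compileExpr, compilePath, List.map_cons,
        List.map_nil, List.cons_append, List.nil_append, List.append_nil,
        Lit.val, clauseGuard]
      refine .pushThis (.rd hty hst (.push (.op rfl (.pushThis (.rd hty hh (.rd hht hsym (.push
        (.op rfl (.op (u := .bool (decide ((q, s) = c))) ?_ (.pushThis (.wr hty
          (.inr ⟨rfl, by simp [parTy_control]⟩) ?_)))))))))))
      · by_cases h₁ : q = c.1 <;> by_cases h₂ : s = c.2 <;>
          simp [BOp.eval, Prod.ext_iff, N.stateCode_injective.eq_iff,
            N.symbolCode_injective.eq_iff, h₁, h₂]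
      · have hμ' := hset μ n (.bool (decide ((q, s) = c))) hμ
        have hty' := (hI _ hμ').1
        have hg := Mem.get_set_self μ ℓ (.guard n) (.bool (decide ((q, s) = c)))
        simp only [parTy_control, reduceCtorEq, if_false, or_true, decide_true, Bool.and_true]
        refine .pushThis (.rd hty' hg ?_)
        by_cases he : (q, s) = c
        · subst he
          simp only [decide_true] at hμ' hty' hg ⊢
          refine .ifTrue (hbody r hr n _ _ _ hμ' hg fun μ' su' hJ hty'' hg' => ?_)
          exact .pushThis (.rd hty'' hg' (.not (.ifFalse
            (hyes (by simp) (by simp [hr]) μ' su' hJ))))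
        · simp only [he, decide_false] at hμ' hty' hg ⊢
          refine .ifFalse (.pushThis (.rd hty' hg (.not (.ifTrue (ih (n + 1) hμ' ?_ ?_)))))
          · exact fun h h' => hyes (by simp [h]) h'
          · exact fun h => hno fun ⟨h₁, h₂⟩ => h ⟨by simpa [he] using h₁, h₂⟩

end

/-! ### Execution of the step `init` -/

/-- The memory that the null-instance of `Control` uses in the step `init`, when `k` cells have been
created and the first `r` pairs of neighbours have been linked. The local variables of `init` are
variables of that null-instance. -/
structure ChainMem (μ : Mem) (lab : ℕ → ℕ) (sy : ℕ → ℤ) (k r : ℕ) : Prop where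
  ty : μ.ty (.null .Control) = some .Control
  head : μ.get (.null .Control) .head = some (.label (.null .TapeCell))
  state : μ.get (.null .Control) .state = some (.int 0)
  accepting : μ.get (.null .Control) .accepting = some (.bool false)
  var : ∀ i < k, μ.get (.null .Control) (.cell i) = some (.label (.ref (lab i)))
  cell_ty : ∀ i < k, μ.ty (.ref (lab i)) = some .TapeCell
  left : ∀ i < k, μ.get (.ref (lab i)) .left =
    some (.label (if 1 ≤ i ∧ i ≤ r then .ref (lab (i - 1)) else .null .TapeCell))
  right : ∀ i < k, μ.get (.ref (lab i)) .right =
    some (.label (if i < r then .ref (lab (i + 1)) else .null .TapeCell))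
  symbol : ∀ i < k, μ.get (.ref (lab i)) .symbol = some (.int (sy i))
  inj : ∀ i < k, ∀ j < k, lab i = lab j → i = j
  dom : ∀ m, μ.ty m ≠ none → m = .null .Control ∨ ∃ i < k, m = .ref (lab i)

namespace ChainMem

variable {Q Γ : Type*} [DecidableEq Q] {T : TM Q Γ} {N : Numbering T} {S : List Γ}
  {μ : Mem} {lab : ℕ → ℕ} {sy : ℕ → ℤ} {k r : ℕ}

theorem create (h : ChainMem μ lab sy k 0) {n : ℕ} (hn : μ.ty (.ref n) = none) :
    ChainMem ((μ.alloc (impl T N S) n .TapeCell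
        [.label (.null .TapeCell), .label (.null .TapeCell), .int (sy k)]).set
          (.null .Control) (.cell k) (.label (.ref n)))
      (Function.update lab k n) sy (k + 1) 0 := by
  have hf : ∀ i < k, lab i ≠ n := by
    rintro i hi rfl; simp [h.cell_ty i hi] at hn
  have hl : ∀ i < k, Function.update lab k n i = lab i := fun i hi => by simp [hi.ne]
  refine ⟨?_, ?_, ?_, ?_, fun i hi => ?_, fun i hi => ?_, fun i hi => ?_, fun i hi => ?_,
    fun i hi => ?_, fun i hi j hj he => ?_, fun m hm => ?_⟩
  · simp [Mem.ty_alloc, h.ty]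
  · simp [Mem.get_set, Mem.get_alloc, h.head]
  · simp [Mem.get_set, Mem.get_alloc, h.state]
  · simp [Mem.get_set, Mem.get_alloc, h.accepting]
  · rcases (Nat.lt_succ_iff.1 hi).eq_or_lt with rfl | hi
    · simp [Mem.get_set]
    · simp [Mem.get_set, Mem.get_alloc, hi.ne, h.var i hi]
  · rcases (Nat.lt_succ_iff.1 hi).eq_or_lt with rfl | hi
    · simp [Mem.ty_alloc]
    · simp [Mem.ty_alloc, hi.ne, hf i hi, h.cell_ty i hi]
  · have h0 : ¬ (1 ≤ i ∧ i ≤ 0) := by omega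
    rw [if_neg h0]
    rcases (Nat.lt_succ_iff.1 hi).eq_or_lt with rfl | hi
    · simp [Mem.get_set, Mem.get_alloc, newEnv_tapeCell]
    · have := h.left i hi
      rw [if_neg h0] at this
      simp [Mem.get_set, Mem.get_alloc, hi.ne, hf i hi, this]
  · rcases (Nat.lt_succ_iff.1 hi).eq_or_lt with rfl | hi
    · simp [Mem.get_set, Mem.get_alloc, newEnv_tapeCell]
    · simp [Mem.get_set, Mem.get_alloc, hi.ne, hf i hi, h.right i hi]
  · rcases (Nat.lt_succ_iff.1 hi).eq_or_lt with rfl | hi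
    · simp [Mem.get_set, Mem.get_alloc, newEnv_tapeCell]
    · simp [Mem.get_set, Mem.get_alloc, hi.ne, hf i hi, h.symbol i hi]
  · rcases (Nat.lt_succ_iff.1 hi).eq_or_lt with rfl | hi <;>
      rcases (Nat.lt_succ_iff.1 hj).eq_or_lt with rfl | hj
    · rfl
    · simp [hj.ne, (hf j hj).symm] at he
    · simp [hi.ne, hf i hi] at he
    · exact h.inj i hi j hj (by simpa [hi.ne, hj.ne] using he)
  · by_cases e : m = .ref n
    · exact .inr ⟨k, by omega, by simp [e]⟩
    · rcases h.dom m (by simpa [Mem.ty_alloc, e] using hm) with hm | ⟨i, hi, hm⟩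
      · exact .inl hm
      · exact .inr ⟨i, by omega, by rw [hl i hi, hm]⟩

theorem connect (h : ChainMem μ lab sy k r) (hr : r + 1 < k) :
    ChainMem ((μ.set (.ref (lab (r + 1))) .left (.label (.ref (lab r)))).set
      (.ref (lab r)) .right (.label (.ref (lab (r + 1))))) lab sy k (r + 1) := by
  refine ⟨h.ty, ?_, ?_, ?_, fun i hi => ?_, h.cell_ty, fun i hi => ?_, fun i hi => ?_,
    fun i hi => ?_, h.inj, h.dom⟩
  · simp [Mem.get_set, h.head]
  · simp [Mem.get_set, h.state]
  · simp [Mem.get_set, h.accepting]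
  · simp [Mem.get_set, h.var i hi]
  · by_cases e : i = r + 1
    · simp [Mem.get_set, e]
    · have : lab i ≠ lab (r + 1) := fun he => e (h.inj i hi _ hr he)
      have h' : (1 ≤ i ∧ i ≤ r + 1) ↔ (1 ≤ i ∧ i ≤ r) := by omega
      simp [Mem.get_set, this, h.left i hi, h']
  · by_cases e : i = r
    · simp [Mem.get_set, e]
    · have : lab i ≠ lab r := fun he => e (h.inj i hi _ (by omega) he)
      have h' : i < r + 1 ↔ i < r := by omega
      simp [Mem.get_set, this, h.right i hi, h']
  · simp [Mem.get_set, h.symbol i hi]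

variable {Φ : Mem → Bool → Prop} {γ : List Cmd} {χ : List Val} {su : Bool}

theorem wp_decls (w : List ℤ) (h : ChainMem μ lab sy k 0)
    (hw : ∀ i (hi : i < w.length), w[i] = sy (k + i))
    (K : ∀ μ' lab' su', ChainMem μ' lab' sy (k + w.length) 0 →
      WP (impl T N S) (.null .Control) Φ γ χ μ' su') :
    WP (impl T N S) (.null .Control) Φ
      (compileStmts (w.mapIdx fun i s => Stmt.decl cellTy (.cell (k + i)) (newCell s)) ++ γ)
      χ μ su := by
  induction w generalizing k μ lab su with
  | nil => simpa [compileStmts] using K μ lab su h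
  | cons s w ih =>
    obtain rfl : s = sy k := hw 0 (by simp)
    rw [List.mapIdx_cons]
    simp only [compileStmts, compileStmt, newCell, compileExpr, compileExprs, compilePath,
      List.map_nil, List.cons_append, List.nil_append, Lit.val, Ty.defaultVal, cellTy]
    refine .push (.push (.push (.cons
      (vs := [.label (.null .TapeCell), .label (.null .TapeCell), .int (sy k)])
      (by simp [structDef_tapeCell]) (by simp [pars_tapeCell]) rfl fun n hn => ?_)))
    refine .pushThis (.wr (t := .Control) (by simp [Mem.ty_alloc, h.ty])
      (.inr ⟨rfl, by simp [parTy_control]⟩) ?_)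
    have := fun su' => ih (su := su') (k := k + 1)
      (h.create (T := T) (N := N) (S := S) hn) (fun i hi => by
      have := hw (i + 1) (by simpa using hi)
      rw [List.getElem_cons_succ] at this
      rw [this]; congr 1; ring) (fun μ' lab' su' h' => K μ' lab' su' (by
        convert h' using 1; simp; ring))
    simpa [cellTy, newCell, add_assoc, add_comm, add_left_comm] using this _

theorem wp_links (m : ℕ) (h : ChainMem μ lab sy k r) (hm : r + m < k)
    (K : ∀ μ' su', ChainMem μ' lab sy k (r + m) →
      WP (impl T N S) (.null .Control) Φ γ χ μ' su') :
    WP (impl T N S) (.null .Control) Φ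
      (compileStmts ((List.range' r m).flatMap fun i =>
        [Stmt.assign [.cell (i + 1)] .left (.var [] (.cell i)),
         Stmt.assign [.cell i] .right (.var [] (.cell (i + 1)))]) ++ γ) χ μ su := by
  induction m generalizing r μ su with
  | zero => simpa [compileStmts] using K μ su h
  | succ m ih =>
    rw [List.range'_succ]
    simp only [List.flatMap_cons, compileStmts, compileStmt, compileExpr, compilePath,
      List.map_nil, List.map_cons, List.cons_append, List.nil_append]
    refine .pushThis (.rd h.ty (h.var r (by omega)) (.pushThis (.rd h.ty (h.var (r + 1) (by omega))
      (.wr (h.cell_ty (r + 1) (by omega)) (.inl id) ?_))))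
    have hv : ∀ i < k, (μ.set (.ref (lab (r + 1))) .left (.label (.ref (lab r)))).get
        (.null .Control) (.cell i) = some (.label (.ref (lab i))) := fun i hi => by
      simp [Mem.get_set, h.var i hi]
    refine .pushThis (.rd h.ty (hv (r + 1) (by omega)) (.pushThis (.rd h.ty (hv r (by omega))
      (.wr (h.cell_ty r (by omega)) (.inl id) ?_))))
    exact ih (h.connect (by omega)) (by omega) fun μ' su' h' =>
      K μ' su' (by convert h' using 1; ring)

/-- The linked cells, a new `Control` instance and the null-instance of `TapeCell` encode an initial
configuration. -/
theorem encodes (h : ChainMem μ lab sy k (k - 1)) (hk : 0 < k) {c : ℕ}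
    (hc : μ.ty (.ref c) = none) {acc : Bool} {sym : ℤ → ℤ}
    (hsy : ∀ i < k, sym i = sy i) (hblank : ∀ i : ℤ, ¬ (0 ≤ i ∧ i < k) → sym i = 0) {μ' : Mem}
    (ht : ∀ m, m ≠ .null .TapeCell → μ'.ty m = (μ.alloc (impl T N S) c .Control
      [.label (.ref (lab 0)), .int 0, .bool acc]).ty m)
    (hg : ∀ m, μ'.ty m ≠ none → m ≠ .null .TapeCell →
      μ'.get m = (μ.alloc (impl T N S) c .Control
        [.label (.ref (lab 0)), .int 0, .bool acc]).get m)
    (hn : μ'.ty (.null .TapeCell) = some .TapeCell)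
    (hl : μ'.get (.null .TapeCell) .left = some (.label (.null .TapeCell)))
    (hr : μ'.get (.null .TapeCell) .right = some (.label (.null .TapeCell)))
    (hs : μ'.get (.null .TapeCell) .symbol = some (.int 0)) :
    NullMem μ' ∧ Encodes μ' c (fun i => lab i.toNat) (0, k - 1) 0 acc sym := by
  have hf : ∀ i < k, lab i ≠ c := by
    rintro i hi rfl; simp [h.cell_ty i hi] at hc
  have hct : μ'.ty (.ref c) = some .Control := by rw [ht _ (by simp)]; simp [Mem.ty_alloc]
  have hnt : μ'.ty (.null .Control) = some .Control := by
    rw [ht _ (by simp)]; simp [Mem.ty_alloc, h.ty]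
  have hcell : ∀ i < k, μ'.ty (.ref (lab i)) = some .TapeCell := fun i hi => by
    rw [ht _ (by simp)]; simp [Mem.ty_alloc, hf i hi, h.cell_ty i hi]
  have hget : ∀ i < k, μ'.get (.ref (lab i)) = μ.get (.ref (lab i)) := fun i hi => by
    rw [hg _ (by simp [hcell i hi]) (by simp)]; simp [Mem.get_alloc, hf i hi]
  have hgn : μ'.get (.null .Control) = μ.get (.null .Control) := by
    rw [hg _ (by simp [hnt]) (by simp)]; simp [Mem.get_alloc]
  have hgc := hg (.ref c) (by simp [hct]) (by simp)
  refine ⟨⟨hnt, by rw [hgn, h.head], by rw [hgn, h.state], by rw [hgn, h.accepting], hn, hl, hr,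
    hs⟩, ⟨⟨hn, hl, hr, hs, fun s h₁ h₂ => ?_, fun i h₁ h₂ => ?_, fun i h₁ h₂ => ?_,
    fun i h₁ h₂ => ?_, fun i h₁ h₂ => ?_, fun i j h₁ h₂ h₃ h₄ he => ?_, fun i h₁ h₂ => ?_,
    fun m hm => ?_, fun i hi => hblank i (by simp at hi ⊢; omega)⟩, ⟨hct, ?_, ?_, ?_⟩, le_rfl, ?_⟩⟩
  · rw [ht _ (by simpa using h₁)]
    by_contra hne
    rcases h.dom _ (by simpa [Mem.ty_alloc] using hne) with hm | ⟨i, -, hm⟩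
    · simp at hm; exact h₂ hm
    · simp at hm
  · exact hcell _ (by simp at h₁ h₂; omega)
  · simp only at h₁ h₂
    lift i to ℕ using h₁
    rw [Int.toNat_natCast, hget i (by omega), h.left i (by omega)]
    congr 2
    simp only [link]
    have : (1 ≤ i ∧ i ≤ k - 1) ↔ ((0 : ℤ) ≤ i - 1 ∧ (i : ℤ) - 1 ≤ k - 1) := by omega
    simp only [this]
    congr 3
    omega
  · simp only at h₁ h₂
    lift i to ℕ using h₁
    rw [Int.toNat_natCast, hget i (by omega), h.right i (by omega)]
    congr 2
    simp only [link]
    have : (i < k - 1) ↔ ((0 : ℤ) ≤ i + 1 ∧ (i : ℤ) + 1 ≤ k - 1) := by omega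
    simp only [this]
    congr 3
  · simp only at h₁ h₂
    lift i to ℕ using h₁
    rw [Int.toNat_natCast, hget i (by omega), h.symbol i (by omega), hsy i (by omega)]
  · simp only at h₁ h₂ h₃ h₄
    have := h.inj _ (by omega) _ (by omega) he
    omega
  · simp only at h₁ h₂
    exact hf _ (by omega)
  · rw [ht _ (by simp)] at hm
    by_cases e : m = c
    · exact .inl e
    · rcases h.dom (.ref m) (by simpa [Mem.ty_alloc, e] using hm) with hm | ⟨i, hi, hm⟩
      · simp at hm
      · exact .inr ⟨i, by simp, by simp; omega, by simpa using hm⟩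
  · rw [hgc]; simp [Mem.get_alloc, newEnv_control]
  · rw [hgc]; simp [Mem.get_alloc, newEnv_control]
  · rw [hgc]; simp [Mem.get_alloc, newEnv_control]
  · simp; omega

end ChainMem

theorem compileStmts_append (A B : List Stmt) :
    compileStmts (A ++ B) = compileStmts A ++ compileStmts B := by
  induction A with
  | nil => simp [compileStmts]
  | cons Z A ih => simp [compileStmts, ih]

theorem wp_initBody {Q Γ : Type*} [DecidableEq Q] {T : TM Q Γ} {N : Numbering T} {S : List Γ}
    {Φ : Mem → Bool → Prop} {μ : Mem} {su : Bool} {lab : ℕ → ℕ} (w : List ℤ) (acc : Bool)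
    (hw : w ≠ []) (h : ChainMem μ lab (fun i => w.getD i 0) 0 0)
    (K : ∀ μ' lab' c su', ChainMem μ' lab' (fun i => w.getD i 0) w.length (w.length - 1) →
      μ'.ty (.ref c) = none →
      Φ (μ'.alloc (impl T N S) c .Control [.label (.ref (lab' 0)), .int 0, .bool acc]) su') :
    WP (impl T N S) (.null .Control) Φ (compileStmts (initBody w acc)) [] μ su := by
  have hlen := List.length_pos_of_ne_nil hw
  simp only [initBody, compileStmts_append, List.append_assoc]
  have hd := h.wp_decls (T := T) (N := N) (S := S) (Φ := Φ) (χ := []) (su := su)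
    (γ := compileStmts ((List.range (w.length - 1)).flatMap fun i =>
      [Stmt.assign [.cell (i + 1)] .left (.var [] (.cell i)),
       Stmt.assign [.cell i] .right (.var [] (.cell (i + 1)))]) ++
      compileStmts [Stmt.cons .Control [.var [] (.cell 0), .lit (.int 0), .lit (.bool acc)]])
    w (fun i hi => by simp [hi])
  simp only [zero_add] at hd
  refine hd fun μ₁ lab₁ su₁ h₁ => ?_
  rw [List.range_eq_range']
  refine h₁.wp_links _ (by omega) fun μ₂ su₂ h₂ => ?_
  simp only [zero_add] at h₂
  simp only [compileStmts, compileStmt, compileExpr, compileExprs, compilePath,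
    List.map_nil, List.cons_append, List.nil_append, Lit.val]
  exact .pushThis (.rd h₂.ty (h₂.var 0 hlen) (.push (.push (.cons
    (vs := [.label (.ref (lab₁ 0)), .int 0, .bool acc]) (by simp [structDef_control])
    (by simp [pars_control]) rfl fun n hn => .nil (K μ₂ lab₁ n _ h₂ hn)))))

/-! ### The steps as transformations of states -/

section

/-- The instances of a state, without their commands and stacks. -/
def State.mem (P : State) : Mem where
  ty m := (P.store m).map Instance.type
  get m x := (P.store m).bind fun i => i.env x

theorem State.mem_of_store {P : State} {m : Label} {i : Instance} (h : P.store m = some i) :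
    P.mem.ty m = some i.type ∧ P.mem.get m = i.env :=
  ⟨by simp [State.mem, h], by ext x; simp [State.mem, h]⟩

theorem State.exists_of_ty {P : State} {m : Label} {t : Ident} (h : P.mem.ty m = some t) :
    ∃ i, P.store m = some i ∧ i.type = t ∧ i.env = P.mem.get m := by
  obtain ⟨i, hi, rfl⟩ := Option.map_eq_some_iff.1 h
  exact ⟨i, hi, rfl, (State.mem_of_store hi).2.symm⟩

theorem State.mem_ty_eq_none {P : State} {m : Label} : P.mem.ty m = none ↔ P.store m = none := by
  simp [State.mem]

theorem State.Shows.mem {P : State} {ℓ : Label} {γ : List Cmd} {χ : List Val} {μ : Mem}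
    (h : P.Shows ℓ γ χ μ) {m : Label} (hm : μ.ty m ≠ none) :
    P.mem.ty m = μ.ty m ∧ P.mem.get m = μ.get m := by
  obtain ⟨t, ht⟩ := Option.ne_none_iff_exists'.1 hm
  have := State.mem_of_store (h m t ht)
  exact ⟨this.1.trans ht.symm, this.2⟩

theorem Encodes.congr {μ μ' : Mem} {c : ℕ} {lab : ℤ → ℕ} {e : ℤ × ℤ} {q : ℤ} {acc : Bool}
    {sym : ℤ → ℤ} (h : Encodes μ c lab e q acc sym)
    (ht : ∀ m, m ≠ .null .Control → μ'.ty m = μ.ty m)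
    (hg : ∀ m, m ≠ .null .Control → μ.ty m ≠ none → μ'.get m = μ.get m) :
    Encodes μ' c lab e q acc sym where
  tape := h.tape.congr ht fun m h₁ _ h₂ => hg m h₁ h₂
  control := h.control.congr (by rw [ht _ (by simp), h.control.ty])
    (hg _ (by simp) (by simp [h.control.ty]))
  nonpos := h.nonpos
  nonneg := h.nonneg

theorem Encodes.ty_eq {μ : Mem} {c : ℕ} {lab : ℤ → ℕ} {e : ℤ × ℤ} {q : ℤ} {acc : Bool}
    {sym : ℤ → ℤ} (h : Encodes μ c lab e q acc sym) {m : Label} {t : Ident}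
    (hm : μ.ty m = some t) (h₁ : m ≠ .null .Control) (h₂ : m ≠ .ref c) : t = .TapeCell := by
  cases m with
  | null s =>
    by_cases hs : s = .TapeCell
    · subst hs; simpa [h.tape.null_ty] using hm.symm
    · simp [h.tape.null_none s hs (by simpa using h₁)] at hm
  | ref n =>
    rcases h.tape.dom n (by simp [hm]) with rfl | ⟨i, hi₁, hi₂, rfl⟩
    · exact absurd rfl h₂
    · simpa [h.tape.ty i hi₁ hi₂] using hm.symm

theorem symbolCode_moveTape {Q Γ : Type*} {T : TM Q Γ} (N : Numbering T) (t : ℤ → Γ) (s : Γ)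
    (D : Dir) :
    (fun i => N.symbolCode (TM.moveTape t s D i)) =
      TM.moveTape (fun i => N.symbolCode (t i)) (N.symbolCode s) D := by
  funext i
  cases D <;> simp only [TM.moveTape] <;> split_ifs <;> rfl

variable {Q Γ : Type*} [DecidableEq Q] {T : TM Q Γ}

/-- The idle state `P` encodes the configuration `C`, with a tape whose first and last cell,
relative to the head, are given by `e`. Local variables and stacks are left open. -/
structure StateEncodes (N : Numbering T) (P : State) (e : ℤ × ℤ) (C : TM.Config Q Γ) : Prop where
  idle : P.Idle
  fin : P.FiniteRefs
  null : NullMem P.mem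
  enc : ∃ c lab, Encodes P.mem c lab e (N.stateCode C.state) (decide (C.state ∈ T.F))
    fun i => N.symbolCode (C.tape i)

/-- Starting the execution of the step `F` at all instances. -/
def State.start (p : Program) (P : State) (F : Ident) (r : List Pending) : State :=
  { P with
    sched := r
    store := fun ℓ => (P.store ℓ).map fun i =>
      ⟨i.type, compileStmts (p.stepBody i.type F), [], i.env⟩ }

/-- An execution of `transition` simulates one transition of the machine, and notices it as a change
of parameters; if the machine has halted, nothing changes. -/
theorem term_transition {N : Numbering T} {S : List Γ} {P : State} {e : ℤ × ℤ}
    {C : TM.Config Q Γ} (h : StateEncodes N P e C) (r : List Pending) :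
    Term (impl T N S) (fun P' => P'.sched = r ∧
      (T.δ C.state (C.tape 0) = none → StateEncodes N P' e C ∧ P'.stab = P.stab) ∧
      ∀ u, T.δ C.state (C.tape 0) = some u →
        StateEncodes N P' (extend u.2.2 e) ⟨u.1, TM.moveTape C.tape u.2.1 u.2.2⟩ ∧
          P'.stab = P.stab.map fun _ => false) (P.start (impl T N S) .transition r) := by
  obtain ⟨c, lab, hE⟩ := h.enc
  -- the instance `ref c` works on everything except the null-instance of `Control`, which shares
  -- with it the null-instance of `TapeCell`
  set μ₁ : Mem := ⟨fun m => if m = .null .Control then none else P.mem.ty m, P.mem.get⟩ with hμ₁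
  set μ₂ : Mem := ⟨fun m => if m = .null .Control ∨ m = .null .TapeCell then P.mem.ty m else none,
    P.mem.get⟩ with hμ₂
  have hE₁ : Encodes μ₁ c lab e (N.stateCode C.state) (decide (C.state ∈ T.F))
      (fun i => N.symbolCode (C.tape i)) :=
    hE.congr (fun m hm => by simp [hμ₁, hm]) fun m hm _ => rfl
  have hN₂ : NullMem μ₂ := by
    obtain ⟨h1, h2, h3, h4, h5, h6, h7, h8⟩ := h.null
    exact ⟨by simpa [hμ₂], h2, h3, h4, by simpa [hμ₂], h6, h7, h8⟩
  have hbody : compileStmts (transitionBody T N) =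
      compileStmts (transitionBody T N) ++ [] := by simp
  refine Par.term (ℓ₁ := .ref c) (ℓ₂ := .null .Control) (sc := r) (st := P.stab)
    (γ₁ := compileStmts (transitionBody T N)) (γ₂ := compileStmts (transitionBody T N))
    (χ₁ := []) (χ₂ := []) (μ₁ := μ₁) (μ₂ := μ₂) (su₁ := true) (su₂ := true)
    (Φ₁ := fun μ su =>
      (T.δ C.state (C.tape 0) = none → su = true ∧ ∃ lab', Encodes μ c lab' e
        (N.stateCode C.state) (decide (C.state ∈ T.F)) fun i => N.symbolCode (C.tape i)) ∧
      ∀ u, T.δ C.state (C.tape 0) = some u → su = false ∧ ∃ lab', Encodes μ c lab'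
        (extend u.2.2 e) (N.stateCode u.1) (decide (u.1 ∈ T.F))
        fun i => N.symbolCode (TM.moveTape C.tape u.2.1 u.2.2 i))
    (Φ₂ := fun μ su => NullMem μ ∧ su = true ∧
      ∀ m, μ.ty m ≠ none → m = .null .Control ∨ m = .null .TapeCell) ?_ ?_
  · intro P' χ₁ χ₂ μ₁' μ₂' su₁ su₂ hidle hpar
    obtain ⟨hN', rfl, hd₂⟩ := hpar.wp₂.post
    have hΦ₁ := hpar.wp₁.post
    have hnull : NullMem P'.mem := by
      have hc := hpar.shows₂.mem (m := .null .Control) (by simp [hN'.ty])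
      have ht := hpar.shows₂.mem (m := .null .TapeCell) (by simp [hN'.cell_ty])
      exact ⟨by rw [hc.1, hN'.ty], by rw [hc.2, hN'.head], by rw [hc.2, hN'.state],
        by rw [hc.2, hN'.accepting], by rw [ht.1, hN'.cell_ty], by rw [ht.2, hN'.cell_left],
        by rw [ht.2, hN'.cell_right], by rw [ht.2, hN'.cell_symbol]⟩
    have henc : ∀ {lab' e' q acc sym}, Encodes μ₁' c lab' e' q acc sym →
        Encodes P'.mem c lab' e' q acc sym := by
      intro lab' e' q acc sym hE'
      refine hE'.congr (fun m hm => ?_) fun m hm hm' => (hpar.shows₁.mem hm').2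
      by_cases h₁ : μ₁'.ty m = none
      · rw [h₁, State.mem_ty_eq_none]
        by_contra hne
        rcases hpar.dom m hne with h | h
        · exact h h₁
        · rcases hd₂ m h with rfl | rfl
          · exact hm rfl
          · simp [hE'.tape.null_ty] at h₁
      · exact (hpar.shows₁.mem h₁).1
    refine ⟨hpar.sched, fun hδ => ?_, fun u hu => ?_⟩
    · obtain ⟨rfl, lab', hE'⟩ := hΦ₁.1 hδ
      exact ⟨⟨hidle, hpar.fin, hnull, c, lab', henc hE'⟩, by simp [hpar.stab]⟩
    · obtain ⟨rfl, lab', hE'⟩ := hΦ₁.2 u hu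
      exact ⟨⟨hidle, hpar.fin, hnull, c, lab', henc hE'⟩, by simp [hpar.stab]⟩
  · refine ⟨?_, ?_, ?_, ?_, ?_, ?_, ?_, ?_, ?_, rfl, ?_⟩
    · rw [hbody]
      refine wp_elseIfs
        (I := fun μ => Encodes μ c lab e (N.stateCode C.state) (decide (C.state ∈ T.F))
          fun i => N.symbolCode (C.tape i))
        (J := fun μ su => ∃ u, T.δ C.state (C.tape 0) = some u ∧ su = false ∧
          ∃ lab', Encodes μ c lab' (extend u.2.2 e) (N.stateCode u.1) (decide (u.1 ∈ T.F))
            fun i => N.symbolCode (TM.moveTape C.tape u.2.1 u.2.2 i))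
        C.state (C.tape 0) ?_ ?_ ?_ N.pairs 0 hE₁ ?_ ?_
      · intro μ hμ
        exact ⟨hμ.control.ty, hμ.control.state, _, _, hμ.control.head,
          hμ.tape.ty 0 hμ.nonpos hμ.nonneg, hμ.tape.symbol 0 hμ.nonpos hμ.nonneg⟩
      · exact fun μ n v hμ => ⟨hμ.tape.set_control _ _, hμ.control.set_guard _ _, hμ.nonpos,
          hμ.nonneg⟩
      · intro u hu n μ χ γ hμ hg K
        refine wp_clauseBody _ _ _ _ hμ fun μ' lab' hμ' hg' => K μ' false ⟨u, hu, rfl, lab', ?_⟩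
          hμ'.control.ty (by rw [hg', hg])
        rwa [symbolCode_moveTape]
      · rintro - - μ' su' ⟨u, hu, rfl, hμ'⟩
        refine .nil ⟨fun hn => by simp [hu] at hn, fun u' hu' => ?_⟩
        obtain rfl : u = u' := by simpa [hu] using hu'
        exact ⟨rfl, hμ'⟩
      · intro hno μ' hμ'
        have hδ : T.δ C.state (C.tape 0) = none := by
          by_contra hne
          have := Option.isSome_iff_ne_none.2 hne
          exact hno ⟨(N.mem_pairs _ _).2 this, this⟩
        exact .nil ⟨fun _ => ⟨rfl, lab, hμ'⟩, fun u hu => by simp [hδ] at hu⟩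
    · rw [hbody]
      refine wp_elseIfs
        (I := fun μ => NullMem μ ∧
          ∀ m, μ.ty m ≠ none → m = .null .Control ∨ m = .null .TapeCell)
        (J := fun μ su => su = true ∧ NullMem μ ∧
          ∀ m, μ.ty m ≠ none → m = .null .Control ∨ m = .null .TapeCell)
        T.q0 T.B ?_ ?_ ?_ N.pairs 0 ⟨hN₂, fun m hm => ?_⟩ ?_ ?_
      · rintro μ ⟨hμ, -⟩
        exact ⟨hμ.ty, by rw [hμ.state, N.stateCode_q0], _, _, hμ.head, hμ.cell_ty,
          by rw [hμ.cell_symbol, N.symbolCode_blank]⟩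
      · rintro μ n v ⟨hμ, hd⟩
        exact ⟨⟨hμ.ty, by simp [Mem.get_set, hμ.head], by simp [Mem.get_set, hμ.state],
          by simp [Mem.get_set, hμ.accepting], hμ.cell_ty, by simp [Mem.get_set, hμ.cell_left],
          by simp [Mem.get_set, hμ.cell_right], by simp [Mem.get_set, hμ.cell_symbol]⟩, hd⟩
      · rintro u hu n μ χ γ ⟨hμ, hd⟩ hg K
        exact wp_clauseBody_null _ _ _ _ hμ (K μ true ⟨rfl, hμ, hd⟩ hμ.ty hg)
      · by_contra hne
        exact hm (by simp only [hμ₂, hne, if_false])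
      · rintro - - μ' su' ⟨rfl, hμ, hd⟩
        exact .nil ⟨hμ, rfl, hd⟩
      · rintro - μ' ⟨hμ, hd⟩
        exact .nil ⟨hμ, rfl, hd⟩
    · intro m t hm
      have hne : m ≠ .null .Control := by rintro rfl; simp [hμ₁] at hm
      obtain ⟨i, hi, rfl, hi'⟩ := State.exists_of_ty (P := P) (by simpa [hμ₁, hne] using hm)
      by_cases hc : m = .ref c
      · subst hc
        rw [hE₁.control.ty] at hm
        simp only [Option.some.injEq] at hm
        simp [State.start, hi, hμ₁, hi', ← hm, stepBody_transition]
      · have := hE₁.ty_eq hm hne hc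
        simp [State.start, hi, hμ₁, hi', this, stepBody_tapeCell, compileStmts, hc]
    · intro m t hm
      have hm' : m = .null .Control ∨ m = .null .TapeCell := by
        by_contra hne
        simp [hμ₂, hne] at hm
      obtain ⟨i, hi, rfl, hi'⟩ := State.exists_of_ty (P := P) (by simpa [hμ₂, hm'] using hm)
      rcases hm' with rfl | rfl
      · rw [hN₂.ty] at hm
        simp only [Option.some.injEq] at hm
        simp [State.start, hi, hμ₂, hi', ← hm, stepBody_transition]
      · rw [hN₂.cell_ty] at hm
        simp only [Option.some.injEq] at hm
        simp [State.start, hi, hμ₂, hi', ← hm, stepBody_tapeCell, compileStmts]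
    · simp [hE₁.control.ty]
    · simp [hN₂.ty]
    · intro m h₁ h₂
      have h₃ : m ≠ .null .Control := by rintro rfl; simp [hμ₁] at h₁
      have h₄ : m = .null .TapeCell := by
        by_contra hne
        simp [hμ₂, hne, h₃] at h₂
      subst h₄
      exact ⟨trivial, by simp, by simp⟩
    · intro m hm
      have : P.mem.ty m ≠ none := by
        rw [Ne, State.mem_ty_eq_none]; simpa [State.start] using hm
      by_cases hc : m = .null .Control
      · exact .inr (by simpa [hμ₂, hc] using this)
      · exact .inl (by simpa [hμ₁, hc] using this)
    · exact h.fin.subset fun n hn => by simpa [State.start] using hn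
    · simp [State.start]

/-- The step `init`, executed in the initial state, produces the initial configuration. -/
theorem term_init {N : Numbering T} {S : List Γ} (hS : S ≠ []) (r : List Pending) :
    Term (impl T N S) (fun P' => P'.sched = r ∧
      StateEncodes N P' (0, S.length - 1) (T.initialConfig S) ∧ P'.stab = [])
      ((impl T N S).initial.start (impl T N S) .init r) := by
  set p := impl T N S with hp
  set μ₁ : Mem := ⟨fun m => if m = .null .Control then some .Control else none,
    fun _ => p.nullEnv .Control⟩ with hμ₁
  set μ₂ : Mem := ⟨fun m => if m = .null .TapeCell then some .TapeCell else none,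
    fun _ => p.nullEnv .TapeCell⟩ with hμ₂
  set w := S.map N.symbolCode with hw
  have hst : ∀ s, p.initial.store (.null s) = if s = .TapeCell then some ⟨.TapeCell, [], [],
      p.nullEnv .TapeCell⟩ else if s = .Control then some ⟨.Control, [], [], p.nullEnv .Control⟩
      else none := by
    intro s
    simp only [Program.initial]
    by_cases h₁ : s = .TapeCell
    · subst h₁; simp [hp, structDef_tapeCell]
    · by_cases h₂ : s = .Control
      · subst h₂; simp [hp, structDef_control]
      · simp [hp, structDef_eq_none T N S h₁ h₂, h₁, h₂]
  refine Par.term (ℓ₁ := .null .Control) (ℓ₂ := .null .TapeCell) (sc := r) (st := [])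
    (γ₁ := compileStmts (initBody w (decide (T.q0 ∈ T.F)))) (γ₂ := [])
    (χ₁ := []) (χ₂ := []) (μ₁ := μ₁) (μ₂ := μ₂) (su₁ := true) (su₂ := true)
    (Φ₁ := fun μ _ => ∃ μ' lab c, ChainMem μ' lab (fun i => w.getD i 0) w.length (w.length - 1) ∧
      μ'.ty (.ref c) = none ∧ μ = μ'.alloc p c .Control
        [.label (.ref (lab 0)), .int 0, .bool (decide (T.q0 ∈ T.F))])
    (Φ₂ := fun μ _ => μ = μ₂) ?_ ?_
  · intro P' χ₁ χ₂ μ₁' μ₂' su₁ su₂ hidle hpar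
    obtain rfl : μ₂' = μ₂ := hpar.wp₂.post
    obtain ⟨μ', lab, c, hch, hc, rfl⟩ := hpar.wp₁.post
    have hcell := hpar.shows₂.mem (m := .null .TapeCell) (by simp [hμ₂])
    have hty : ∀ m, m ≠ .null .TapeCell → P'.mem.ty m = (μ'.alloc p c .Control
        [.label (.ref (lab 0)), .int 0, .bool (decide (T.q0 ∈ T.F))]).ty m := by
      intro m hm
      by_cases h₁ : (μ'.alloc p c .Control
        [.label (.ref (lab 0)), .int 0, .bool (decide (T.q0 ∈ T.F))]).ty m = none
      · rw [h₁, State.mem_ty_eq_none]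
        by_contra hne
        rcases hpar.dom m hne with h | h
        · exact h h₁
        · simp [hμ₂, hm] at h
      · exact (hpar.shows₁.mem h₁).1
    have hlen : 0 < w.length := by simpa [hw] using List.length_pos_of_ne_nil hS
    have hB : (0 : ℤ) = N.symbolCode T.B := N.symbolCode_blank.symm
    have hE := hch.encodes (T := T) (N := N) (S := S) hlen hc
      (sym := fun i => N.symbolCode (T.inputTape S i))
      (fun i _ => by
        rw [show w.getD i 0 = N.symbolCode (S.getD i T.B) by rw [hw, hB, List.getD_map]]
        simp [TM.inputTape]) ?_ hty
      (fun m hm hm' => (hpar.shows₁.mem (by rwa [hty m hm'] at hm)).2)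
      (by rw [hcell.1]; simp [hμ₂])
      (by rw [hcell.2]; simp [hμ₂, hp, Program.nullEnv, parTy_tapeCell, cellTy, Ty.defaultVal])
      (by rw [hcell.2]; simp [hμ₂, hp, Program.nullEnv, parTy_tapeCell, cellTy, Ty.defaultVal])
      (by rw [hcell.2]; simp [hμ₂, hp, Program.nullEnv, parTy_tapeCell, Ty.defaultVal])
    · refine ⟨hpar.sched, ⟨hidle, hpar.fin, hE.1, c, fun i => lab i.toNat, ?_⟩, by simp [hpar.stab]⟩
      have hE₂ := hE.2
      rw [show w.length = S.length by simp [hw]] at hE₂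
      rw [show N.stateCode (T.initialConfig S).state = 0 from N.stateCode_q0]
      exact hE₂
    · intro i hi
      rw [← N.symbolCode_blank]
      congr 1
      simp only [TM.inputTape]
      split_ifs with h0
      · refine List.getD_eq_default _ _ ?_
        simp [hw] at hi; omega
      · rfl
  · refine ⟨?_, .nil rfl, ?_, ?_, ?_, ?_, ?_, ?_, ?_, rfl, rfl⟩
    · refine wp_initBody (lab := fun _ => 0) w _ (by simpa [hw] using hS) ?_
        fun μ' lab' c _ h hc => ⟨μ', lab', c, h, hc, rfl⟩
      refine ⟨by simp [hμ₁], ?_, ?_, ?_, by simp, by simp, by simp, by simp, by simp, by simp,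
        fun m hm => ?_⟩
      · simp [hμ₁, hp, Program.nullEnv, parTy_control, cellTy, Ty.defaultVal]
      · simp [hμ₁, hp, Program.nullEnv, parTy_control, Ty.defaultVal]
      · simp [hμ₁, hp, Program.nullEnv, parTy_control, Ty.defaultVal]
      · left
        by_contra hne
        simp [hμ₁, hne] at hm
    · intro m t hm
      have hm' : m = .null .Control := by by_contra hne; simp [hμ₁, hne] at hm
      subst hm'
      obtain rfl : .Control = t := by simpa [hμ₁] using hm
      simp only [State.start, hst]
      simp [hμ₁, hp, stepBody_init, hw]
    · intro m t hm
      have hm' : m = .null .TapeCell := by by_contra hne; simp [hμ₂, hne] at hm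
      subst hm'
      obtain rfl : .TapeCell = t := by simpa [hμ₂] using hm
      simp only [State.start, hst]
      simp [hμ₂, hp, stepBody_tapeCell, compileStmts]
    · simp [hμ₁]
    · simp [hμ₂]
    · intro m h₁ h₂
      have : m = .null .Control := by by_contra hne; simp [hμ₁, hne] at h₁
      subst this
      simp [hμ₂] at h₂
    · intro m hm
      cases m with
      | ref n => simp [State.start, Program.initial] at hm
      | null s =>
        simp only [State.start, hst] at hm
        by_cases h₁ : s = .TapeCell
        · exact .inr (by simp [hμ₂, h₁])
        · by_cases h₂ : s = .Control
          · exact .inl (by simp [hμ₁, h₂])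
          · simp [h₁, h₂] at hm
    · refine Set.finite_empty.subset fun n hn => ?_
      simp [State.start, Program.initial] at hn

end

/-! ### Encodings and implementation configurations -/

section

namespace TapeMem

variable {μ : Mem} {c : ℕ} {lab : ℤ → ℕ} {a b : ℤ} {sym : ℤ → ℤ}

theorem link_symbol (h : TapeMem μ c lab a b sym) (i : ℤ) :
    μ.get (link lab a b i) .symbol = some (.int (sym i)) := by
  by_cases hi : a ≤ i ∧ i ≤ b
  · simp [link, hi, h.symbol i hi.1 hi.2]
  · simp [link, hi, h.null_symbol, h.blank i hi]

theorem link_right (h : TapeMem μ c lab a b sym) {i : ℤ} (ha : a ≤ i) :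
    μ.get (link lab a b i) .right = some (.label (link lab a b (i + 1))) := by
  by_cases hi : i ≤ b
  · rw [← h.right i ha hi]; simp [link, ha, hi]
  · simp [link, hi, show ¬ i + 1 ≤ b by omega, h.null_right]

theorem link_left (h : TapeMem μ c lab a b sym) {i : ℤ} (hb : i ≤ b) :
    μ.get (link lab a b i) .left = some (.label (link lab a b (i - 1))) := by
  by_cases hi : a ≤ i
  · rw [← h.left i hi hb]; simp [link, hb, hi]
  · simp [link, hi, show ¬ a ≤ i - 1 by omega, h.null_left]

end TapeMem

theorem dot_label (P : State) (ℓ : Label) (x : Ident) :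
    P.store.dot (some (.label ℓ)) x = P.mem.get ℓ x := rfl

variable {Q Γ : Type*} [DecidableEq Q] {T : TM Q Γ} {N : Numbering T} {S : List Γ}

theorem StateEncodes.of_store {P P' : State} {e : ℤ × ℤ} {C : TM.Config Q Γ}
    (h : StateEncodes N P e C) (hs : P'.store = P.store) : StateEncodes N P' e C := by
  have hm : P'.mem = P.mem := by simp only [State.mem, hs]
  refine ⟨?_, ?_, hm ▸ h.null, hm ▸ h.enc⟩
  · simpa only [State.Idle, hs] using h.idle
  · simpa only [State.FiniteRefs, hs] using h.fin

theorem State.SoleControl.unique {P : State} {c c' : Label} (h : P.SoleControl c)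
    (h' : P.SoleControl c') : c = c' :=
  (h' c).1 ((h c).2 rfl)

theorem StateEncodes.corresponds {P : State} {e : ℤ × ℤ} {C : TM.Config Q Γ}
    (h : StateEncodes N P e C) : Corresponds N P C := by
  obtain ⟨c, lab, hE⟩ := h.enc
  have hsole : P.SoleControl (.ref c) := by
    intro ℓ
    constructor
    · rintro ⟨hn, i, hi, hc⟩
      by_contra hne
      have hm := (State.mem_of_store hi).1
      have := hE.ty_eq hm (by rintro rfl; exact hn trivial) hne
      rw [hc] at this
      cases this
    · rintro rfl
      obtain ⟨i, hi, hc, -⟩ := State.exists_of_ty hE.control.ty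
      exact ⟨id, i, hi, hc⟩
  have h0 : Label.ref (lab 0) = link lab e.1 e.2 0 := by simp [link, hE.nonpos, hE.nonneg]
  refine ⟨⟨h.idle, _, hsole, hE.control.state, fun i => ?_⟩, _, hsole, hE.control.accepting⟩
  simp only [Store.tape]
  rw [dot_label, hE.control.head, h0]
  split_ifs with hi
  · have : ∀ n : ℕ, (fun v => P.store.dot v .left)^[n] (some (.label (link lab e.1 e.2 0))) =
        some (.label (link lab e.1 e.2 (-n))) := by
      intro n
      induction n with
      | zero => simp
      | succ n ih =>
        have hb := hE.nonneg
        rw [Function.iterate_succ_apply', ih, dot_label, hE.tape.link_left (by omega)]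
        congr 3; push_cast; ring
    rw [this, dot_label, hE.tape.link_symbol]
    congr 4; omega
  · have : ∀ n : ℕ, (fun v => P.store.dot v .right)^[n] (some (.label (link lab e.1 e.2 0))) =
        some (.label (link lab e.1 e.2 n)) := by
      intro n
      induction n with
      | zero => simp
      | succ n ih =>
        have ha := hE.nonpos
        rw [Function.iterate_succ_apply', ih, dot_label, hE.tape.link_right (by omega)]
        congr 3
    rw [this, dot_label, hE.tape.link_symbol]
    congr 4; omega

theorem exists_perm_apply_eq {ι : Type*} [Finite ι] {f g : ι → ℕ} (hf : Function.Injective f)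
    (hg : Function.Injective g) : ∃ π : ℕ ≃ ℕ, ∀ i, π (f i) = g i := by
  classical
  have : Infinite {n // n ∉ Set.range f} := (Set.finite_range f).infinite_compl.to_subtype
  have : Infinite {n // n ∉ Set.range g} := (Set.finite_range g).infinite_compl.to_subtype
  obtain ⟨o⟩ := nonempty_equiv_of_countable (α := {n // n ∉ Set.range f})
    (β := {n // n ∉ Set.range g})
  refine ⟨Equiv.subtypeCongr ((Equiv.ofInjective f hf).symm.trans (Equiv.ofInjective g hg)) o,
    fun i => ?_⟩
  rw [Equiv.subtypeCongr]
  simp [Equiv.sumCompl_symm_apply_of_pos (p := (· ∈ Set.range f)) (⟨i, rfl⟩ : f i ∈ Set.range f)]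

/-- The permutation of the labels that permutes the labels `ref n` and fixes the null-labels. -/
def Label.permRef (π : ℕ ≃ ℕ) : Label ≃ Label where
  toFun
    | .null s => .null s
    | .ref n => .ref (π n)
  invFun
    | .null s => .null s
    | .ref n => .ref (π.symm n)
  left_inv ℓ := by cases ℓ <;> simp
  right_inv ℓ := by cases ℓ <;> simp

/-- States that encode the same configuration with tapes of the same extent differ in labels, local
variables and stacks only. -/
theorem StateEncodes.sameData {P P' : State} {e : ℤ × ℤ} {C : TM.Config Q Γ}
    (h : StateEncodes N P e C) (h' : StateEncodes N P' e C) :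
    State.SameData (impl T N S) P P' := by
  obtain ⟨c, lab, hE⟩ := h.enc
  obtain ⟨c', lab', hE'⟩ := h'.enc
  -- the labels of the `Control` instance and of the cells, indexed independently of the state
  have hinj : ∀ {μ c lab q acc sym}, Encodes μ c lab e q acc sym → Function.Injective
      (fun o : Option (Set.Icc e.1 e.2) => o.elim c fun i => lab i) := by
    rintro μ c lab q acc sym hE (_ | i) (_ | j) hij
    · rfl
    · exact absurd hij.symm (hE.tape.ne j j.2.1 j.2.2)
    · exact absurd hij (hE.tape.ne i i.2.1 i.2.2)
    · exact congrArg some (Subtype.ext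
        (hE.tape.inj i j i.2.1 i.2.2 j.2.1 j.2.2 hij))
  obtain ⟨π, hπ⟩ := exists_perm_apply_eq (hinj hE) (hinj hE')
  have hc : π c = c' := hπ none
  have hl : ∀ i, e.1 ≤ i → i ≤ e.2 → π (lab i) = lab' i := fun i h₁ h₂ => hπ (some ⟨i, h₁, h₂⟩)
  have hlink : ∀ i, Val.rename (Label.permRef π) (.label (link lab e.1 e.2 i)) =
      .label (link lab' e.1 e.2 i) := by
    intro i
    by_cases hi : e.1 ≤ i ∧ i ≤ e.2
    · simp [link, hi, Val.rename, Label.permRef, hl i hi.1 hi.2]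
    · simp [link, hi, Val.rename, Label.permRef]
  have key : ∀ ℓ, P'.mem.ty (Label.permRef π ℓ) = P.mem.ty ℓ ∧
      ∀ t x, P.mem.ty ℓ = some t → ((impl T N S).parTy t x).isSome →
        P'.mem.get (Label.permRef π ℓ) x =
          (P.mem.get ℓ x).map (Val.rename (Label.permRef π)) := by
    intro ℓ
    cases ℓ with
    | null s =>
      change P'.mem.ty (.null s) = _ ∧ ∀ t x, _ → _ → P'.mem.get (.null s) x = _
      by_cases h₁ : s = .TapeCell
      · subst h₁
        refine ⟨by rw [h.null.cell_ty, h'.null.cell_ty], fun t x ht hx => ?_⟩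
        obtain rfl : .TapeCell = t := by simpa [h.null.cell_ty] using ht
        have : x = .left ∨ x = .right ∨ x = .symbol := by
          by_contra hne
          simp only [not_or] at hne
          simp [parTy_tapeCell, hne] at hx
        rcases this with rfl | rfl | rfl
        · rw [h.null.cell_left, h'.null.cell_left]; rfl
        · rw [h.null.cell_right, h'.null.cell_right]; rfl
        · rw [h.null.cell_symbol, h'.null.cell_symbol]; rfl
      · by_cases h₂ : s = .Control
        · subst h₂
          refine ⟨by rw [h.null.ty, h'.null.ty], fun t x ht hx => ?_⟩
          obtain rfl : .Control = t := by simpa [h.null.ty] using ht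
          have : x = .head ∨ x = .state ∨ x = .accepting := by
            by_contra hne
            simp only [not_or] at hne
            simp [parTy_control, hne] at hx
          rcases this with rfl | rfl | rfl
          · rw [h.null.head, h'.null.head]; rfl
          · rw [h.null.state, h'.null.state]; rfl
          · rw [h.null.accepting, h'.null.accepting]; rfl
        · have hn := hE.tape.null_none s h₁ h₂
          exact ⟨by rw [hn, hE'.tape.null_none s h₁ h₂], fun t x ht => by simp [hn] at ht⟩
    | ref n =>
      change P'.mem.ty (.ref (π n)) = _ ∧ ∀ t x, _ → _ → P'.mem.get (.ref (π n)) x = _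
      by_cases hn : P.mem.ty (.ref n) = none
      · refine ⟨?_, fun t x ht => by simp [hn] at ht⟩
        rw [hn]
        by_contra hne
        rcases hE'.tape.dom _ hne with hm | ⟨i, h₁, h₂, hm⟩
        · rw [← hc] at hm
          obtain rfl := π.injective hm
          simp [hE.control.ty] at hn
        · rw [← hl i h₁ h₂] at hm
          obtain rfl := π.injective hm
          simp [hE.tape.ty i h₁ h₂] at hn
      · rcases hE.tape.dom _ hn with rfl | ⟨i, h₁, h₂, rfl⟩
        · rw [hc]
          refine ⟨by rw [hE.control.ty, hE'.control.ty], fun t x ht hx => ?_⟩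
          obtain rfl : .Control = t := by simpa [hE.control.ty] using ht
          have : x = .head ∨ x = .state ∨ x = .accepting := by
            by_contra hne
            simp only [not_or] at hne
            simp [parTy_control, hne] at hx
          rcases this with rfl | rfl | rfl
          · rw [hE.control.head, hE'.control.head]
            simp [Val.rename, Label.permRef, hl 0 hE.nonpos hE.nonneg]
          · rw [hE.control.state, hE'.control.state]; rfl
          · rw [hE.control.accepting, hE'.control.accepting]; rfl
        · rw [hl i h₁ h₂]
          refine ⟨by rw [hE.tape.ty i h₁ h₂, hE'.tape.ty i h₁ h₂], fun t x ht hx => ?_⟩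
          obtain rfl : .TapeCell = t := by simpa [hE.tape.ty i h₁ h₂] using ht
          have : x = .left ∨ x = .right ∨ x = .symbol := by
            by_contra hne
            simp only [not_or] at hne
            simp [parTy_tapeCell, hne] at hx
          rcases this with rfl | rfl | rfl
          · rw [hE.tape.left i h₁ h₂, hE'.tape.left i h₁ h₂, Option.map_some, hlink]
          · rw [hE.tape.right i h₁ h₂, hE'.tape.right i h₁ h₂, Option.map_some, hlink]
          · rw [hE.tape.symbol i h₁ h₂, hE'.tape.symbol i h₁ h₂]; rfl
  refine ⟨Label.permRef π, fun s => rfl, fun ℓ => ⟨?_, fun i i' hi hi' => ?_⟩⟩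
  · rw [← State.mem_ty_eq_none, ← State.mem_ty_eq_none, (key ℓ).1]
  · obtain ⟨ht, hg⟩ := State.mem_of_store hi
    obtain ⟨ht', hg'⟩ := State.mem_of_store hi'
    have := (key ℓ).1
    rw [ht, ht'] at this
    refine ⟨by simpa using this, fun x hx => ?_⟩
    rw [← hg, ← hg']
    exact (key ℓ).2 _ x ht hx

end

/-! ### Executions of the program -/

section

theorem Term.of_idle {p : Program} {Ψ : State → Prop} {P : State} (h : Term p Ψ P)
    (hP : P.Idle) : Ψ P := by
  cases h with
  | idle _ h => exact h
  | step h => exact absurd hP h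

theorem Term.mono {p : Program} {Ψ Ψ' : State → Prop} (hΨ : ∀ P, P.Idle → Ψ P → Ψ' P) {P : State}
    (h : Term p Ψ P) : Term p Ψ' P := by
  induction h with
  | idle hi h => exact .idle hi (hΨ _ hi h)
  | step h₁ h₂ h₃ _ ih => exact .step h₁ h₂ h₃ ih

theorem Term.exists_reach {p : Program} {Ψ : State → Prop} {P : State} (h : Term p Ψ P)
    {l : List Ident} (hl : Reach p l P) : ∃ P', Reach p l P' ∧ P'.Idle ∧ Ψ P' := by
  induction h with
  | idle hi h => exact ⟨_, hl, hi, h⟩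
  | step _ h₂ _ _ ih =>
    obtain ⟨P', hP'⟩ := h₂
    exact ih _ _ hP' (by simpa using hl.trans hP')

/-- A transition with a label in `A` leads from `P` to `P'`; the order of the arguments is such that
`Acc (Prec p A) P` says that there is no infinite execution from `P` with labels in `A`. -/
def Prec (p : Program) (A : Set (Option Ident)) (P' P : State) : Prop := ∃ a ∈ A, Trans p P a P'

theorem Term.acc {p : Program} {A : Set (Option Ident)} {Ψ : State → Prop}
    (hΨ : ∀ P, P.Idle → Ψ P → Acc (Prec p A) P) {P : State} (h : Term p Ψ P) :
    Acc (Prec p A) P := by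
  induction h with
  | idle hi h => exact hΨ _ hi h
  | step _ _ _ _ ih => exact ⟨_, fun P' ⟨a, _, h⟩ => ih a P' h⟩

theorem not_chain_of_acc {α : Type*} {r : α → α → Prop} {x : α} (h : Acc r x) (f : ℕ → α)
    (h0 : f 0 = x) (hf : ∀ n, r (f (n + 1)) (f n)) : False := by
  induction h generalizing f with
  | intro x _ ih => exact ih (f 1) (h0 ▸ hf 0) (fun n => f (n + 1)) rfl fun n => hf (n + 1)

/-- The transitions from an idle state are governed by its schedule. -/
theorem Trans.of_idle {p : Program} {P P' : State} {a : Option Ident} (h : Trans p P a P')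
    (hP : P.Idle) :
    (∃ F r, P.sched = .item (.call F) :: r ∧ a = some F ∧ P' = P.start p F r) ∨
    (∃ s F r, P.sched = .item (.typedCall s F) :: r) ∨
    (∃ sc r, P.sched = .item (.fix sc) :: r ∧ a = none ∧
      P' = { P with sched := sc.map Pending.item ++ .aFix sc :: r, stab := true :: P.stab }) ∨
    (∃ sc r st, P.sched = .aFix sc :: r ∧ P.stab = false :: st ∧ a = none ∧
      P' = { P with sched := sc.map Pending.item ++ .aFix sc :: r, stab := true :: st }) ∨
    (∃ sc r st, P.sched = .aFix sc :: r ∧ P.stab = true :: st ∧ a = none ∧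
      P' = { P with sched := r, stab := st }) := by
  cases h with
  | push hs => exact absurd (hP _ _ hs) (by simp)
  | pushThis hs => exact absurd (hP _ _ hs) (by simp)
  | rd hs => exact absurd (hP _ _ hs) (by simp)
  | wr hs => exact absurd (hP _ _ hs) (by simp)
  | wrSkip hs => exact absurd (hP _ _ hs) (by simp)
  | not hs => exact absurd (hP _ _ hs) (by simp)
  | op hs => exact absurd (hP _ _ hs) (by simp)
  | cons hs => exact absurd (hP _ _ hs) (by simp)
  | ifTrue hs => exact absurd (hP _ _ hs) (by simp)
  | ifFalse hs => exact absurd (hP _ _ hs) (by simp)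
  | call _ h => exact .inl ⟨_, _, h, rfl, rfl⟩
  | typedCall _ h => exact .inr (.inl ⟨_, _, _, h⟩)
  | fixInit _ h => exact .inr (.inr (.inl ⟨_, _, h, rfl, rfl⟩))
  | fixIter _ h h' => exact .inr (.inr (.inr (.inl ⟨_, _, _, h, h', rfl, rfl⟩)))
  | fixTerm _ h h' => exact .inr (.inr (.inr (.inr ⟨_, _, _, h, h', rfl, rfl⟩)))

variable {Q Γ : Type*}

/-- The configuration after `k` transitions, together with the extent of the tape that the program
has created by then. -/
def modelAt (T : TM Q Γ) (S : List Γ) : ℕ → Option ((ℤ × ℤ) × TM.Config Q Γ)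
  | 0 => some ((0, S.length - 1), T.initialConfig S)
  | k + 1 => (modelAt T S k).bind fun M => (T.δ M.2.state (M.2.tape 0)).map fun u =>
      (extend u.2.2 M.1, ⟨u.1, TM.moveTape M.2.tape u.2.1 u.2.2⟩)

theorem map_snd_modelAt (T : TM Q Γ) (S : List Γ) (k : ℕ) :
    (modelAt T S k).map Prod.snd = T.configAt S k := by
  induction k with
  | zero => rfl
  | succ k ih =>
    rw [modelAt, TM.configAt, ← ih]
    cases modelAt T S k with
    | none => rfl
    | some M =>
      simp only [Option.bind_some, Option.map_some, TM.next, Option.map_map]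
      rfl

theorem configAt_of_modelAt {T : TM Q Γ} {S : List Γ} {k : ℕ} {e : ℤ × ℤ} {C : TM.Config Q Γ}
    (h : modelAt T S k = some (e, C)) : T.configAt S k = some C := by
  simp [← map_snd_modelAt, h]

theorem exists_modelAt {T : TM Q Γ} {S : List Γ} {k : ℕ} {C : TM.Config Q Γ}
    (h : T.configAt S k = some C) : ∃ e, modelAt T S k = some (e, C) := by
  rw [← map_snd_modelAt, Option.map_eq_some_iff] at h
  obtain ⟨M, hM, rfl⟩ := h
  exact ⟨M.1, hM⟩

theorem next_eq_none {T : TM Q Γ} {C : TM.Config Q Γ} :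
    T.next C = none ↔ T.δ C.state (C.tape 0) = none := by
  simp [TM.next]

theorem configAt_succ_eq_none {T : TM Q Γ} {S : List Γ} {k : ℕ} {C : TM.Config Q Γ}
    (h : T.configAt S k = some C) (hn : T.next C = none) : T.configAt S (k + 1) = none := by
  simp [TM.configAt, h, hn]

theorem modelAt_succ {T : TM Q Γ} {S : List Γ} {k : ℕ} {e : ℤ × ℤ} {C : TM.Config Q Γ}
    {u : Q × Γ × Dir} (h : modelAt T S k = some (e, C)) (hu : T.δ C.state (C.tape 0) = some u) :
    modelAt T S (k + 1) = some (extend u.2.2 e, ⟨u.1, TM.moveTape C.tape u.2.1 u.2.2⟩) := by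
  simp [modelAt, h, hu]

theorem modelAt_isSome_of_le {T : TM Q Γ} {S : List Γ} {j k : ℕ} (hjk : j ≤ k)
    (h : (modelAt T S k).isSome) : (modelAt T S j).isSome := by
  induction k, hjk using Nat.le_induction with
  | base => exact h
  | succ k _ ih =>
    refine ih ?_
    cases hk : modelAt T S k with
    | none => simp [modelAt, hk] at h
    | some M => rfl

theorem runTrace_injective : Function.Injective runTrace := fun j k h => by
  simpa [runTrace] using congrArg List.length h

theorem runTrace_succ (k : ℕ) : runTrace (k + 1) = runTrace k ++ [.transition] := by
  simp [runTrace, List.replicate_succ']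

variable [DecidableEq Q] {T : TM Q Γ} {N : Numbering T} {S : List Γ}

/-- An idle state that encodes the configuration after `k` transitions, from which `transition` will
be executed again. -/
def RunState (N : Numbering T) (k : ℕ) (e : ℤ × ℤ) (C : TM.Config Q Γ) (P : State) : Prop :=
  StateEncodes N P e C ∧
    (k = 0 ∧ P.sched = [.item (.fix [.call .transition])] ∧ P.stab = [] ∨
      k ≠ 0 ∧ P.sched = [.aFix [.call .transition]] ∧ P.stab = [false] ∨
      P.sched = [.item (.call .transition), .aFix [.call .transition]] ∧ P.stab = [true])

/-- An idle state after the execution of `transition` without effect. -/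
def HaltState (N : Numbering T) (e : ℤ × ℤ) (C : TM.Config Q Γ) (P : State) : Prop :=
  StateEncodes N P e C ∧
    (P.sched = [.aFix [.call .transition]] ∧ P.stab = [true] ∨ P.sched = [] ∧ P.stab = [])

/-- The state in which an execution of `transition` has just been started. -/
def afterCall (T : TM Q Γ) (N : Numbering T) (S : List Γ) (P : State) : State :=
  P.start (impl T N S) .transition [.aFix [.call .transition]]

theorem RunState.step {k : ℕ} {e : ℤ × ℤ} {C : TM.Config Q Γ} {P P' : State} {a : Option Ident}
    (h : RunState N k e C P) (ht : Trans (impl T N S) P a P') :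
    (a = none ∧ RunState N k e C P' ∧
      P.sched ≠ [.item (.call .transition), .aFix [.call .transition]] ∧
      P'.sched = [.item (.call .transition), .aFix [.call .transition]]) ∨
    (a = some .transition ∧ P.stab = [true] ∧ P' = afterCall T N S P) := by
  obtain ⟨hE, h⟩ := h
  rcases ht.of_idle hE.idle with ⟨F, r, hs, rfl, rfl⟩ | ⟨s, F, r, hs⟩ | ⟨sc, r, hs, rfl, rfl⟩ |
    ⟨sc, r, st, hs, hb, rfl, rfl⟩ | ⟨sc, r, st, hs, hb, rfl, rfl⟩ <;>
    rcases h with ⟨hk, h, hb'⟩ | ⟨hk, h, hb'⟩ | ⟨h, hb'⟩ <;> rw [h] at hs <;> simp at hs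
  · obtain ⟨rfl, rfl⟩ := hs
    exact .inr ⟨rfl, hb', rfl⟩
  · obtain ⟨rfl, rfl⟩ := hs
    exact .inl ⟨rfl, ⟨hE.of_store rfl, .inr (.inr ⟨rfl, by simp [hb']⟩)⟩, by simp [h], rfl⟩
  · obtain ⟨rfl, rfl⟩ := hs
    obtain rfl : [] = st := by simpa [hb'] using hb
    exact .inl ⟨rfl, ⟨hE.of_store rfl, .inr (.inr ⟨rfl, rfl⟩)⟩, by simp [h], rfl⟩
  · simp [hb'] at hb

theorem RunState.acc_of_afterCall {A : Set (Option Ident)} {k : ℕ} {e : ℤ × ℤ}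
    {C : TM.Config Q Γ} (hA : some .transition ∈ A → ∀ P, RunState N k e C P → P.stab = [true] →
      Acc (Prec (impl T N S) A) (afterCall T N S P)) {P : State} (h : RunState N k e C P) :
    Acc (Prec (impl T N S) A) P := by
  refine ⟨_, ?_⟩
  rintro P₁ ⟨a, ha, ht⟩
  rcases h.step ht with ⟨-, h₁, -, hs⟩ | ⟨rfl, hb, rfl⟩
  · refine ⟨_, ?_⟩
    rintro P₂ ⟨a, ha, ht⟩
    rcases h₁.step ht with ⟨-, -, hs', -⟩ | ⟨rfl, hb, rfl⟩
    · exact absurd hs hs'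
    · exact hA ha _ h₁ hb
  · exact hA ha _ h hb

theorem RunState.progress {k : ℕ} {e : ℤ × ℤ} {C : TM.Config Q Γ} {P : State}
    (h : RunState N k e C P) : ∃ a P', Trans (impl T N S) P a P' := by
  obtain ⟨hE, ⟨-, h, -⟩ | ⟨-, h, hb⟩ | ⟨h, -⟩⟩ := h
  · exact ⟨_, _, .fixInit hE.idle h⟩
  · exact ⟨_, _, .fixIter hE.idle h hb⟩
  · exact ⟨_, _, .call hE.idle h⟩

theorem HaltState.step {e : ℤ × ℤ} {C : TM.Config Q Γ} {P P' : State} {a : Option Ident}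
    (h : HaltState N e C P) (ht : Trans (impl T N S) P a P') :
    a = none ∧ HaltState N e C P' ∧ P.sched ≠ [] ∧ P'.sched = [] := by
  obtain ⟨hE, h⟩ := h
  rcases ht.of_idle hE.idle with ⟨F, r, hs, rfl, rfl⟩ | ⟨s, F, r, hs⟩ | ⟨sc, r, hs, rfl, rfl⟩ |
    ⟨sc, r, st, hs, hb, rfl, rfl⟩ | ⟨sc, r, st, hs, hb, rfl, rfl⟩ <;>
    rcases h with ⟨h, hb'⟩ | ⟨h, hb'⟩ <;> rw [h] at hs <;> simp at hs
  · simp [hb'] at hb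
  · obtain ⟨rfl, rfl⟩ := hs
    obtain rfl : [] = st := by simpa [hb'] using hb
    exact ⟨rfl, ⟨hE.of_store rfl, .inr ⟨rfl, rfl⟩⟩, by simp [h], rfl⟩

theorem HaltState.progress {e : ℤ × ℤ} {C : TM.Config Q Γ} {P : State}
    (h : HaltState N e C P) : P.Final ∨ ∃ a P', Trans (impl T N S) P a P' := by
  obtain ⟨hE, ⟨h, hb⟩ | ⟨h, -⟩⟩ := h
  · exact .inr ⟨_, _, .fixTerm hE.idle h hb⟩
  · exact .inl ⟨hE.idle, h⟩

theorem HaltState.acc {A : Set (Option Ident)} {e : ℤ × ℤ} {C : TM.Config Q Γ} {P : State}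
    (h : HaltState N e C P) : Acc (Prec (impl T N S) A) P := by
  refine ⟨_, fun P' ⟨a, _, ht⟩ => ⟨_, fun P'' ⟨a', _, ht'⟩ => ?_⟩⟩
  exact absurd (h.step ht).2.2.2 ((h.step ht).2.1.step ht').2.2.1

theorem term_afterCall_of_halted {k : ℕ} {e : ℤ × ℤ} {C : TM.Config Q Γ} {P : State}
    (h : RunState N k e C P) (hb : P.stab = [true]) (hC : T.next C = none) :
    Term (impl T N S) (HaltState N e C) (afterCall T N S P) := by
  refine (term_transition h.1 _).mono fun P' _ ⟨h₁, h₂, _⟩ => ?_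
  obtain ⟨h₂, h₃⟩ := h₂ (next_eq_none.1 hC)
  exact ⟨h₂, .inl ⟨h₁, h₃.trans hb⟩⟩

theorem term_afterCall {k : ℕ} {e : ℤ × ℤ} {C : TM.Config Q Γ} {P : State}
    (h : RunState N k e C P) (hb : P.stab = [true]) {u : Q × Γ × Dir}
    (hu : T.δ C.state (C.tape 0) = some u) :
    Term (impl T N S) (RunState N (k + 1) (extend u.2.2 e)
      ⟨u.1, TM.moveTape C.tape u.2.1 u.2.2⟩) (afterCall T N S P) := by
  refine (term_transition h.1 _).mono fun P' _ ⟨h₁, _, h₂⟩ => ?_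
  obtain ⟨h₂, h₃⟩ := h₂ u hu
  exact ⟨h₂, .inr (.inl ⟨by omega, h₁, by simp [h₃, hb]⟩)⟩

/-- The state in which the execution of `init` has just been started. -/
def afterInit (T : TM Q Γ) (N : Numbering T) (S : List Γ) : State :=
  (impl T N S).initial.start (impl T N S) .init [.item (.fix [.call .transition])]

theorem term_afterInit (hS : S ≠ []) :
    Term (impl T N S) (RunState N 0 (0, S.length - 1) (T.initialConfig S)) (afterInit T N S) :=
  (term_init hS _).mono fun _ _ h => ⟨h.2.1, .inl ⟨rfl, h.1, h.2.2⟩⟩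

theorem initial_idle : (impl T N S).initial.Idle := by
  intro ℓ i hi
  cases ℓ with
  | null s =>
    simp only [Program.initial] at hi
    split_ifs at hi
    simp only [Option.some.injEq] at hi
    simp [← hi]
  | ref n => simp [Program.initial] at hi

theorem initial_trans : Trans (impl T N S) (impl T N S).initial (some .init) (afterInit T N S) :=
  .call initial_idle rfl

theorem eq_of_initial_trans {a : Option Ident} {P : State}
    (ht : Trans (impl T N S) (impl T N S).initial a P) : a = some .init ∧ P = afterInit T N S := by
  have hs : (impl T N S).initial.sched =
    [.item (.call .init), .item (.fix [.call .transition])] := rfl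
  rcases ht.of_idle initial_idle with ⟨F, r, h, rfl, rfl⟩ | ⟨s, F, r, h⟩ | ⟨sc, r, h, -, -⟩ |
    ⟨sc, r, st, h, -, -, -⟩ | ⟨sc, r, st, h, -, -, -⟩
  · rw [hs] at h
    simp only [List.cons.injEq, Pending.item.injEq, SchedItem.call.injEq] at h
    obtain ⟨rfl, rfl⟩ := h
    exact ⟨rfl, rfl⟩
  all_goals simp [hs] at h

/-- What is known of every reachable state: nothing has happened yet, or `init` and `k` times
`transition` have been started, and the current execution of a step will end in a state that encodes
the configuration after `k` transitions or, if the machine halts before, its last one. -/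
def Invariant (T : TM Q Γ) (N : Numbering T) (S : List Γ) (l : List Ident) (P : State) : Prop :=
  (l = [] ∧ P = (impl T N S).initial) ∨
  ∃ k e C, modelAt T S k = some (e, C) ∧
    ((l = runTrace k ∧ Term (impl T N S) (RunState N k e C) P) ∨
      (l = runTrace (k + 1) ∧ T.next C = none ∧ Term (impl T N S) (HaltState N e C) P))

theorem Reach.invariant (hS : S ≠ []) {l : List Ident} {P : State}
    (h : Reach (impl T N S) l P) : Invariant T N S l P := by
  induction h with
  | initial => exact .inl ⟨rfl, rfl⟩
  | @trans l P P' a hl ht ih =>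
    rcases ih with ⟨rfl, rfl⟩ | ⟨k, e, C, hM, ⟨rfl, hT⟩ | ⟨rfl, hC, hT⟩⟩
    · obtain ⟨rfl, rfl⟩ := eq_of_initial_trans ht
      exact .inr ⟨0, _, _, rfl, .inl ⟨rfl, term_afterInit hS⟩⟩
    · cases hT with
      | idle hi h =>
        rcases h.step ht with ⟨rfl, h', -, -⟩ | ⟨rfl, hb, rfl⟩
        · exact .inr ⟨k, e, C, hM, .inl ⟨by simp, .idle h'.1.idle h'⟩⟩
        · cases hu : T.δ C.state (C.tape 0) with
          | none =>
            have hC := next_eq_none.2 hu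
            exact .inr ⟨k, e, C, hM, .inr ⟨(runTrace_succ k).symm, hC,
              term_afterCall_of_halted h hb hC⟩⟩
          | some u =>
            exact .inr ⟨k + 1, _, _, modelAt_succ hM hu, .inl ⟨(runTrace_succ k).symm,
              term_afterCall h hb hu⟩⟩
      | step _ _ h₃ h₄ =>
        obtain rfl := h₃ _ _ ht
        exact .inr ⟨k, e, C, hM, .inl ⟨by simp, h₄ _ _ ht⟩⟩
    · cases hT with
      | idle hi h =>
        obtain ⟨rfl, h', -⟩ := h.step ht
        exact .inr ⟨k, e, C, hM, .inr ⟨by simp, hC, .idle h'.1.idle h'⟩⟩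
      | step _ _ h₃ h₄ =>
        obtain rfl := h₃ _ _ ht
        exact .inr ⟨k, e, C, hM, .inr ⟨by simp, hC, h₄ _ _ ht⟩⟩

theorem Reach.progress (hS : S ≠ []) {l : List Ident} {P : State} (h : Reach (impl T N S) l P) :
    P.Final ∨ ∃ a P', Trans (impl T N S) P a P' := by
  rcases h.invariant hS with ⟨-, rfl⟩ | ⟨k, e, C, -, ⟨-, hT⟩ | ⟨-, -, hT⟩⟩
  · exact .inr ⟨_, _, initial_trans⟩
  · cases hT with
    | idle _ h => exact .inr h.progress
    | step _ h => exact .inr ⟨none, h⟩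
  · cases hT with
    | idle _ h => exact h.progress
    | step _ h => exact .inr ⟨none, h⟩

/-- Every execution of a step ends. -/
theorem Reach.acc_none (hS : S ≠ []) {l : List Ident} {P : State} (h : Reach (impl T N S) l P) :
    Acc (Prec (impl T N S) {none}) P := by
  rcases h.invariant hS with ⟨-, rfl⟩ | ⟨k, e, C, -, ⟨-, hT⟩ | ⟨-, -, hT⟩⟩
  · refine ⟨_, ?_⟩
    rintro P' ⟨a, ha, ht⟩
    have := (eq_of_initial_trans ht).1
    rw [ha] at this
    cases this
  · exact hT.acc fun P' _ h => h.acc_of_afterCall fun h => by simp at h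
  · exact hT.acc fun P' _ h => h.acc

/-- If the machine halts, then there are no infinite executions. -/
theorem RunState.acc {k d : ℕ} {e : ℤ × ℤ} {C C' : TM.Config Q Γ}
    (hM : modelAt T S k = some (e, C)) (hC' : T.configAt S (k + d) = some C')
    (hn : T.next C' = none) {P : State} (h : RunState N k e C P) :
    Acc (Prec (impl T N S) Set.univ) P := by
  induction d generalizing k e C P with
  | zero =>
    obtain rfl : C = C' := by simpa [configAt_of_modelAt hM] using hC'
    exact h.acc_of_afterCall fun _ P h hb =>
      (term_afterCall_of_halted h hb hn).acc fun _ _ h => h.acc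
  | succ d ih =>
    cases hu : T.δ C.state (C.tape 0) with
    | none =>
      have hsome := modelAt_isSome_of_le (T := T) (S := S) (show k + 1 ≤ k + (d + 1) by omega)
        (by obtain ⟨e, he⟩ := exists_modelAt hC'; simp [he])
      simp [modelAt, hM, hu] at hsome
    | some u =>
      exact h.acc_of_afterCall fun _ P h hb => (term_afterCall h hb hu).acc fun _ _ h₁ =>
        ih (modelAt_succ hM hu) (by rwa [show k + 1 + d = k + (d + 1) by omega]) h₁

/-- Every configuration of the run is reached, right before `transition` is executed. -/
theorem exists_reach_runState (hS : S ≠ []) (N : Numbering T) {k : ℕ} {e : ℤ × ℤ}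
    {C : TM.Config Q Γ} (hM : modelAt T S k = some (e, C)) :
    ∃ P, Reach (impl T N S) (runTrace k) P ∧ RunState N k e C P ∧
      P.sched = [.item (.call .transition), .aFix [.call .transition]] ∧ P.stab = [true] := by
  have settle : ∀ {k e C P}, Reach (impl T N S) (runTrace k) P → RunState N k e C P →
      ∃ P, Reach (impl T N S) (runTrace k) P ∧ RunState N k e C P ∧
        P.sched = [.item (.call .transition), .aFix [.call .transition]] ∧ P.stab = [true] := by
    rintro k e C P hr ⟨hE, ⟨hk, h, hb⟩ | ⟨hk, h, hb⟩ | ⟨h, hb⟩⟩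
    · have := hr.trans (.fixInit hE.idle h)
      simp only [Option.toList_none, List.append_nil, hb] at this
      exact ⟨_, this, ⟨hE.of_store rfl, .inr (.inr ⟨rfl, rfl⟩)⟩, rfl, rfl⟩
    · have := hr.trans (.fixIter hE.idle h hb)
      simp only [Option.toList_none, List.append_nil] at this
      exact ⟨_, this, ⟨hE.of_store rfl, .inr (.inr ⟨rfl, rfl⟩)⟩, rfl, rfl⟩
    · exact ⟨_, hr, ⟨hE, .inr (.inr ⟨h, hb⟩)⟩, h, hb⟩
  induction k generalizing e C with
  | zero =>
    simp only [modelAt, Option.some.injEq, Prod.mk.injEq] at hM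
    obtain ⟨rfl, rfl⟩ := hM
    obtain ⟨P, hr, -, h⟩ := (term_afterInit (N := N) hS).exists_reach
      (Reach.initial.trans initial_trans)
    exact settle hr h
  | succ k ih =>
    obtain ⟨⟨e₀, C₀⟩, h₀, hM⟩ := Option.bind_eq_some_iff.1 hM
    obtain ⟨u, hu, he⟩ := Option.map_eq_some_iff.1 hM
    obtain ⟨P, hr, h, hs, hb⟩ := ih h₀
    simp only [Prod.mk.injEq] at he
    obtain ⟨rfl, rfl⟩ := he
    have hr' : Reach (impl T N S) (runTrace (k + 1)) (afterCall T N S P) := by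
      rw [runTrace_succ]; exact hr.trans (.call h.1.idle hs)
    obtain ⟨P', hr', -, h'⟩ := (term_afterCall (u := u) h hb hu).exists_reach hr'
    exact settle hr' h'

theorem exists_reach_final (hS : S ≠ []) (N : Numbering T) {k : ℕ} {C : TM.Config Q Γ}
    (hC : T.configAt S k = some C) (hn : T.next C = none) :
    ∃ P, Reach (impl T N S) (runTrace (k + 1)) P ∧ P.Final ∧ Corresponds N P C := by
  obtain ⟨e, hM⟩ := exists_modelAt hC
  obtain ⟨P, hr, h, hs, hb⟩ := exists_reach_runState hS N hM
  have hr' : Reach (impl T N S) (runTrace (k + 1)) (afterCall T N S P) := by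
    rw [runTrace_succ]; exact hr.trans (.call h.1.idle hs)
  obtain ⟨P', hr', hi, h'⟩ := (term_afterCall_of_halted h hb hn).exists_reach hr'
  rcases h'.progress (S := S) with hf | ⟨a, P'', ht⟩
  · exact ⟨P', hr', hf, h'.1.corresponds⟩
  · obtain ⟨rfl, h'', -, hs⟩ := h'.step ht
    exact ⟨P'', by simpa using hr'.trans ht, ⟨h''.1.idle, hs⟩, h''.1.corresponds⟩

theorem Reach.final (hS : S ≠ []) {l : List Ident} {P : State} (h : Reach (impl T N S) l P)
    (hf : P.Final) : ∃ k C, l = runTrace (k + 1) ∧ T.configAt S k = some C ∧ T.next C = none ∧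
      Corresponds N P C := by
  rcases h.invariant hS with ⟨-, rfl⟩ | ⟨k, e, C, hM, ⟨-, hT⟩ | ⟨hl, hn, hT⟩⟩
  · cases hf.2
  · obtain ⟨-, ⟨-, h, -⟩ | ⟨-, h, -⟩ | ⟨h, -⟩⟩ := hT.of_idle hf.1 <;> simp [hf.2] at h
  · exact ⟨k, C, hl, configAt_of_modelAt hM, hn, (hT.of_idle hf.1).1.corresponds⟩

/-- An idle state after `init` and `k` times `transition` encodes the configuration after `k`
transitions, if there is one. -/
theorem Reach.stateEncodes (hS : S ≠ []) {k : ℕ} {P : State}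
    (h : Reach (impl T N S) (runTrace k) P) (hi : P.Idle) {e : ℤ × ℤ} {C : TM.Config Q Γ}
    (hM : modelAt T S k = some (e, C)) : StateEncodes N P e C := by
  rcases h.invariant hS with ⟨hl, -⟩ | ⟨j, e', C', hM', ⟨hl, hT⟩ | ⟨hl, hn, hT⟩⟩
  · cases hl
  · obtain rfl := runTrace_injective hl
    rw [hM] at hM'
    simp only [Option.some.injEq, Prod.mk.injEq] at hM'
    obtain ⟨rfl, rfl⟩ := hM'
    exact (hT.of_idle hi).1
  · obtain rfl := runTrace_injective hl
    have := configAt_succ_eq_none (configAt_of_modelAt hM') hn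
    simp [configAt_of_modelAt hM] at this

/-- The execution of `transition` after the machine has halted preserves the encoding. -/
theorem Reach.stateEncodes_succ (hS : S ≠ []) {k : ℕ} {P : State}
    (h : Reach (impl T N S) (runTrace (k + 1)) P) (hi : P.Idle) {e : ℤ × ℤ} {C : TM.Config Q Γ}
    (hM : modelAt T S k = some (e, C)) (hn : T.next C = none) : StateEncodes N P e C := by
  rcases h.invariant hS with ⟨hl, -⟩ | ⟨j, e', C', hM', ⟨hl, hT⟩ | ⟨hl, hn', hT⟩⟩
  · cases hl
  · obtain rfl := runTrace_injective hl
    have := configAt_succ_eq_none (configAt_of_modelAt hM) hn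
    simp [configAt_of_modelAt hM'] at this
  · obtain rfl : k = j := by simpa using runTrace_injective hl
    rw [hM] at hM'
    simp only [Option.some.injEq, Prod.mk.injEq] at hM'
    obtain ⟨rfl, rfl⟩ := hM'
    exact (hT.of_idle hi).1

end

end AuDaLa

theorem theorem1 {Q Γ : Type*} [Fintype Q] [DecidableEq Q] [Fintype Γ] (T : TM Q Γ)
    (S : List Γ) (hS : S ≠ []) (hSin : ∀ s ∈ S, s ∈ T.inputSymbols) :
    -- states and symbols can be numbered as the construction of the program needs it
    Nonempty (AuDaLa.Numbering T) ∧
    ∀ N : AuDaLa.Numbering T,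
      -- the constructed program is an AuDaLa program
      (AuDaLa.impl T N S).WellFormed ∧
      -- an execution never gets stuck
      (∀ l P, AuDaLa.Reach (AuDaLa.impl T N S) l P →
        P.Final ∨ ∃ a P', AuDaLa.Trans (AuDaLa.impl T N S) P a P') ∧
      -- every execution of a step ends
      (¬ ∃ f : ℕ → AuDaLa.State, (∃ l, AuDaLa.Reach (AuDaLa.impl T N S) l (f 0)) ∧
        ∀ n, AuDaLa.Trans (AuDaLa.impl T N S) (f n) none (f (n + 1))) ∧
      -- every idle state after `init` and `k` times `transition` corresponds to the configuration
      -- after `k` transitions, or the `k`-th `transition` was the one after `T` halted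
      (∀ l P, AuDaLa.Reach (AuDaLa.impl T N S) l P → P.Idle → l ≠ [] →
        ∃ k, l = AuDaLa.runTrace k ∧
          ((∃ C, T.configAt S k = some C ∧ AuDaLa.Corresponds N P C) ∨
           (∃ j C, k = j + 1 ∧ T.configAt S j = some C ∧ T.next C = none ∧
              AuDaLa.Corresponds N P C))) ∧
      -- every configuration of the run is reached in this way
      (∀ k C, T.configAt S k = some C →
        ∃ P, AuDaLa.Reach (AuDaLa.impl T N S) (AuDaLa.runTrace k) P ∧
          AuDaLa.Corresponds N P C) ∧
      -- and by one idle state only, up to the names of labels; the `transition` after `T` halted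
      -- does not change it
      (∀ k C P P', T.configAt S k = some C →
        AuDaLa.Reach (AuDaLa.impl T N S) (AuDaLa.runTrace k) P → P.Idle →
        (AuDaLa.Reach (AuDaLa.impl T N S) (AuDaLa.runTrace k) P' ∨
          T.next C = none ∧ AuDaLa.Reach (AuDaLa.impl T N S) (AuDaLa.runTrace (k + 1)) P') →
        P'.Idle → AuDaLa.State.SameData (AuDaLa.impl T N S) P P') ∧
      -- the program ends only when `T` has halted, in a state corresponding to `T`'s last one
      (∀ l P, AuDaLa.Reach (AuDaLa.impl T N S) l P → P.Final →
        ∃ k C, l = AuDaLa.runTrace (k + 1) ∧ T.configAt S k = some C ∧ T.next C = none ∧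
          AuDaLa.Corresponds N P C) ∧
      -- halting
      (T.Halts S ↔ ∃ l P, AuDaLa.Reach (AuDaLa.impl T N S) l P ∧ P.Final) ∧
      (T.Halts S ↔ ¬ ∃ f : ℕ → AuDaLa.State, f 0 = (AuDaLa.impl T N S).initial ∧
        ∀ n, ∃ a, AuDaLa.Trans (AuDaLa.impl T N S) (f n) a (f (n + 1))) ∧
      -- acceptance
      (T.Accepts S ↔
        ∃ l P, AuDaLa.Reach (AuDaLa.impl T N S) l P ∧ P.Final ∧ P.HasAccepting true) := by
  refine ⟨AuDaLa.nonempty_numbering T, fun N => ?_⟩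
  have hfinal : T.Halts S ↔ ∃ l P, AuDaLa.Reach (AuDaLa.impl T N S) l P ∧ P.Final := by
    constructor
    · rintro ⟨k, C, hC, hn⟩
      obtain ⟨P, hr, hf, -⟩ := AuDaLa.exists_reach_final hS N hC hn
      exact ⟨_, P, hr, hf⟩
    · rintro ⟨l, P, hr, hf⟩
      obtain ⟨k, C, -, hC, hn, -⟩ := hr.final hS hf
      exact ⟨k, C, hC, hn⟩
  refine ⟨AuDaLa.impl_wellFormed T N S hS, fun l P h => h.progress hS, ?_, ?_, ?_, ?_,
    fun l P h hf => h.final hS hf, hfinal, ⟨?_, fun h => ?_⟩, ?_⟩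
  · rintro ⟨f, ⟨l, hl⟩, hf⟩
    exact AuDaLa.not_chain_of_acc (hl.acc_none hS) f rfl fun n => ⟨none, rfl, hf n⟩
  · intro l P h hi hl
    rcases h.invariant hS with ⟨h, -⟩ | ⟨k, e, C, hM, ⟨rfl, hT⟩ | ⟨rfl, hn, hT⟩⟩
    · exact absurd h hl
    · exact ⟨k, rfl, .inl ⟨C, AuDaLa.configAt_of_modelAt hM, (hT.of_idle hi).1.corresponds⟩⟩
    · exact ⟨k + 1, rfl, .inr ⟨k, C, rfl, AuDaLa.configAt_of_modelAt hM, hn,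
        (hT.of_idle hi).1.corresponds⟩⟩
  · intro k C hC
    obtain ⟨e, hM⟩ := AuDaLa.exists_modelAt hC
    obtain ⟨P, hr, h, -⟩ := AuDaLa.exists_reach_runState hS N hM
    exact ⟨P, hr, h.1.corresponds⟩
  · intro k C P P' hC hr hi hr' hi'
    obtain ⟨e, hM⟩ := AuDaLa.exists_modelAt hC
    refine (hr.stateEncodes hS hi hM).sameData ?_
    rcases hr' with hr' | ⟨hn, hr'⟩
    · exact hr'.stateEncodes hS hi' hM
    · exact hr'.stateEncodes_succ hS hi' hM hn
  · rintro ⟨k, C, hC, hn⟩ ⟨f, h0, hf⟩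
    -- after the start of `init`, the execution runs through states from which every execution ends
    have hacc : Acc (AuDaLa.Prec (AuDaLa.impl T N S) Set.univ) (AuDaLa.impl T N S).initial := by
      refine ⟨_, ?_⟩
      rintro P ⟨a, -, ht⟩
      obtain ⟨-, rfl⟩ := AuDaLa.eq_of_initial_trans ht
      exact (AuDaLa.term_afterInit hS).acc fun P _ h =>
        h.acc (k := 0) (d := k) rfl (by simpa using hC) hn
    exact AuDaLa.not_chain_of_acc hacc f h0 fun n => (hf n).imp fun a h => ⟨trivial, h⟩
  · by_contra hH
    -- no reachable state is final, so that every execution can be continued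
    have hnext : ∀ X : {P // ∃ l, AuDaLa.Reach (AuDaLa.impl T N S) l P},
        ∃ Y : {P // ∃ l, AuDaLa.Reach (AuDaLa.impl T N S) l P},
          ∃ a, AuDaLa.Trans (AuDaLa.impl T N S) X.1 a Y.1 := by
      rintro ⟨P, l, hl⟩
      rcases hl.progress hS with hf | ⟨a, P', ht⟩
      · exact absurd (hfinal.2 ⟨l, P, hl, hf⟩) hH
      · exact ⟨⟨P', _, hl.trans ht⟩, a, ht⟩
    choose g hg using hnext
    refine h ⟨fun n => (g^[n] ⟨_, [], .initial⟩).1, rfl, fun n => ?_⟩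
    simp only [Function.iterate_succ_apply']
    exact hg _
  · constructor
    · rintro ⟨k, C, hC, hn, hF⟩
      obtain ⟨P, hr, hf, hP⟩ := AuDaLa.exists_reach_final hS N hC hn
      exact ⟨_, P, hr, hf, by simpa [hF] using hP.2⟩
    · rintro ⟨l, P, hr, hf, c, hc, ha⟩
      obtain ⟨k, C, -, hC, hn, -, c', hc', ha'⟩ := hr.final hS hf
      obtain rfl := hc.unique hc'
      rw [ha] at ha'
      exact ⟨k, C, hC, hn, by simpa using ha'⟩
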